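/- Let $\Omega\subset\mathbb R^2$ be bounded, measurable and of positive Lebesgue measure. A countable set $\Lambda\subset\mathbb R^2$ is a *spectrum* of $\Omega$ if the exponentials $e_\lambda(x)=e^{2\pi i\langle\lambda,x\rangle}$, $\lambda\in\Lambda$, form an orthogonal basis of $L^2(\Omega)$ (they are mutually orthogonal and their span is dense), and $\Omega$ is *spectral* if it has a spectrum. A convex polygon is the convex hull of a finite set of points in $\mathbb R^2$, with non-empty interior. For a centrally symmetric convex polygon $\Omega$ and an edge $F$ of $\Omega$, let $\tau_F$ be the vector that carries the edge opposite to $F$ onto $F$; let $T=T(\Omega)$ be the group of all integer linear combinations of the vectors $\tau_F$, and let $T^*=\{\xi\in\mathbb R^2:\langle\xi,t\rangle\in\mathbb Z\text{ for all }t\in T\}$. **Theorem.** (i) Let $\Omega$ be a centrally symmetric convex hexagon in $\mathbb R^2$. Then $\Omega$ is spectral and its spectrum is unique up to translation. More precisely, $T$ is a lattice in $\mathbb R^2$, and a set $\Lambda\subset\mathbb R^2$ is a spectrum of $\Omega$ if and only if $\Lambda$ is a translate of the dual lattice $T^*$. (ii) More generally, let $\Omega$ be a spectral convex polygon in $\mathbb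 R^2$ which is not a parallelogram. Then $\Omega$ is centrally symmetric, its spectrum is unique up to translation, $T$ is a lattice in $\mathbb R^2$, and a set $\Lambda\subset\mathbb R^2$ is a spectrum of $\Omega$ if and only if $\Lambda$ is a translate of $T^*$. -/

import Mathlib

open scoped Pointwise

noncomputable section

open MeasureTheory

namespace SpectralPolytope

/-- The exponential function `e_ξ(x) = exp(2πi⟨ξ, x⟩)` on `ℝᵈ`. -/
def expFun {d : ℕ} (ξ x : EuclideanSpace ℝ (Fin d)) : ℂ :=
  Complex.exp (2 * (Real.pi : ℂ) * Complex.I * ((inner ℝ ξ x : ℝ) : ℂ))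

/-- `Λ` is a spectrum for `Ω`: here `Ω` is a bounded, measurable set of positive Lebesgue measure,
`Λ` is countable, and the exponentials `e_ξ`, `ξ ∈ Λ`, are an orthogonal basis of `L²(Ω)`, that is,
they are mutually orthogonal and their linear span is dense. -/
structure IsSpectrum {d : ℕ} (Ω Λ : Set (EuclideanSpace ℝ (Fin d))) : Prop where
  isBounded : Bornology.IsBounded Ω
  measurableSet : MeasurableSet Ω
  measure_pos : 0 < volume Ω
  countable : Λ.Countable
  orthogonal : ∀ ξ ∈ Λ, ∀ η ∈ Λ, ξ ≠ η →
    ∫ x in Ω, expFun ξ x * (starRingEnd ℂ) (expFun η x) = 0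
  complete : (Submodule.span ℂ {f : Lp ℂ 2 (volume.restrict Ω) |
    ∃ ξ ∈ Λ, f =ᵐ[volume.restrict Ω] expFun ξ}).topologicalClosure = ⊤

/-- `Ω` is a spectral set: it admits a spectrum. -/
def IsSpectral {d : ℕ} (Ω : Set (EuclideanSpace ℝ (Fin d))) : Prop :=
  ∃ Λ, IsSpectrum Ω Λ

/-- `Ω` has a spectrum, and any two spectra of `Ω` are translates of each other. -/
def HasUniqueSpectrumUpToTranslation {d : ℕ} (Ω : Set (EuclideanSpace ℝ (Fin d))) : Prop :=
  IsSpectral Ω ∧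
    ∀ Λ Λ', IsSpectrum Ω Λ → IsSpectrum Ω Λ' → ∃ v : EuclideanSpace ℝ (Fin d), Λ' = v +ᵥ Λ

/-- A convex polytope: the convex hull of finitely many points. -/
def IsConvexPolytope {d : ℕ} (Ω : Set (EuclideanSpace ℝ (Fin d))) : Prop :=
  ∃ s : Set (EuclideanSpace ℝ (Fin d)), s.Finite ∧ Ω = convexHull ℝ s

/-- `Ω` is symmetric with respect to some point `c`. -/
def IsCentrallySymmetric {d : ℕ} (Ω : Set (EuclideanSpace ℝ (Fin d))) : Prop :=
  ∃ c : EuclideanSpace ℝ (Fin d), Equiv.pointReflection c '' Ω = Ω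

/-- A convex hexagon in the plane: a convex polygon with exactly six vertices. -/
def IsConvexHexagon (Ω : Set (EuclideanSpace ℝ (Fin 2))) : Prop :=
  IsConvexPolytope Ω ∧ (Ω.extremePoints ℝ).ncard = 6

/-- A (nondegenerate) parallelogram in the plane. -/
def IsParallelogram (Ω : Set (EuclideanSpace ℝ (Fin 2))) : Prop :=
  ∃ (p : EuclideanSpace ℝ (Fin 2)) (v : Fin 2 → EuclideanSpace ℝ (Fin 2)),
    LinearIndependent ℝ v ∧ Ω = p +ᵥ parallelepiped v

/-- A facet of `Ω`: a nonempty exposed face of dimension `d - 1`. -/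
def IsFacet {d : ℕ} (Ω F : Set (EuclideanSpace ℝ (Fin d))) : Prop :=
  F.Nonempty ∧ IsExposed ℝ Ω F ∧ Module.finrank ℝ (vectorSpan ℝ F) + 1 = d

/-- The vectors `τ_F` carrying the facet opposite to `F` onto `F`, where `F` runs through the
facets of `Ω`. (In a convex polytope with nonempty interior, two distinct facets which are
translates of each other lie in parallel supporting hyperplanes, so that they are opposite.) -/
def facetTranslations {d : ℕ} (Ω : Set (EuclideanSpace ℝ (Fin d))) :
    Set (EuclideanSpace ℝ (Fin d)) :=
  {τ | ∃ F F', IsFacet Ω F ∧ IsFacet Ω F' ∧ F ≠ F' ∧ F = τ +ᵥ F'}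

/-- The group `T(Ω)` of all integer linear combinations of the vectors `τ_F`. -/
def facetGroup {d : ℕ} (Ω : Set (EuclideanSpace ℝ (Fin d))) :
    AddSubgroup (EuclideanSpace ℝ (Fin d)) :=
  AddSubgroup.closure (facetTranslations Ω)

/-- `L` is a lattice: the image of `ℤᵈ` under an invertible linear transformation, that is,
the set of integer combinations of the vectors of some basis of `ℝᵈ`. -/
def IsLatticeSubgroup {d : ℕ} (L : AddSubgroup (EuclideanSpace ℝ (Fin d))) : Prop :=
  ∃ b : Module.Basis (Fin d) ℝ (EuclideanSpace ℝ (Fin d)), L = AddSubgroup.closure (Set.range b)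

/-- The dual `L* = {ξ : ⟨t, ξ⟩ ∈ ℤ for all t ∈ L}`. -/
def dualLattice {d : ℕ} (L : AddSubgroup (EuclideanSpace ℝ (Fin d))) :
    Set (EuclideanSpace ℝ (Fin d)) :=
  {ξ | ∀ t ∈ L, ∃ n : ℤ, inner ℝ t ξ = n}

end SpectralPolytope

end

open scoped Pointwise

noncomputable section

open MeasureTheory

namespace SpectralPolytope

/-! Two exponentials are orthogonal on Ω exactly when the Fourier transform `ft Ω` vanishes at the
difference of their frequencies, and a spectrum is maximal among mutually orthogonal families. The
theorem thus rests on knowing where `ft Ω` vanishes. The divergence theorem (`green`) writes ‖ξ‖²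
`ft Ω ξ`, up to a constant, as a sum over the edges ab of det(ξ, b - a) times the integral of the
exponential along the edge.

Far out in a strip |⟨ξ, b - a⟩| ≤ M, the edges not parallel to ab contribute O(1), while those
parallel to ab carry a coefficient of order ‖ξ‖. At zeros of `ft Ω` the parallel edges must
therefore almost cancel (`IsPolygon.parallel_sum_small`). A spectrum Λ is relatively dense, by
Parseval applied to a bump function and its derivatives, so it has far apart pairs in arbitrarily
thin strips; there an edge integral has modulus close to 1, which forces every edge to have an
opposite edge of equal length (`IsPolygon.exists_opposite_of_spectrum`). For such a polygon the
difference of the support function at u and -u is linear, whence central symmetry.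

Let τ carry the opposite edge onto ab and put e = b - a. Cancellation now says that ⟨ξ, τ⟩ or ⟨ξ, e⟩
is nearly an integer at far zeros in the strip. The alternative ⟨ξ, e⟩ is disposed of when Ω is not
a parallelogram: then the interior of Ω meets its translate by e, and Parseval for b - z b(· - e)
shows that the points of Λ in a large ball cannot all have nearly the same product with e modulo 1.
Comparing two given points of Λ with two suitably chosen far ones shows that Λ - Λ has integral
products with τ (`IsPolygon.inner_translation_int`), that is, Λ - Λ ⊆ T*. Conversely opposite edges
cancel in `green` at nonzero points of T*, so maximality makes Λ a full translate of T*. T is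
discrete because a short vector cannot have integral products with Λ - Λ, and it spans because
otherwise `ft Ω` would vanish on a punctured line through 0, where its value is the area.

For a hexagon with centre c and vertices c ± A, c ± B, c ± C it remains to exhibit one spectrum: the
dual of the lattice L generated by A + B and B + C. Orthogonality holds because T ⊆ L. Completeness
needs only that the open hexagon injects into the torus of L, since the characters of the torus are
dense in its continuous functions. -/

/-- The Euclidean plane. -/
abbrev Plane := EuclideanSpace ℝ (Fin 2)

/-! ### The circle character and the distance to the integers -/

/-- The character `t ↦ exp(2πit)` of `ℝ`. -/
def ee (t : ℝ) : ℂ := Complex.exp (2 * (Real.pi : ℂ) * Complex.I * (t : ℂ))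

lemma expFun_eq {d : ℕ} (ξ x : EuclideanSpace ℝ (Fin d)) : expFun ξ x = ee (inner ℝ ξ x) := rfl

lemma ee_add (s t : ℝ) : ee (s + t) = ee s * ee t := by
  simp only [ee, ← Complex.exp_add]; congr 1; push_cast; ring

@[simp] lemma ee_zero : ee 0 = 1 := by simp [ee]

@[simp] lemma norm_ee (t : ℝ) : ‖ee t‖ = 1 := by
  have : (2 * (Real.pi : ℂ) * Complex.I * (t : ℂ)) = ((2 * Real.pi * t : ℝ) : ℂ) * Complex.I := by
    push_cast; ring
  rw [ee, this, Complex.norm_exp_ofReal_mul_I]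

@[simp] lemma conj_ee (t : ℝ) : (starRingEnd ℂ) (ee t) = ee (-t) := by
  simp only [ee, ← Complex.exp_conj]; congr 1
  simp [Complex.conj_ofReal, Complex.conj_ofNat]

lemma ee_int (n : ℤ) : ee n = 1 := by
  rw [ee, Complex.exp_eq_one_iff]; exact ⟨n, by push_cast; ring⟩

lemma ee_eq_one_iff (t : ℝ) : ee t = 1 ↔ ∃ n : ℤ, t = n := by
  constructor
  · intro h
    rw [ee, Complex.exp_eq_one_iff] at h
    obtain ⟨n, hn⟩ := h
    refine ⟨n, ?_⟩
    have h2 : (2 * (Real.pi : ℂ) * Complex.I) ≠ 0 := by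
      simp [Real.pi_ne_zero]
    have : (t : ℂ) = n := by
      apply mul_left_cancel₀ h2; rw [hn]; ring
    exact_mod_cast this
  · rintro ⟨n, rfl⟩; exact ee_int n

lemma continuous_ee : Continuous ee := by unfold ee; fun_prop

lemma hasDerivAt_ee (t : ℝ) : HasDerivAt ee (2 * (Real.pi : ℂ) * Complex.I * ee t) t := by
  have h : HasDerivAt (fun t : ℝ => 2 * (Real.pi : ℂ) * Complex.I * (t : ℂ))
      (2 * (Real.pi : ℂ) * Complex.I * 1) t :=
    (Complex.ofRealCLM.hasDerivAt (x := t)).const_mul _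
  have := h.cexp
  unfold ee
  convert this using 1; ring

/-- The distance of `exp(2πit)` to `1`, a subadditive measure of the distance of `t` to `ℤ`. -/
def circNorm (t : ℝ) : ℝ := ‖ee t - 1‖

lemma circNorm_nonneg (t : ℝ) : 0 ≤ circNorm t := norm_nonneg _

lemma circNorm_le_two (t : ℝ) : circNorm t ≤ 2 := by
  have := norm_sub_le (ee t) 1
  simp at this; unfold circNorm; linarith

lemma circNorm_eq_norm_sub (s t : ℝ) : circNorm (s - t) = ‖ee s - ee t‖ := by
  have : ee s - ee t = ee t * (ee (s - t) - 1) := by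
    rw [mul_sub, ← ee_add]; simp
  rw [this, norm_mul]; simp [circNorm]

lemma circNorm_neg (t : ℝ) : circNorm (-t) = circNorm t := by
  have h := circNorm_eq_norm_sub 0 t
  have h' := circNorm_eq_norm_sub t 0
  rw [zero_sub] at h; rw [sub_zero] at h'
  rw [h, h', norm_sub_rev]

lemma circNorm_sub_le (a b c : ℝ) : circNorm (a - c) ≤ circNorm (a - b) + circNorm (b - c) := by
  simp only [circNorm_eq_norm_sub]; exact norm_sub_le_norm_sub_add_norm_sub _ _ _

lemma circNorm_sub_comm (a b : ℝ) : circNorm (a - b) = circNorm (b - a) := by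
  rw [← circNorm_neg, neg_sub]

lemma circNorm_eq_zero_iff (t : ℝ) : circNorm t = 0 ↔ ∃ n : ℤ, t = n := by
  rw [← ee_eq_one_iff, circNorm, norm_eq_zero, sub_eq_zero]

lemma inner_self_eq_ofReal {H : Type*} [NormedAddCommGroup H] [InnerProductSpace ℂ H] (x : H) :
    inner ℂ x x = ((‖x‖ ^ 2 : ℝ) : ℂ) := by
  rw [inner_self_eq_norm_sq_to_K]; push_cast; rfl

/-! ### Exponentials in L², Parseval, maximality of spectra -/

section Hilbert

variable {d : ℕ} {Ω Λ : Set (EuclideanSpace ℝ (Fin d))}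

lemma continuous_expFun (ξ : EuclideanSpace ℝ (Fin d)) : Continuous (expFun ξ) := by
  have : expFun ξ = fun x => ee (inner ℝ ξ x) := rfl
  rw [this]; exact continuous_ee.comp (by fun_prop)

@[simp] lemma norm_expFun (ξ x : EuclideanSpace ℝ (Fin d)) : ‖expFun ξ x‖ = 1 := norm_ee _

lemma expFun_add_left (ξ η x : EuclideanSpace ℝ (Fin d)) :
    expFun (ξ + η) x = expFun ξ x * expFun η x := by
  simp only [expFun_eq, inner_add_left, ee_add]

lemma expFun_add_right (ξ x y : EuclideanSpace ℝ (Fin d)) :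
    expFun ξ (x + y) = expFun ξ x * expFun ξ y := by
  simp only [expFun_eq, inner_add_right, ee_add]

lemma conj_expFun (ξ x : EuclideanSpace ℝ (Fin d)) :
    (starRingEnd ℂ) (expFun ξ x) = expFun (-ξ) x := by
  simp only [expFun_eq, inner_neg_left, conj_ee]

lemma expFun_mul_conj (ξ η x : EuclideanSpace ℝ (Fin d)) :
    expFun ξ x * (starRingEnd ℂ) (expFun η x) = expFun (ξ - η) x := by
  rw [conj_expFun, ← expFun_add_left, sub_eq_add_neg]

lemma expFun_zero (x : EuclideanSpace ℝ (Fin d)) : expFun 0 x = 1 := by simp [expFun_eq]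

/-- The (inverse) Fourier transform of the indicator function of `Ω`. -/
def ft (Ω : Set (EuclideanSpace ℝ (Fin d))) (ξ : EuclideanSpace ℝ (Fin d)) : ℂ :=
  ∫ x in Ω, expFun ξ x

lemma memLp_expFun [IsFiniteMeasure (volume.restrict Ω)] (ξ : EuclideanSpace ℝ (Fin d)) :
    MemLp (expFun ξ) 2 (volume.restrict Ω) :=
  MemLp.of_bound (continuous_expFun ξ).aestronglyMeasurable 1 (by simp)

lemma isFiniteMeasure_restrict (h : Bornology.IsBounded Ω) :
    IsFiniteMeasure (volume.restrict Ω) :=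
  ⟨by simpa using h.measure_lt_top⟩

/-- The class of `expFun ξ` in `L²(Ω)`. -/
def expLp (Ω : Set (EuclideanSpace ℝ (Fin d))) [IsFiniteMeasure (volume.restrict Ω)]
    (ξ : EuclideanSpace ℝ (Fin d)) : Lp ℂ 2 (volume.restrict Ω) :=
  (memLp_expFun ξ).toLp _

lemma inner_expLp [IsFiniteMeasure (volume.restrict Ω)] (ξ : EuclideanSpace ℝ (Fin d))
    {g : EuclideanSpace ℝ (Fin d) → ℂ} (hg : MemLp g 2 (volume.restrict Ω)) :
    inner ℂ (expLp Ω ξ) (hg.toLp g) = ∫ x in Ω, expFun (-ξ) x * g x := by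
  rw [L2.inner_def]
  apply integral_congr_ae
  filter_upwards [(memLp_expFun (Ω := Ω) ξ).coeFn_toLp, hg.coeFn_toLp] with x hx hx'
  rw [expLp, hx, hx', RCLike.inner_apply, conj_expFun, mul_comm]

lemma inner_expLp_expLp [IsFiniteMeasure (volume.restrict Ω)] (ξ η : EuclideanSpace ℝ (Fin d)) :
    inner ℂ (expLp Ω ξ) (expLp Ω η) = ft Ω (η - ξ) := by
  rw [expLp, expLp, ← expLp, inner_expLp, ft]
  simp only [← expFun_add_left]
  congr! 3; abel

lemma ft_zero (Ω : Set (EuclideanSpace ℝ (Fin d))) : ft Ω 0 = (volume.real Ω : ℂ) := by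
  simp [ft, expFun_zero]

lemma volume_real_pos (h : Bornology.IsBounded Ω) (hp : 0 < volume Ω) : 0 < volume.real Ω :=
  ENNReal.toReal_pos hp.ne' h.measure_lt_top.ne

lemma norm_expLp_sq [IsFiniteMeasure (volume.restrict Ω)] (ξ : EuclideanSpace ℝ (Fin d)) :
    ‖expLp Ω ξ‖ ^ 2 = volume.real Ω := by
  have h := inner_self_eq_ofReal (expLp Ω ξ)
  rw [inner_expLp_expLp, sub_self, ft_zero] at h
  exact (Complex.ofReal_injective h).symm

lemma spanning_set_eq [IsFiniteMeasure (volume.restrict Ω)] :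
    {f : Lp ℂ 2 (volume.restrict Ω) | ∃ ξ ∈ Λ, f =ᵐ[volume.restrict Ω] expFun ξ} =
      expLp Ω '' Λ := by
  ext f
  simp only [Set.mem_ofPred_eq, Set.mem_image]
  constructor
  · rintro ⟨ξ, hξ, hf⟩
    refine ⟨ξ, hξ, ?_⟩
    apply Lp.ext
    exact (memLp_expFun ξ).coeFn_toLp.trans hf.symm
  · rintro ⟨ξ, hξ, rfl⟩
    exact ⟨ξ, hξ, (memLp_expFun ξ).coeFn_toLp⟩

lemma IsSpectrum.ft_eq_zero (h : IsSpectrum Ω Λ) {ξ η : EuclideanSpace ℝ (Fin d)} (hξ : ξ ∈ Λ)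
    (hη : η ∈ Λ) (hne : ξ ≠ η) : ft Ω (ξ - η) = 0 := by
  have := h.orthogonal ξ hξ η hη hne
  simpa only [expFun_mul_conj, ft] using this

/-- Parseval's identity for the orthogonal basis given by a spectrum. -/
lemma IsSpectrum.hasSum_sq (h : IsSpectrum Ω Λ) {g : EuclideanSpace ℝ (Fin d) → ℂ}
    (hg : MemLp g 2 (volume.restrict Ω)) :
    HasSum (fun ξ : Λ => ‖∫ x in Ω, expFun (-(ξ : EuclideanSpace ℝ (Fin d))) x * g x‖ ^ 2)
      (volume.real Ω * ∫ x in Ω, ‖g x‖ ^ 2) := by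
  have := isFiniteMeasure_restrict h.isBounded
  have hV := volume_real_pos h.isBounded h.measure_pos
  set V := volume.real Ω with hVdef
  -- Every exponential has squared norm V on Ω, so this factor normalises the family.
  set c : ℂ := (((Real.sqrt V)⁻¹ : ℝ) : ℂ) with hc
  have hs : 0 < Real.sqrt V := Real.sqrt_pos.2 hV
  have hc0 : c ≠ 0 := by rw [hc]; exact_mod_cast (inv_pos.2 hs).ne'
  have hcV : ‖c‖ ^ 2 * V = 1 := by
    rw [hc, Complex.norm_real, Real.norm_eq_abs, sq_abs, inv_pow, Real.sq_sqrt hV.le]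
    field_simp
  let v : Λ → Lp ℂ 2 (volume.restrict Ω) := fun ξ => c • expLp Ω ξ
  have hv : Orthonormal ℂ v := by
    constructor
    · intro ξ
      have : ‖v ξ‖ ^ 2 = 1 := by
        simp only [v]
        rw [norm_smul, mul_pow, norm_expLp_sq, hcV]
      have h0 := norm_nonneg (v ξ)
      nlinarith
    · intro ξ η hne
      simp only [v]
      rw [inner_smul_left, inner_smul_right, inner_expLp_expLp,
        h.ft_eq_zero η.2 ξ.2 (fun hh => hne (Subtype.ext hh.symm))]
      simp
  have hspan : ⊤ ≤ (Submodule.span ℂ (Set.range v)).topologicalClosure := by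
    have hcomp := h.complete
    rw [spanning_set_eq] at hcomp
    rw [← hcomp]
    apply Submodule.topologicalClosure_mono
    rw [Submodule.span_le]
    rintro _ ⟨ξ, hξ, rfl⟩
    have : expLp Ω ξ = c⁻¹ • v ⟨ξ, hξ⟩ := by simp [v, smul_smul, hc0]
    rw [this]
    exact Submodule.smul_mem _ _ (Submodule.subset_span ⟨_, rfl⟩)
  let b := HilbertBasis.mk hv hspan
  have hb : ∀ ξ, b ξ = v ξ := fun ξ => by simp [b]
  have key := b.hasSum_inner_mul_inner (hg.toLp g) (hg.toLp g)
  have key2 : HasSum (fun ξ : Λ => ‖inner ℂ (v ξ) (hg.toLp g)‖ ^ 2) (‖hg.toLp g‖ ^ 2) := by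
    rw [inner_self_eq_ofReal] at key
    have h1 : (fun i => inner ℂ (hg.toLp g) (b i) * inner ℂ (b i) (hg.toLp g)) =
        fun ξ : Λ => ((‖inner ℂ (v ξ) (hg.toLp g)‖ ^ 2 : ℝ) : ℂ) := by
      funext ξ
      rw [hb, ← inner_conj_symm, mul_comm, Complex.mul_conj, Complex.normSq_eq_norm_sq]
    rw [h1] at key
    exact Complex.hasSum_ofReal.1 key
  have hnorm : ‖hg.toLp g‖ ^ 2 = ∫ x in Ω, ‖g x‖ ^ 2 := by
    have h1 := inner_self_eq_ofReal (hg.toLp g)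
    rw [L2.inner_def] at h1
    have h2 : ∫ x in Ω, inner ℂ (hg.toLp g x) (hg.toLp g x) = ∫ x in Ω, ((‖g x‖ ^ 2 : ℝ) : ℂ) := by
      apply integral_congr_ae
      filter_upwards [hg.coeFn_toLp] with x hx
      rw [hx, inner_self_eq_ofReal]
    rw [h2, integral_complex_ofReal] at h1
    exact (Complex.ofReal_injective h1).symm
  have key3 := key2.mul_left V
  rw [hnorm] at key3
  refine key3.congr_fun ?_
  intro ξ
  simp only [v]
  rw [inner_smul_left, inner_expLp, norm_mul, mul_pow, ← mul_assoc]
  rw [RCLike.norm_conj, mul_comm V, hcV, one_mul]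

lemma IsSpectrum.eq_zero_of_orthogonal (h : IsSpectrum Ω Λ) {g : EuclideanSpace ℝ (Fin d) → ℂ}
    (hg : MemLp g 2 (volume.restrict Ω))
    (h0 : ∀ ξ ∈ Λ, ∫ x in Ω, expFun (-ξ) x * g x = 0) : ∫ x in Ω, ‖g x‖ ^ 2 = 0 := by
  have hV := volume_real_pos h.isBounded h.measure_pos
  have key := h.hasSum_sq hg
  have : (fun ξ : Λ => ‖∫ x in Ω, expFun (-(ξ : EuclideanSpace ℝ (Fin d))) x * g x‖ ^ 2) =
      fun _ => 0 := by
    funext ξ; rw [h0 ξ ξ.2]; simp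
  rw [this] at key
  have h1 := key.unique hasSum_zero
  rcases mul_eq_zero.1 h1 with h2 | h2
  · exact absurd h2 hV.ne'
  · exact h2

/-- A spectrum is maximal among the sets of mutually orthogonal exponentials. -/
lemma IsSpectrum.mem_of_orthogonal (h : IsSpectrum Ω Λ) {η : EuclideanSpace ℝ (Fin d)}
    (hη : ∀ ξ ∈ Λ, ξ ≠ η → ft Ω (η - ξ) = 0) : η ∈ Λ := by
  by_contra hmem
  have := isFiniteMeasure_restrict h.isBounded
  have hV := volume_real_pos h.isBounded h.measure_pos
  have := h.eq_zero_of_orthogonal (memLp_expFun η) (fun ξ hξ => by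
    have := hη ξ hξ (fun hh => hmem (hh ▸ hξ))
    rw [ft] at this
    rw [← this]; simp only [← expFun_add_left]
    congr! 3; abel)
  simp at this
  exact hV.ne' this

lemma IsSpectrum.nonempty (h : IsSpectrum Ω Λ) : Λ.Nonempty := by
  by_contra hne
  rw [Set.not_nonempty_iff_eq_empty] at hne
  have := h.mem_of_orthogonal (η := 0) (by simp [hne])
  simp [hne] at this

/-- A criterion for `Λ` to be a spectrum of `Ω`. -/
lemma isSpectrum_of_orthogonal_eq_zero (hb : Bornology.IsBounded Ω) (hm : MeasurableSet Ω)
    (hp : 0 < volume Ω) (hc : Λ.Countable)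
    (ho : ∀ ξ ∈ Λ, ∀ η ∈ Λ, ξ ≠ η → ft Ω (ξ - η) = 0)
    (hz : ∀ g : EuclideanSpace ℝ (Fin d) → ℂ, MemLp g 2 (volume.restrict Ω) →
      (∀ ξ ∈ Λ, ∫ x in Ω, expFun (-ξ) x * g x = 0) → g =ᵐ[volume.restrict Ω] 0) :
    IsSpectrum Ω Λ := by
  have := isFiniteMeasure_restrict hb
  refine ⟨hb, hm, hp, hc, ?_, ?_⟩
  · intro ξ hξ η hη hne
    simp only [expFun_mul_conj]
    exact ho ξ hξ η hη hne
  · rw [spanning_set_eq, Submodule.topologicalClosure_eq_top_iff, Submodule.eq_bot_iff]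
    intro g hg
    rw [Submodule.mem_orthogonal] at hg
    have := hz g (Lp.memLp g) (fun ξ hξ => by
      have := hg (expLp Ω ξ) (Submodule.subset_span ⟨ξ, hξ, rfl⟩)
      rw [← inner_expLp ξ (Lp.memLp g), Lp.toLp_coeFn, this])
    apply Lp.ext
    exact this.trans (Lp.coeFn_zero _ _ _).symm

lemma IsSpectrum.vadd (h : IsSpectrum Ω Λ) (v : EuclideanSpace ℝ (Fin d)) :
    IsSpectrum Ω (v +ᵥ Λ) := by
  have := isFiniteMeasure_restrict h.isBounded
  refine isSpectrum_of_orthogonal_eq_zero h.isBounded h.measurableSet h.measure_pos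
    (h.countable.image _) ?_ ?_
  · rintro _ ⟨ξ, hξ, rfl⟩ _ ⟨η, hη, rfl⟩ hne
    simp only [vadd_eq_add, add_sub_add_left_eq_sub]
    exact h.ft_eq_zero hξ hη (fun hh => hne (by rw [hh]))
  · intro g hg hz
    have hmem : MemLp (fun x => expFun (-v) x * g x) 2 (volume.restrict Ω) := by
      refine hg.of_le ((continuous_expFun _).aestronglyMeasurable.mul hg.1) ?_
      filter_upwards with x
      simp
    have := h.eq_zero_of_orthogonal hmem (fun ξ hξ => by
      rw [← hz (v + ξ) ⟨ξ, hξ, rfl⟩]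
      simp only [← mul_assoc, ← expFun_add_left]
      congr! 4; abel)
    rw [integral_eq_zero_iff_of_nonneg (fun _ => by positivity)] at this
    · filter_upwards [this] with x hx
      simpa using hx
    · exact hmem.integrable_norm_pow (by norm_num)

end Hilbert

/-! ### How densely a spectrum fills the plane -/

section Density

variable {Ω Λ : Set Plane}

lemma hasFDerivAt_expFun (ζ x : Plane) :
    HasFDerivAt (expFun ζ)
      ((2 * (Real.pi : ℂ) * Complex.I * expFun ζ x) • Complex.ofRealCLM.comp (innerSL ℝ ζ)) x := by
  have h1 : HasFDerivAt (fun x : Plane => (inner ℝ ζ x : ℝ)) (innerSL ℝ ζ) x :=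
    (innerSL ℝ ζ).hasFDerivAt
  have := (hasDerivAt_ee (inner ℝ ζ x)).hasFDerivAt.comp x h1
  refine HasFDerivAt.congr_fderiv (f := expFun ζ) this ?_
  ext y
  simp [expFun_eq, mul_comm]

/-- The (inverse) Fourier transform of `b`. -/
def fourierOf (b : Plane → ℂ) (ζ : Plane) : ℂ := ∫ x, expFun ζ x * b x

lemma fourierOf_fderiv {b : Plane → ℂ} (hb : ContDiff ℝ 1 b) (hc : HasCompactSupport b)
    (ζ v : Plane) :
    fourierOf (fun x => fderiv ℝ b x v) ζ =
      -(2 * (Real.pi : ℂ) * Complex.I * (inner ℝ ζ v : ℝ)) * fourierOf b ζ := by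
  have hdiff : ∀ x, fderiv ℝ (expFun ζ) x v =
      2 * (Real.pi : ℂ) * Complex.I * (inner ℝ ζ v : ℝ) * expFun ζ x := by
    intro x
    rw [(hasFDerivAt_expFun ζ x).fderiv]
    simp; ring
  have hcont : Continuous fun x => fderiv ℝ b x v :=
    (hb.continuous_fderiv (by norm_num)).clm_apply continuous_const
  have hcs : HasCompactSupport fun x => fderiv ℝ b x v := hc.fderiv_apply ℝ v
  have key := integral_mul_fderiv_eq_neg_fderiv_mul_of_integrable (μ := (volume : Measure Plane))
    (f := expFun ζ) (g := b) (v := v) (𝕜 := ℂ)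
    (by
      simp only [hdiff]
      exact ((continuous_const.mul (continuous_expFun ζ)).mul hb.continuous
        |>.integrable_of_hasCompactSupport hc.mul_left))
    (((continuous_expFun ζ).mul hcont).integrable_of_hasCompactSupport hcs.mul_left)
    (((continuous_expFun ζ).mul hb.continuous).integrable_of_hasCompactSupport hc.mul_left)
    (fun x _ => (hasFDerivAt_expFun ζ x).differentiableAt)
    (fun x _ => (hb.differentiable (by norm_num)).differentiableAt)
  unfold fourierOf
  rw [key]
  simp only [hdiff, mul_assoc]
  simp only [integral_const_mul]
  ring

lemma IsSpectrum.hasSum_fourierOf (h : IsSpectrum Ω Λ) {g : Plane → ℂ} (hg : Continuous g)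
    (hc : HasCompactSupport g) (hs : ∀ x, x ∉ Ω → g x = 0) (ξ₀ : Plane) :
    HasSum (fun ξ : Λ => ‖fourierOf g (ξ₀ - ξ)‖ ^ 2) (volume.real Ω * ∫ x, ‖g x‖ ^ 2) := by
  have := isFiniteMeasure_restrict h.isBounded
  have hcont : Continuous fun x => expFun ξ₀ x * g x := (continuous_expFun _).mul hg
  have hmem : MemLp (fun x => expFun ξ₀ x * g x) 2 (volume.restrict Ω) :=
    (hcont.memLp_of_hasCompactSupport hc.mul_left)
  have key := h.hasSum_sq hmem
  have h1 : ∫ x in Ω, ‖expFun ξ₀ x * g x‖ ^ 2 = ∫ x, ‖g x‖ ^ 2 := by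
    simp only [norm_mul, norm_expFun, one_mul]
    exact setIntegral_eq_integral_of_forall_compl_eq_zero (fun x hx => by simp [hs x hx])
  rw [h1] at key
  refine key.congr_fun ?_
  intro ξ
  rw [setIntegral_eq_integral_of_forall_compl_eq_zero (fun x hx => by simp [hs x hx])]
  unfold fourierOf
  congr 2
  simp only [← mul_assoc, ← expFun_add_left]
  congr! 4; abel

/-- Parseval for the two partial derivatives of b, added up: differentiation multiplies the
transform by a coordinate of the frequency, so the sum has a weight ‖ζ‖² and a value independent of
ξ₀. It controls the tail of the Parseval sum of b. -/
lemma IsSpectrum.weighted_sum_le (h : IsSpectrum Ω Λ) {b : Plane → ℂ} (hb : ContDiff ℝ 1 b)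
    (hc : HasCompactSupport b) (hs : tsupport b ⊆ Ω) :
    ∃ D : ℝ, ∀ ξ₀ : Plane,
      Summable (fun ξ : Λ => ‖ξ₀ - ξ‖ ^ 2 * ‖fourierOf b (ξ₀ - ξ)‖ ^ 2) ∧
      ∑' ξ : Λ, ‖ξ₀ - ξ‖ ^ 2 * ‖fourierOf b (ξ₀ - ξ)‖ ^ 2 ≤ D := by
  let e : Fin 2 → Plane := fun j => EuclideanSpace.single j 1
  let D : Fin 2 → ℝ := fun j => volume.real Ω * ∫ x, ‖fderiv ℝ b x (e j)‖ ^ 2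
  have hj : ∀ j ξ₀, HasSum (fun ξ : Λ => ‖fourierOf (fun x => fderiv ℝ b x (e j)) (ξ₀ - ξ)‖ ^ 2)
      (D j) := by
    intro j ξ₀
    refine h.hasSum_fourierOf
      ((hb.continuous_fderiv (by norm_num)).clm_apply continuous_const) (hc.fderiv_apply ℝ _) ?_ ξ₀
    intro x hx
    have : fderiv ℝ b x = 0 := by
      by_contra hne
      exact hx (hs (support_fderiv_subset ℝ (Function.mem_support.2 hne)))
    rw [this]; rfl
  have hsum : ∀ ξ₀ : Plane, HasSum (fun ξ : Λ => ‖ξ₀ - ξ‖ ^ 2 * ‖fourierOf b (ξ₀ - ξ)‖ ^ 2)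
      ((4 * Real.pi ^ 2)⁻¹ * (D 0 + D 1)) := by
    intro ξ₀
    refine (((hj 0 ξ₀).add (hj 1 ξ₀)).mul_left (4 * Real.pi ^ 2)⁻¹).congr_fun ?_
    intro ξ
    rw [fourierOf_fderiv hb hc, fourierOf_fderiv hb hc, EuclideanSpace.norm_sq_eq]
    simp only [e, Fin.sum_univ_two, norm_mul, norm_neg, mul_pow, Complex.norm_real]
    simp [EuclideanSpace.inner_single_right]
    field_simp
    ring
  exact ⟨_, fun ξ₀ => ⟨(hsum ξ₀).summable, (hsum ξ₀).tsum_eq.le⟩⟩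

/-- A smooth bump supported in a given ball. -/
lemma exists_bump (q : Plane) {r : ℝ} (hr : 0 < r) :
    ∃ b : Plane → ℂ, ContDiff ℝ 1 b ∧ HasCompactSupport b ∧ tsupport b ⊆ Metric.ball q r ∧
      0 < ∫ x, ‖b x‖ ^ 2 := by
  let f : ContDiffBump q := ⟨r / 4, r / 2, by positivity, by linarith⟩
  have hcont : Continuous fun x => ‖(f x : ℂ)‖ ^ 2 := by
    have := f.continuous; fun_prop
  have hcs : HasCompactSupport fun x => (f x : ℂ) :=
    f.hasCompactSupport.comp_left (g := fun t : ℝ => (t : ℂ)) (by simp)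
  refine ⟨fun x => (f x : ℂ), Complex.ofRealCLM.contDiff.comp f.contDiff, hcs, ?_, ?_⟩
  · have h1 : tsupport (fun x => (f x : ℂ)) ⊆ tsupport f :=
      closure_mono (Function.support_comp_subset (g := fun t : ℝ => (t : ℂ)) (by simp) _)
    refine h1.trans ?_
    rw [f.tsupport_eq]
    exact Metric.closedBall_subset_ball (by change r / 2 < r; linarith)
  · refine hcont.integral_pos_of_hasCompactSupport_nonneg_nonzero
      (hcs.comp_left (g := fun z : ℂ => ‖z‖ ^ 2) (by simp)) (fun x => by positivity) (x := q) ?_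
    have : f q = 1 := f.one_of_mem_closedBall (Metric.mem_closedBall_self (by positivity))
    simp [this]

/-- If all of Λ were farther than M from ξ₀, the weighted sum would be at least M² times the
Parseval sum B of a bump, which exceeds its bound D once M² B > D. -/
lemma IsSpectrum.exists_mem_near (h : IsSpectrum Ω Λ) {q : Plane} {r : ℝ} (hr : 0 < r)
    (hq : Metric.ball q r ⊆ Ω) : ∃ M : ℝ, 0 < M ∧ ∀ ξ₀ : Plane, ∃ ξ ∈ Λ, ‖ξ₀ - ξ‖ ≤ M := by
  obtain ⟨b, hb, hc, hs, hpos⟩ := exists_bump q hr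
  obtain ⟨D, hD⟩ := h.weighted_sum_le hb hc (hs.trans hq)
  have hV := volume_real_pos h.isBounded h.measure_pos
  set B := volume.real Ω * ∫ x, ‖b x‖ ^ 2 with hB
  have hBpos : 0 < B := mul_pos hV hpos
  obtain ⟨M, hM0, hM⟩ : ∃ M : ℝ, 0 < M ∧ D < M ^ 2 * B := by
    refine ⟨1 + |D| / B, by positivity, ?_⟩
    have h1 : 0 ≤ |D| / B := by positivity
    have h2 : |D| = |D| / B * B := by field_simp
    set t := |D| / B
    have := le_abs_self D
    nlinarith [mul_nonneg h1 hBpos.le, mul_nonneg (mul_nonneg h1 h1) hBpos.le]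
  refine ⟨M, hM0, fun ξ₀ => ?_⟩
  by_contra! hcon
  have h1 := h.hasSum_fourierOf hb.continuous hc
    (fun x hx => image_eq_zero_of_notMem_tsupport (fun hh => hx (hq (hs hh)))) ξ₀
  have h2 := h1.mul_left (M ^ 2)
  have h3 := hasSum_le (g := fun ξ : Λ => ‖ξ₀ - ξ‖ ^ 2 * ‖fourierOf b (ξ₀ - ξ)‖ ^ 2) (fun ξ => by
    have := hcon ξ ξ.2
    gcongr) h2 (hD ξ₀).1.hasSum
  have := (hD ξ₀).2
  linarith

/-- If `Ω` contains a ball and its translate by `e`, then the points of a spectrum near a given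
point cannot all have almost the same inner product with `e` modulo `1`. -/
lemma IsSpectrum.exists_mem_near_of_translate (h : IsSpectrum Ω Λ) {q e : Plane} {r : ℝ}
    (hr : 0 < r) (hre : 2 * r ≤ ‖e‖) (hq : Metric.ball q r ⊆ Ω)
    (hqe : ∀ x ∈ Metric.ball q r, x + e ∈ Ω) :
    ∃ M : ℝ, 0 < M ∧ ∀ (ξ₀ : Plane) (s₀ : ℝ), ∃ ξ ∈ Λ, ‖ξ₀ - ξ‖ ≤ M ∧
      1 / 2 ≤ circNorm (inner ℝ ξ e - s₀) := by
  obtain ⟨b, hb, hc, hs, hpos⟩ := exists_bump q hr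
  obtain ⟨D, hD⟩ := h.weighted_sum_le hb hc (hs.trans hq)
  have hV := volume_real_pos h.isBounded h.measure_pos
  set B := volume.real Ω * ∫ x, ‖b x‖ ^ 2 with hB
  have hBpos : 0 < B := mul_pos hV hpos
  -- The contradiction: points within M of ξ₀ contribute at most B / 4 (their factor is below
  -- (1/2)²), the others at most 4 / M² * D < B / 2, while the total is at least B.
  obtain ⟨M, hM0, hM⟩ : ∃ M : ℝ, 0 < M ∧ 4 / M ^ 2 * D < 1 / 2 * B := by
    refine ⟨3 + 8 * |D| / B, by positivity, ?_⟩
    have h1 : 0 ≤ |D| / B := by positivity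
    have h2 : |D| = |D| / B * B := by field_simp
    rw [div_mul_eq_mul_div, div_lt_iff₀ (by positivity)]
    have h3 : 8 * |D| / B = 8 * (|D| / B) := by ring
    rw [h3]
    set t := |D| / B
    have := le_abs_self D
    nlinarith [mul_nonneg h1 hBpos.le, mul_nonneg (mul_nonneg h1 h1) hBpos.le]
  refine ⟨M, hM0, fun ξ₀ s₀ => ?_⟩
  by_contra! hcon
  have hb0 : ∀ x, x ∉ Metric.ball q r → b x = 0 := fun x hx =>
    image_eq_zero_of_notMem_tsupport (fun hh => hx (hs hh))
  have h1 := h.hasSum_fourierOf hb.continuous hc (fun x hx => hb0 x (fun hh => hx (hq hh))) ξ₀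
  -- This phase makes the transform of g at ξ₀ - ξ equal to that of b times a factor of modulus
  -- `circNorm (inner ℝ ξ e - s₀)`.
  set z : ℂ := ee (s₀ - inner ℝ ξ₀ e) with hz
  let g : Plane → ℂ := fun x => b x - z * b (x - e)
  have hgcont : Continuous g := by
    have := hb.continuous; fun_prop
  have hgc : HasCompactSupport g := by
    refine hc.sub (HasCompactSupport.mul_left ?_)
    exact hc.comp_homeomorph (Homeomorph.subRight e)
  have h2 := h.hasSum_fourierOf hgcont hgc (fun x hx => by
    have h3 : b x = 0 := hb0 x (fun hh => hx (hq hh))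
    have h4 : b (x - e) = 0 := hb0 _ (fun hh => hx (by simpa using hqe _ hh))
    simp [g, h3, h4]) ξ₀
  have hint : ∀ ζ, Integrable fun x => expFun ζ x * b x := fun ζ =>
    ((continuous_expFun ζ).mul hb.continuous).integrable_of_hasCompactSupport hc.mul_left
  have htr : ∀ ζ, fourierOf g ζ = (1 - z * ee (inner ℝ ζ e)) * fourierOf b ζ := by
    intro ζ
    have h5 : ∀ x, expFun ζ x * g x =
        expFun ζ x * b x - z * ee (inner ℝ ζ e) * (expFun ζ (x - e) * b (x - e)) := by
      intro x
      have : expFun ζ x = expFun ζ (x - e) * ee (inner ℝ ζ e) := by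
        rw [← expFun_eq, ← expFun_add_right, sub_add_cancel]
      simp only [g]; rw [this]; ring
    unfold fourierOf
    simp only [h5]
    rw [integral_sub (hint ζ) (((hint ζ).comp_sub_right e).const_mul _), integral_const_mul,
      integral_sub_right_eq_self (fun x => expFun ζ x * b x) e]
    ring
  have hfac : ∀ ξ : Plane, ‖1 - z * ee (inner ℝ (ξ₀ - ξ) e)‖ = circNorm (inner ℝ ξ e - s₀) := by
    intro ξ
    rw [hz, ← ee_add, circNorm_sub_comm, norm_sub_rev, circNorm, inner_sub_left]
    congr 3; ring
  -- Since ‖e‖ ≥ 2r, the bump and its translate have disjoint supports, so nothing cancels in g.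
  have hnorm : ∫ x, ‖b x‖ ^ 2 ≤ ∫ x, ‖g x‖ ^ 2 := by
    apply integral_mono
    · exact (by have := hb.continuous; fun_prop : Continuous fun x => ‖b x‖ ^ 2)
        |>.integrable_of_hasCompactSupport (hc.comp_left (g := fun z : ℂ => ‖z‖ ^ 2) (by simp))
    · exact (by fun_prop : Continuous fun x => ‖g x‖ ^ 2)
        |>.integrable_of_hasCompactSupport (hgc.comp_left (g := fun z : ℂ => ‖z‖ ^ 2) (by simp))
    · intro x
      by_cases hx : x ∈ Metric.ball q r
      · have : b (x - e) = 0 := by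
          apply hb0
          intro hx'
          rw [Metric.mem_ball, dist_eq_norm] at hx hx'
          have h6 : ‖e‖ ≤ ‖x - q‖ + ‖x - e - q‖ := by
            have : e = (x - q) - (x - e - q) := by abel
            conv_lhs => rw [this]
            exact norm_sub_le _ _
          linarith
        simp [g, this]
      · simp [hb0 x hx]
  have hlow : B ≤ volume.real Ω * ∫ x, ‖g x‖ ^ 2 :=
    mul_le_mul_of_nonneg_left hnorm hV.le
  have hup := hasSum_le (fun ξ : Λ => by
    show ‖fourierOf g (ξ₀ - ξ)‖ ^ 2 ≤ (1 / 4) * ‖fourierOf b (ξ₀ - ξ)‖ ^ 2 +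
      4 / M ^ 2 * (‖ξ₀ - ξ‖ ^ 2 * ‖fourierOf b (ξ₀ - ξ)‖ ^ 2)
    rw [htr, norm_mul, hfac, mul_pow]
    have hn := circNorm_nonneg (inner ℝ (ξ : Plane) e - s₀)
    have hn2 := circNorm_le_two (inner ℝ (ξ : Plane) e - s₀)
    rw [← mul_assoc, ← add_mul]
    refine mul_le_mul_of_nonneg_right ?_ (by positivity)
    by_cases hle : ‖ξ₀ - ξ‖ ≤ M
    · have := hcon ξ ξ.2 hle
      have : circNorm (inner ℝ (ξ : Plane) e - s₀) ^ 2 ≤ 1 / 4 := by nlinarith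
      have : 0 ≤ 4 / M ^ 2 * ‖ξ₀ - ξ‖ ^ 2 := by positivity
      linarith
    · have h7 : circNorm (inner ℝ (ξ : Plane) e - s₀) ^ 2 ≤ 4 := by nlinarith
      have : 4 ≤ 4 / M ^ 2 * ‖ξ₀ - ξ‖ ^ 2 := by
        rw [div_mul_eq_mul_div, le_div_iff₀ (by positivity)]
        have : M ^ 2 ≤ ‖ξ₀ - ξ‖ ^ 2 := by
          exact pow_le_pow_left₀ hM0.le (not_le.1 hle).le 2
        linarith
      linarith) h2 ((h1.mul_left (1 / 4)).add ((hD ξ₀).1.hasSum.mul_left (4 / M ^ 2)))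
  have h8 := mul_le_mul_of_nonneg_left (hD ξ₀).2 (by positivity : 0 ≤ 4 / M ^ 2)
  linarith

end Density

/-! ### Plane determinants, oriented edges and supporting lines -/

section Edges

/-- The determinant of two vectors of the plane. -/
def det2 (p q : Plane) : ℝ := p 0 * q 1 - p 1 * q 0

/-- Rotation by a right angle. -/
def rot (u : Plane) : Plane := !₂[-u 1, u 0]

lemma inner_plane (u x : Plane) : (inner ℝ u x : ℝ) = u 0 * x 0 + u 1 * x 1 := by
  simp [PiLp.inner_apply, Fin.sum_univ_two]; ring

lemma norm_sq_plane (u : Plane) : ‖u‖ ^ 2 = u 0 ^ 2 + u 1 ^ 2 := by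
  simp [EuclideanSpace.norm_sq_eq, Fin.sum_univ_two]

lemma det2_add_right (p q r : Plane) : det2 p (q + r) = det2 p q + det2 p r := by
  simp [det2]; ring

lemma det2_sub_right (p q r : Plane) : det2 p (q - r) = det2 p q - det2 p r := by
  simp [det2]; ring

lemma det2_smul_right (p q : Plane) (c : ℝ) : det2 p (c • q) = c * det2 p q := by
  simp [det2]; ring

lemma det2_add_left (p q r : Plane) : det2 (p + q) r = det2 p r + det2 q r := by
  simp [det2]; ring

lemma det2_sub_left (p q r : Plane) : det2 (p - q) r = det2 p r - det2 q r := by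
  simp [det2]; ring

lemma det2_smul_left (p q : Plane) (c : ℝ) : det2 (c • p) q = c * det2 p q := by
  simp [det2]; ring

lemma det2_neg_left (p q : Plane) : det2 (-p) q = -det2 p q := by
  simp [det2]; ring

lemma det2_neg_right (p q : Plane) : det2 p (-q) = -det2 p q := by
  simp [det2]; ring

@[simp] lemma det2_self (p : Plane) : det2 p p = 0 := by simp [det2]; ring

@[simp] lemma det2_zero_right (p : Plane) : det2 p 0 = 0 := by simp [det2]

lemma det2_swap (p q : Plane) : det2 p q = -det2 q p := by simp [det2]; ring

lemma continuous_det2 (p : Plane) : Continuous (det2 p) := by unfold det2; fun_prop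

lemma det2_rot_left (u x : Plane) : det2 (rot u) x = -inner ℝ u x := by
  simp [det2, rot, inner_plane]; ring

lemma inner_rot_left (u x : Plane) : (inner ℝ (rot u) x : ℝ) = det2 u x := by
  simp [det2, rot, inner_plane]; ring

lemma norm_rot (u : Plane) : ‖rot u‖ = ‖u‖ := by
  have : ‖rot u‖ ^ 2 = ‖u‖ ^ 2 := by simp [norm_sq_plane, rot]; ring
  exact (pow_left_inj₀ (norm_nonneg _) (norm_nonneg _) two_ne_zero).1 this

/-- Expansion of w in the orthogonal frame d, `rot d`; it is what turns a vanishing determinant into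
proportionality. -/
lemma norm_sq_smul_eq (d w : Plane) :
    ‖d‖ ^ 2 • w = (inner ℝ d w : ℝ) • d + det2 d w • rot d := by
  ext i; fin_cases i <;> simp [det2, rot, inner_plane, norm_sq_plane] <;> ring

lemma inner_sq_add_det2_sq (d w : Plane) :
    (inner ℝ d w : ℝ) ^ 2 + det2 d w ^ 2 = ‖d‖ ^ 2 * ‖w‖ ^ 2 := by
  simp only [det2, inner_plane, norm_sq_plane]; ring

lemma eq_smul_of_det2_eq_zero {d w : Plane} (hd : d ≠ 0) (h : det2 d w = 0) :
    w = ((inner ℝ d w : ℝ) / ‖d‖ ^ 2) • d := by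
  have h1 := norm_sq_smul_eq d w
  rw [h, zero_smul, add_zero] at h1
  have h2 : ‖d‖ ^ 2 ≠ 0 := by simpa using hd
  rw [div_eq_inv_mul, mul_smul, ← h1, smul_smul, inv_mul_cancel₀ h2, one_smul]

/-- `a b` is an edge of `Ω`, oriented so that `Ω` lies to its left. -/
structure IsEdge (Ω : Set Plane) (a b : Plane) : Prop where
  ne : a ≠ b
  det2_nonneg : ∀ x ∈ Ω, 0 ≤ det2 (b - a) (x - a)
  face_eq : {x ∈ Ω | det2 (b - a) (x - a) = 0} = segment ℝ a b

variable {Ω : Set Plane} {a b c d : Plane}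

lemma IsEdge.sub_ne_zero (h : IsEdge Ω a b) : b - a ≠ 0 := by
  rw [_root_.sub_ne_zero]; exact h.ne.symm

lemma IsEdge.segment_subset (h : IsEdge Ω a b) : segment ℝ a b ⊆ Ω := by
  rw [← h.face_eq]; exact Set.sep_subset _ _

lemma IsEdge.left_mem (h : IsEdge Ω a b) : a ∈ Ω := h.segment_subset (left_mem_segment ℝ a b)

lemma IsEdge.right_mem (h : IsEdge Ω a b) : b ∈ Ω := h.segment_subset (right_mem_segment ℝ a b)

lemma IsEdge.exists_of_det2_eq_zero (h : IsEdge Ω a b) {x : Plane} (hx : x ∈ Ω)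
    (h0 : det2 (b - a) (x - a) = 0) : ∃ s : ℝ, 0 ≤ s ∧ s ≤ 1 ∧ x = a + s • (b - a) := by
  have : x ∈ segment ℝ a b := by rw [← h.face_eq]; exact ⟨hx, h0⟩
  rw [segment_eq_image'] at this
  obtain ⟨s, hs, rfl⟩ := this
  exact ⟨s, hs.1, hs.2, rfl⟩

lemma IsEdge.left_mem_extremePoints (h : IsEdge Ω a b) : a ∈ Ω.extremePoints ℝ := by
  rw [mem_extremePoints]
  refine ⟨h.left_mem, ?_⟩
  rintro x hx y hy ⟨s, t, hs, ht, hst, hxy⟩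
  have hx0 := h.det2_nonneg x hx
  have hy0 := h.det2_nonneg y hy
  have h1 : s * det2 (b - a) (x - a) + t * det2 (b - a) (y - a) = 0 := by
    rw [← det2_smul_right, ← det2_smul_right, ← det2_add_right]
    have : s • (x - a) + t • (y - a) = (s • x + t • y) - (s + t) • a := by module
    rw [this, hxy, hst]; simp
  obtain ⟨p, hp0, -, rfl⟩ := h.exists_of_det2_eq_zero hx (by nlinarith [mul_nonneg hs.le hx0, mul_nonneg ht.le hy0])
  obtain ⟨q, hq0, -, rfl⟩ := h.exists_of_det2_eq_zero hy (by nlinarith [mul_nonneg hs.le hx0, mul_nonneg ht.le hy0])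
  have h2 : (s * p + t * q) • (b - a) = 0 := by
    have : (s * p + t * q) • (b - a) =
        (s • (a + p • (b - a)) + t • (a + q • (b - a))) - (s + t) • a := by module
    rw [this, hxy, hst]; simp
  have h3 : s * p + t * q = 0 := (smul_eq_zero.1 h2).resolve_right h.sub_ne_zero
  have hp : p = 0 := by
    by_contra hne
    have : 0 < p := lt_of_le_of_ne hp0 (Ne.symm hne)
    nlinarith [mul_pos hs this, mul_nonneg ht.le hq0]
  have hq : q = 0 := by
    by_contra hne
    have : 0 < q := lt_of_le_of_ne hq0 (Ne.symm hne)
    nlinarith [mul_pos ht this, mul_nonneg hs.le hp0]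
  simp [hp, hq]

lemma IsEdge.right_mem_extremePoints (h : IsEdge Ω a b) : b ∈ Ω.extremePoints ℝ := by
  rw [mem_extremePoints]
  refine ⟨h.right_mem, ?_⟩
  rintro x hx y hy ⟨s, t, hs, ht, hst, hxy⟩
  have hx0 := h.det2_nonneg x hx
  have hy0 := h.det2_nonneg y hy
  have h1 : s * det2 (b - a) (x - a) + t * det2 (b - a) (y - a) = 0 := by
    rw [← det2_smul_right, ← det2_smul_right, ← det2_add_right]
    have : s • (x - a) + t • (y - a) = (s • x + t • y) - (s + t) • a := by module
    rw [this, hxy, hst]; simp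
  obtain ⟨p, -, hp0, rfl⟩ := h.exists_of_det2_eq_zero hx (by nlinarith [mul_nonneg hs.le hx0, mul_nonneg ht.le hy0])
  obtain ⟨q, -, hq0, rfl⟩ := h.exists_of_det2_eq_zero hy (by nlinarith [mul_nonneg hs.le hx0, mul_nonneg ht.le hy0])
  have h2 : (s * p + t * q - 1) • (b - a) = 0 := by
    have : (s * p + t * q - 1) • (b - a) =
        (s • (a + p • (b - a)) + t • (a + q • (b - a))) - (s + t) • a - (b - a) := by module
    rw [this, hxy, hst]; simp
  have h3 : s * p + t * q - 1 = 0 := (smul_eq_zero.1 h2).resolve_right h.sub_ne_zero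
  have hp : p = 1 := by
    by_contra hne
    have : 0 < 1 - p := by have := lt_of_le_of_ne hp0 hne; linarith
    nlinarith [mul_pos hs this, mul_nonneg ht.le (sub_nonneg.2 hq0)]
  have hq : q = 1 := by
    by_contra hne
    have : 0 < 1 - q := by have := lt_of_le_of_ne hq0 hne; linarith
    nlinarith [mul_pos ht this, mul_nonneg hs.le (sub_nonneg.2 hp0)]
  simp [hp, hq]

/-- Edges with the same direction coincide. -/
lemma IsEdge.eq_of_sub_eq_smul (h : IsEdge Ω a b) (h' : IsEdge Ω c d) {k : ℝ} (hk : 0 < k)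
    (heq : d - c = k • (b - a)) : a = c ∧ b = d := by
  have h1 := h.det2_nonneg c h'.left_mem
  have h2 := h'.det2_nonneg a h.left_mem
  rw [heq, det2_smul_left, ← neg_sub c a, det2_neg_right] at h2
  -- Each edge has the other on its left; as the directions agree, this gives the determinant both
  -- signs, so the edges are collinear and each is the whole face on that line.
  have h0 : det2 (b - a) (c - a) = 0 := by nlinarith
  have h0' : det2 (d - c) (a - c) = 0 := by
    rw [heq, det2_smul_left, ← neg_sub c a, det2_neg_right, h0]; simp
  have hd0 : det2 (b - a) (d - a) = 0 := by
    have : d - a = k • (b - a) + (c - a) := by rw [← heq]; abel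
    rw [this, det2_add_right, det2_smul_right, h0]; simp
  have hb0 : det2 (d - c) (b - c) = 0 := by
    have : b - c = (b - a) + (a - c) := by abel
    rw [this, det2_add_right, h0', heq, det2_smul_left]; simp
  obtain ⟨s, hs0, hs1, hc⟩ := h.exists_of_det2_eq_zero h'.left_mem h0
  obtain ⟨t, ht0, ht1, ha⟩ := h'.exists_of_det2_eq_zero h.left_mem h0'
  obtain ⟨s', hs0', hs1', hd⟩ := h.exists_of_det2_eq_zero h'.right_mem hd0
  obtain ⟨t', ht0', ht1', hb⟩ := h'.exists_of_det2_eq_zero h.right_mem hb0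
  have e1 : (s + t * k) • (b - a) = 0 := by
    have : (s + t * k) • (b - a) = (a + s • (b - a) - a) + t • (k • (b - a)) := by module
    rw [this, ← hc, ← heq]
    have : t • (d - c) = a - c := by rw [eq_comm, sub_eq_iff_eq_add']; exact ha
    rw [this]; abel
  have e2 := (smul_eq_zero.1 e1).resolve_right h.sub_ne_zero
  have hs : s = 0 := by nlinarith [mul_nonneg ht0 hk.le]
  have hac : a = c := by rw [hc, hs]; simp
  refine ⟨hac, ?_⟩
  subst hac
  have e3 : (s' - k) • (b - a) = 0 := by
    rw [sub_smul, ← heq, sub_eq_zero, eq_comm, sub_eq_iff_eq_add']; exact hd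
  have e4 := (smul_eq_zero.1 e3).resolve_right h.sub_ne_zero
  have e5 : (t' * k - 1) • (b - a) = 0 := by
    rw [sub_smul, one_smul, mul_smul, ← heq, sub_eq_zero, eq_comm, sub_eq_iff_eq_add']; exact hb
  have e6 := (smul_eq_zero.1 e5).resolve_right h.sub_ne_zero
  have hk1 : k = 1 := by nlinarith
  rw [hk1, one_smul, sub_left_inj] at heq
  exact heq.symm

/-- The face of `Ω` on which the functional `det2 d` is minimal is a vertex or an edge. -/
lemma exists_vertex_or_edge (hc : IsCompact Ω) (hconv : Convex ℝ Ω) (hne : Ω.Nonempty)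
    {d : Plane} (hd : d ≠ 0) :
    (∃ p ∈ Ω.extremePoints ℝ, ∀ x ∈ Ω, x ≠ p → 0 < det2 d (x - p)) ∨
    ∃ a b, IsEdge Ω a b ∧ ∃ k : ℝ, 0 < k ∧ b - a = k • d := by
  obtain ⟨p, hp, hmin⟩ := hc.exists_isMinOn hne (continuous_det2 d).continuousOn
  set F := {x ∈ Ω | det2 d x = det2 d p} with hF
  have hFc : IsCompact F := hc.inter_right (isClosed_eq (continuous_det2 d) continuous_const)
  have hFne : F.Nonempty := ⟨p, hp, rfl⟩
  have hinn : Continuous fun x : Plane => (inner ℝ d x : ℝ) := by fun_prop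
  obtain ⟨a, ha, hamin⟩ := hFc.exists_isMinOn hFne hinn.continuousOn
  obtain ⟨b, hb, hbmax⟩ := hFc.exists_isMaxOn hFne hinn.continuousOn
  have hd2 : 0 < ‖d‖ ^ 2 := by positivity
  have hge : ∀ x ∈ Ω, 0 ≤ det2 d (x - a) := by
    intro x hx
    have := hmin hx
    simp only [Set.mem_ofPred_eq] at this
    rw [det2_sub_right, ha.2]; linarith
  have hpar : ∀ x ∈ Ω, det2 d (x - a) = 0 → ∃ t : ℝ, 0 ≤ t ∧
      t ≤ (inner ℝ d (b - a) : ℝ) / ‖d‖ ^ 2 ∧ x = a + t • d := by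
    intro x hx h0
    have hxF : x ∈ F := ⟨hx, by rw [det2_sub_right, ha.2] at h0; linarith⟩
    have h1 := hamin hxF
    have h2 := hbmax hxF
    simp only [Set.mem_ofPred_eq] at h1 h2
    refine ⟨(inner ℝ d (x - a) : ℝ) / ‖d‖ ^ 2, ?_, ?_, ?_⟩
    · rw [inner_sub_right]; apply div_nonneg _ hd2.le; linarith
    · rw [inner_sub_right, inner_sub_right]; gcongr
    · rw [← eq_smul_of_det2_eq_zero hd h0]; abel
  have hb0 : det2 d (b - a) = 0 := by rw [det2_sub_right, ha.2, hb.2]; simp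
  have hbeq := eq_smul_of_det2_eq_zero hd hb0
  set k := (inner ℝ d (b - a) : ℝ) / ‖d‖ ^ 2 with hk
  have hk0 : 0 ≤ k := by
    obtain ⟨t, h1, h2, -⟩ := hpar b hb.1 hb0
    linarith
  -- The minimal face is the segment from a to b = a + k d, so k = 0 means a single point.
  rcases hk0.eq_or_lt with hk0 | hk0
  · left
    have hpos : ∀ x ∈ Ω, x ≠ a → 0 < det2 d (x - a) := by
      intro x hx hxa
      refine lt_of_le_of_ne (hge x hx) (fun h0 => hxa ?_)
      obtain ⟨t, h1, h2, h3⟩ := hpar x hx h0.symm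
      have : t = 0 := by linarith
      rw [h3, this]; simp
    refine ⟨a, ?_, hpos⟩
    rw [mem_extremePoints]
    refine ⟨ha.1, ?_⟩
    rintro x hx y hy ⟨s, t, hs, ht, hst, hxy⟩
    have h1 : s * det2 d (x - a) + t * det2 d (y - a) = 0 := by
      rw [← det2_smul_right, ← det2_smul_right, ← det2_add_right]
      have : s • (x - a) + t • (y - a) = (s • x + t • y) - (s + t) • a := by module
      rw [this, hxy, hst]; simp
    constructor
    · by_contra hne
      nlinarith [mul_pos hs (hpos x hx hne), mul_nonneg ht.le (hge y hy)]
    · by_contra hne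
      nlinarith [mul_pos ht (hpos y hy hne), mul_nonneg hs.le (hge x hx)]
  · right
    refine ⟨a, b, ⟨?_, ?_, ?_⟩, k, hk0, hbeq⟩
    · rintro rfl
      simp [hk] at hk0
    · intro x hx
      rw [hbeq, det2_smul_left]
      exact mul_nonneg hk0.le (hge x hx)
    · ext x
      constructor
      · rintro ⟨hx, h0⟩
        rw [hbeq, det2_smul_left] at h0
        obtain ⟨t, h1, h2, h3⟩ := hpar x hx ((mul_eq_zero.1 h0).resolve_left hk0.ne')
        rw [segment_eq_image']
        refine ⟨t / k, ⟨by positivity, (div_le_one hk0).2 h2⟩, ?_⟩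
        simp only
        rw [hbeq, smul_smul, div_mul_cancel₀ _ hk0.ne', h3]
      · intro hx
        refine ⟨hconv.segment_subset ha.1 hb.1 hx, ?_⟩
        rw [segment_eq_image'] at hx
        obtain ⟨s, -, rfl⟩ := hx
        simp [det2_smul_right]

/-- Hahn–Banach separates p from the open interior; the inequality passes to Ω, which lies in the
closure of its interior, and a quarter turn expresses the functional through `det2`. -/
lemma exists_support (hconv : Convex ℝ Ω) (hint : (interior Ω).Nonempty) {p : Plane}
    (hp : p ∉ interior Ω) : ∃ d : Plane, d ≠ 0 ∧ ∀ x ∈ Ω, 0 ≤ det2 d (x - p) := by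
  obtain ⟨f, hf⟩ := geometric_hahn_banach_open_point hconv.interior isOpen_interior hp
  set u := (InnerProductSpace.toDual ℝ Plane).symm f with hu
  have hfu : ∀ x, f x = inner ℝ u x := fun x => by
    rw [hu, InnerProductSpace.toDual_symm_apply]
  have hle : ∀ x ∈ Ω, f x ≤ f p := by
    have h1 : closure (interior Ω) ⊆ {x | f x ≤ f p} :=
      closure_minimal (fun x hx => (hf x hx).le) (isClosed_le f.continuous continuous_const)
    intro x hx
    refine h1 ?_
    rw [hconv.closure_interior_eq_closure_of_nonempty_interior hint]
    exact subset_closure hx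
  refine ⟨rot u, ?_, ?_⟩
  · intro h0
    obtain ⟨x, hx⟩ := hint
    have h1 := hf x hx
    have h2 : u = 0 := by rw [← norm_eq_zero, ← norm_rot, h0, norm_zero]
    rw [hfu, hfu, h2] at h1
    simp at h1
  · intro x hx
    have := hle x hx
    rw [det2_rot_left, inner_sub_right, ← hfu, ← hfu]; linarith

/-- The set of oriented edges of `Ω`. -/
def edgeSet (Ω : Set Plane) : Set (Plane × Plane) := {e | IsEdge Ω e.1 e.2}

lemma finite_edgeSet (h : (Ω.extremePoints ℝ).Finite) : (edgeSet Ω).Finite :=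
  (h.prod h).subset fun _ he => ⟨IsEdge.left_mem_extremePoints he, IsEdge.right_mem_extremePoints he⟩

end Edges

/-! ### The divergence theorem, by slicing along lines parallel to the frequency -/

section Green

variable {Ω : Set Plane} {a b : Plane}

lemma exists_add_smul_mem_of_mem_interior {x : Plane} (hx : x ∈ interior Ω) (w : Plane) :
    ∃ ε : ℝ, 0 < ε ∧ x + ε • w ∈ interior Ω := by
  have hcont : Continuous fun ε : ℝ => x + ε • w := by fun_prop
  have h1 : ∀ᶠ ε : ℝ in nhds 0, x + ε • w ∈ interior Ω := by
    apply hcont.continuousAt.eventually_mem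
    simpa using isOpen_interior.mem_nhds hx
  have h2 : ∀ᶠ ε : ℝ in nhdsWithin 0 (Set.Ioi 0), x + ε • w ∈ interior Ω :=
    h1.filter_mono nhdsWithin_le_nhds
  obtain ⟨ε, h3, h4⟩ := (h2.and self_mem_nhdsWithin).exists
  exact ⟨ε, h4, h3⟩

lemma det2_pos_of_mem_interior {d p x : Plane} (hd : d ≠ 0)
    (h : ∀ x ∈ Ω, 0 ≤ det2 d (x - p)) (hx : x ∈ interior Ω) : 0 < det2 d (x - p) := by
  obtain ⟨ε, hε, hmem⟩ := exists_add_smul_mem_of_mem_interior hx (-rot d)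
  have := h _ (interior_subset hmem)
  have h2 : x + ε • -rot d - p = (x - p) - ε • rot d := by module
  rw [h2, det2_sub_right, det2_smul_right, det2_swap d (rot d), det2_rot_left,
    real_inner_self_eq_norm_sq] at this
  have : 0 < ε * ‖d‖ ^ 2 := by positivity
  linarith

/-- As no vertex has height y, an interior point on one side of the slice can be joined to a vertex
strictly on the other side, and all points of that segment except the vertex are interior. -/
lemma exists_mem_interior_of_height (hc : IsCompact Ω) (hconv : Convex ℝ Ω)
    (hint : (interior Ω).Nonempty) {v : Plane} (hv : v ≠ 0) {y : ℝ}
    (hy : ∀ p ∈ Ω.extremePoints ℝ, det2 v p ≠ y) {q : Plane} (hq : q ∈ Ω) (hqy : det2 v q = y) :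
    ∃ x ∈ interior Ω, det2 v x = y := by
  have key : ∀ (u : Plane) (z : ℝ), u ≠ 0 → (∀ p ∈ Ω.extremePoints ℝ, det2 u p ≠ z) →
      det2 u q = z → ∀ x ∈ interior Ω, z < det2 u x → ∃ x ∈ interior Ω, det2 u x = z := by
    intro u z hu hz hqz x hx hzx
    obtain ⟨p, hp, hple⟩ : ∃ p ∈ Ω.extremePoints ℝ, det2 u p ≤ z := by
      rcases exists_vertex_or_edge hc hconv ⟨q, hq⟩ hu with ⟨p, hp, hmin⟩ | ⟨a, b, hab, k, hk, hk2⟩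
      · refine ⟨p, hp, ?_⟩
        rcases eq_or_ne q p with rfl | hne
        · exact hqz.le
        · have := hmin q hq hne
          rw [det2_sub_right] at this; linarith
      · refine ⟨a, hab.left_mem_extremePoints, ?_⟩
        have := hab.det2_nonneg q hq
        rw [hk2, det2_smul_left, det2_sub_right] at this
        have := nonneg_of_mul_nonneg_right this hk
        linarith
    have hlt : det2 u p < z := lt_of_le_of_ne hple (hz p hp)
    have hD : 0 < det2 u x - det2 u p := by linarith
    set t := (z - det2 u p) / (det2 u x - det2 u p) with ht
    have ht0 : 0 < t := div_pos (by linarith) hD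
    have ht1 : t ≤ 1 := (div_le_one hD).2 (by linarith)
    refine ⟨t • x + (1 - t) • p, hconv.combo_interior_self_mem_interior hx hp.1 ht0
      (by linarith) (by ring), ?_⟩
    rw [det2_add_right, det2_smul_right, det2_smul_right]
    have : t * (det2 u x - det2 u p) = z - det2 u p := div_mul_cancel₀ _ hD.ne'
    linarith
  obtain ⟨x, hx⟩ := hint
  rcases lt_trichotomy (det2 v x) y with hlt | heq | hgt
  · obtain ⟨x', h1, h2⟩ := key (-v) (-y) (neg_ne_zero.2 hv)
      (fun p hp h => hy p hp (by rw [det2_neg_left] at h; linarith))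
      (by rw [det2_neg_left, hqy]) x hx (by rw [det2_neg_left]; linarith)
    exact ⟨x', h1, by rw [det2_neg_left] at h2; linarith⟩
  · exact ⟨x, hx, heq⟩
  · exact key v y hv hy hqy x hx hgt

/-- The point of the line through `a` and `b` at height `y`, where the height of `p` is
`det2 v p`. -/
def crossPt (v : Plane) (y : ℝ) (a b : Plane) : Plane :=
  a + ((y - det2 v a) / (det2 v b - det2 v a)) • (b - a)

lemma det2_crossPt {v : Plane} {y : ℝ} (h : det2 v a ≠ det2 v b) :
    det2 v (crossPt v y a b) = y := by
  have : det2 v b - det2 v a ≠ 0 := sub_ne_zero.2 h.symm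
  rw [crossPt, det2_add_right, det2_smul_right, det2_sub_right, div_mul_cancel₀ _ this]
  ring

lemma crossPt_mem_openSegment {v : Plane} {y : ℝ} (h1 : det2 v a < y) (h2 : y < det2 v b) :
    ∃ s : ℝ, 0 < s ∧ s < 1 ∧ crossPt v y a b = a + s • (b - a) :=
  ⟨_, div_pos (by linarith) (by linarith), (div_lt_one (by linarith)).2 (by linarith), rfl⟩

lemma IsEdge.add_smul_mem (h : IsEdge Ω a b) {s : ℝ} (h0 : 0 ≤ s) (h1 : s ≤ 1) :
    a + s • (b - a) ∈ Ω := by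
  apply h.segment_subset
  rw [segment_eq_image']
  exact ⟨s, ⟨h0, h1⟩, rfl⟩

/-- An edge going up through height y has Ω on its left, and v points to the right, so it meets the
slice at its right end. -/
lemma IsEdge.inner_le_inner_crossPt (h : IsEdge Ω a b) {v : Plane} (hv : v ≠ 0) {y : ℝ}
    (h1 : det2 v a < y) (h2 : y < det2 v b) {q : Plane} (hq : q ∈ Ω) (hqy : det2 v q = y) :
    (inner ℝ v q : ℝ) ≤ inner ℝ v (crossPt v y a b) := by
  set p := crossPt v y a b with hp
  have hpy : det2 v p = y := det2_crossPt (by linarith)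
  have h3 := h.det2_nonneg q hq
  have h4 : det2 (b - a) (p - a) = 0 := by simp [hp, crossPt, det2_smul_right]
  have h5 : 0 ≤ det2 (b - a) (q - p) := by
    have : q - p = (q - a) - (p - a) := by abel
    rw [this, det2_sub_right, h4]; linarith
  have h6 := eq_smul_of_det2_eq_zero hv (w := q - p) (by rw [det2_sub_right, hqy, hpy, sub_self])
  set k := (inner ℝ v (q - p) : ℝ) / ‖v‖ ^ 2 with hk
  rw [h6, det2_smul_right, det2_swap, det2_sub_right] at h5
  have h7 : k ≤ 0 := by
    by_contra hcon
    push Not at hcon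
    nlinarith [mul_pos hcon (by linarith : 0 < det2 v b - det2 v a)]
  have h8 : (inner ℝ v (q - p) : ℝ) ≤ 0 := by
    have hv2 : 0 < ‖v‖ ^ 2 := by positivity
    by_contra hcon
    push Not at hcon
    exact absurd h7 (not_le.2 (div_pos hcon hv2))
  rw [inner_sub_right] at h8; linarith

/-- The right end q of a slice is a boundary point, as an interior one could be pushed along v. A
supporting line at q cuts out an edge, since q is not a vertex, and this edge goes upwards because
an interior point at the same height lies to the left of q. -/
lemma exists_edge_crossing (hc : IsCompact Ω) (hconv : Convex ℝ Ω)
    (hint : (interior Ω).Nonempty) {v : Plane} (hv : v ≠ 0) {y : ℝ}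
    (hy : ∀ p ∈ Ω.extremePoints ℝ, det2 v p ≠ y) {q : Plane} (hq : q ∈ Ω) (hqy : det2 v q = y)
    (hmax : ∀ x ∈ Ω, det2 v x = y → (inner ℝ v x : ℝ) ≤ inner ℝ v q) :
    ∃ a b, IsEdge Ω a b ∧ det2 v a < y ∧ y < det2 v b := by
  have hqi : q ∉ interior Ω := by
    intro hqi
    obtain ⟨ε, hε, hmem⟩ := exists_add_smul_mem_of_mem_interior hqi v
    have := hmax _ (interior_subset hmem) (by rw [det2_add_right, det2_smul_right, hqy]; simp)
    rw [inner_add_right, inner_smul_right, real_inner_self_eq_norm_sq] at this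
    have : 0 < ε * ‖v‖ ^ 2 := by positivity
    linarith
  obtain ⟨d, hd, hsup⟩ := exists_support hconv hint hqi
  rcases exists_vertex_or_edge hc hconv ⟨q, hq⟩ hd with ⟨p, hp, hmin⟩ | ⟨a, b, hab, k, hk, hk2⟩
  · exfalso
    rcases eq_or_ne q p with rfl | hne
    · exact hy q hp hqy
    · have h1 := hmin q hq hne
      have h2 := hsup p hp.1
      rw [← neg_sub, det2_neg_right] at h2
      linarith
  · have h1 := hab.det2_nonneg q hq
    have h2 := hsup a hab.left_mem
    rw [← neg_sub, det2_neg_right] at h2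
    have h0 : det2 (b - a) (q - a) = 0 := by
      rw [hk2, det2_smul_left] at h1 ⊢
      nlinarith
    obtain ⟨s, hs0, hs1, hqs⟩ := hab.exists_of_det2_eq_zero hq h0
    have hya := hy a hab.left_mem_extremePoints
    have hyb := hy b hab.right_mem_extremePoints
    have hyeq : y = det2 v a + s * (det2 v b - det2 v a) := by
      rw [← hqy, hqs, det2_add_right, det2_smul_right, det2_sub_right]
    refine ⟨a, b, hab, ?_⟩
    obtain ⟨x, hx, hxy⟩ := exists_mem_interior_of_height hc hconv hint hv hy hq hqy
    have hxpos := det2_pos_of_mem_interior hab.sub_ne_zero hab.det2_nonneg hx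
    have hxq : 0 < det2 (b - a) (x - q) := by
      have : x - q = (x - a) - (q - a) := by abel
      rw [this, det2_sub_right, h0]; linarith
    have h6 := eq_smul_of_det2_eq_zero hv (w := x - q) (by rw [det2_sub_right, hqy, hxy, sub_self])
    set m := (inner ℝ v (x - q) : ℝ) / ‖v‖ ^ 2 with hm
    have hm0 : m ≤ 0 := by
      apply div_nonpos_of_nonpos_of_nonneg _ (by positivity)
      rw [inner_sub_right]
      linarith [hmax x (interior_subset hx) hxy]
    rw [h6, det2_smul_right, det2_swap, det2_sub_right] at hxq
    have hlt : det2 v a < det2 v b := by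
      by_contra hcon
      push Not at hcon
      nlinarith [mul_nonneg (neg_nonneg.2 hm0) (sub_nonneg.2 hcon)]
    have hs0' : s ≠ 0 := by rintro rfl; simp at hyeq; exact hya hyeq.symm
    have hs1' : s ≠ 1 := by rintro rfl; apply hyb; rw [hyeq]; ring
    have hs0'' := lt_of_le_of_ne hs0 (Ne.symm hs0')
    have hs1'' := lt_of_le_of_ne hs1 hs1'
    constructor
    · nlinarith
    · nlinarith

/-- Both edges cross at the right end of the same slice. The common point is inside ab and on the
supporting line of cd, so ab lies on that line, and both edges point upwards. -/
lemma IsEdge.eq_of_crossing {c d : Plane} (h : IsEdge Ω a b) (h' : IsEdge Ω c d) {v : Plane}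
    (hv : v ≠ 0) {y : ℝ} (h1 : det2 v a < y) (h2 : y < det2 v b) (h1' : det2 v c < y)
    (h2' : y < det2 v d) : a = c ∧ b = d := by
  have hy := det2_crossPt (v := v) (y := y) (a := a) (b := b) (by linarith)
  have hy' := det2_crossPt (v := v) (y := y) (a := c) (b := d) (by linarith)
  obtain ⟨s, hs0, hs1, hs⟩ := crossPt_mem_openSegment h1 h2
  obtain ⟨t, ht0, ht1, ht⟩ := crossPt_mem_openSegment h1' h2'
  have hmem : crossPt v y a b ∈ Ω := by rw [hs]; exact h.add_smul_mem hs0.le hs1.le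
  have hmem' : crossPt v y c d ∈ Ω := by rw [ht]; exact h'.add_smul_mem ht0.le ht1.le
  have hle := h.inner_le_inner_crossPt hv h1 h2 hmem' hy'
  have hle' := h'.inner_le_inner_crossPt hv h1' h2' hmem hy
  have heq : crossPt v y a b = crossPt v y c d := by
    have := eq_smul_of_det2_eq_zero hv (w := crossPt v y a b - crossPt v y c d)
      (by rw [det2_sub_right, hy, hy', sub_self])
    rw [inner_sub_right, le_antisymm hle' hle] at this
    simpa [sub_eq_zero] using this
  have e0 : det2 (d - c) (crossPt v y a b - c) = 0 := by
    rw [heq]; simp [crossPt, det2_smul_right]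
  have e1 := h'.det2_nonneg a h.left_mem
  have e2 := h'.det2_nonneg b h.right_mem
  have e3 : (1 - s) * det2 (d - c) (a - c) + s * det2 (d - c) (b - c) = 0 := by
    rw [← e0, hs, ← det2_smul_right, ← det2_smul_right, ← det2_add_right]
    congr 1; module
  have e4 : det2 (d - c) (a - c) = 0 := by
    nlinarith [mul_nonneg hs0.le e2, mul_nonneg (sub_nonneg.2 hs1.le) e1]
  have e5 : det2 (d - c) (b - c) = 0 := by
    nlinarith [mul_nonneg hs0.le e2, mul_nonneg (sub_nonneg.2 hs1.le) e1]
  have e6 : det2 (d - c) (b - a) = 0 := by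
    have : b - a = (b - c) - (a - c) := by abel
    rw [this, det2_sub_right, e4, e5, sub_self]
  have e7 := eq_smul_of_det2_eq_zero h'.sub_ne_zero e6
  set k := (inner ℝ (d - c) (b - a) : ℝ) / ‖d - c‖ ^ 2
  have e8 : det2 v b - det2 v a = k * (det2 v d - det2 v c) := by
    rw [← det2_sub_right, ← det2_sub_right, ← det2_smul_right, ← e7]
  have hk : 0 < k := by
    by_contra hcon
    push Not at hcon
    nlinarith [mul_nonneg (neg_nonneg.2 hcon) (by linarith : 0 ≤ det2 v d - det2 v c)]
  obtain ⟨r1, r2⟩ := h'.eq_of_sub_eq_smul h hk e7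
  exact ⟨r1.symm, r2.symm⟩

lemma sum_upward_edges (hc : IsCompact Ω) (hconv : Convex ℝ Ω)
    (hint : (interior Ω).Nonempty) (hfin : (edgeSet Ω).Finite) {v : Plane} (hv : v ≠ 0) {y : ℝ}
    (hy : ∀ p ∈ Ω.extremePoints ℝ, det2 v p ≠ y) {q : Plane} (hq : q ∈ Ω) (hqy : det2 v q = y)
    (hmax : ∀ x ∈ Ω, det2 v x = y → (inner ℝ v x : ℝ) ≤ inner ℝ v q) (f : Plane → ℂ) :
    ∑ e ∈ hfin.toFinset, (if det2 v e.1 < y ∧ y < det2 v e.2 then f (crossPt v y e.1 e.2) else 0) =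
      f q := by
  obtain ⟨a, b, hab, h1, h2⟩ := exists_edge_crossing hc hconv hint hv hy hq hqy hmax
  rw [Finset.sum_eq_single (a, b)]
  · rw [if_pos ⟨h1, h2⟩]
    congr 1
    have hle := hab.inner_le_inner_crossPt hv h1 h2 hq hqy
    have hcy := det2_crossPt (v := v) (y := y) (a := a) (b := b) (by linarith)
    obtain ⟨s, hs0, hs1, hs⟩ := crossPt_mem_openSegment h1 h2
    have hle' := hmax (crossPt v y a b) (by rw [hs]; exact hab.add_smul_mem hs0.le hs1.le) hcy
    have := eq_smul_of_det2_eq_zero hv (w := crossPt v y a b - q)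
      (by rw [det2_sub_right, hcy, hqy, sub_self])
    rw [inner_sub_right, le_antisymm hle' hle] at this
    simpa [sub_eq_zero] using this
  · rintro ⟨c, d⟩ he hne
    rw [if_neg]
    rintro ⟨h1', h2'⟩
    obtain ⟨r1, r2⟩ := hab.eq_of_crossing (hfin.mem_toFinset.1 he) hv h1 h2 h1' h2'
    exact hne (by rw [r1, r2])
  · intro hn
    exact absurd (hfin.mem_toFinset.2 hab) hn

/-- The integral of an exponential over the segment from `a` to `b`. -/
def edgeInt (ξ a b : Plane) : ℂ := ∫ s in (0 : ℝ)..1, expFun ξ (a + s • (b - a))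

/-- The oriented contribution of an edge to the slice at height `y`. -/
def edgeTerm (ξ v a b : Plane) (y : ℝ) : ℂ :=
  (if det2 v a < y ∧ y < det2 v b then expFun ξ (crossPt v y a b) else 0) -
    (if det2 v b < y ∧ y < det2 v a then expFun ξ (crossPt v y a b) else 0)

/-- The height serves as parameter along the edge: y = det2 v a + s (det2 v b - det2 v a). For an
edge of constant height both sides vanish. -/
lemma edgeTerm_integrable_and_integral (ξ v a b : Plane) :
    Integrable (edgeTerm ξ v a b) ∧
      ∫ y, edgeTerm ξ v a b y = (det2 v (b - a) : ℂ) * edgeInt ξ a b := by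
  set ya := det2 v a with hya
  set yb := det2 v b with hyb
  have hcont : Continuous fun y => expFun ξ (crossPt v y a b) := by
    refine (continuous_expFun ξ).comp ?_
    unfold crossPt; fun_prop
  have hsub : (det2 v (b - a) : ℂ) * edgeInt ξ a b = ∫ y in ya..yb, expFun ξ (crossPt v y a b) := by
    have key := intervalIntegral.smul_integral_comp_add_mul
      (fun y => expFun ξ (crossPt v y a b)) (a := 0) (b := 1) (yb - ya) ya
    rw [mul_zero, mul_one, add_zero, add_sub_cancel] at key
    rw [← key, det2_sub_right, edgeInt, ← hya, ← hyb, Complex.real_smul]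
    rcases eq_or_ne yb ya with h | h
    · simp [h]
    · congr 1
      apply intervalIntegral.integral_congr
      intro s _
      have : yb - ya ≠ 0 := sub_ne_zero.2 h
      simp only [crossPt, ← hya, ← hyb]
      congr 3
      field_simp
      ring
  rw [hsub]
  have hind : ∀ p q : ℝ, (fun y => if p < y ∧ y < q then expFun ξ (crossPt v y a b) else 0) =
      (Set.Ioo p q).indicator fun y => expFun ξ (crossPt v y a b) := by
    intro p q; funext y
    simp [Set.indicator_apply, Set.mem_Ioo]
  have hI : ∀ p q : ℝ, Integrable
      (fun y => if p < y ∧ y < q then expFun ξ (crossPt v y a b) else 0) := by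
    intro p q
    rw [hind, integrable_indicator_iff measurableSet_Ioo]
    exact (hcont.integrableOn_Icc).mono_set Set.Ioo_subset_Icc_self
  refine ⟨(hI _ _).sub (hI _ _), ?_⟩
  unfold edgeTerm
  rw [integral_sub (hI _ _) (hI _ _), hind, hind, integral_indicator measurableSet_Ioo,
    integral_indicator measurableSet_Ioo]
  rw [← integral_Ioc_eq_integral_Ioo, ← integral_Ioc_eq_integral_Ioo]
  rfl

lemma integral_ee_Icc {α β : ℝ} (c : ℝ) (h : α ≤ β) :
    (2 * (Real.pi : ℂ) * Complex.I * c) * ∫ x in Set.Icc α β, ee (c * x) =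
      ee (c * β) - ee (c * α) := by
  rw [integral_Icc_eq_integral_Ioc, ← intervalIntegral.integral_of_le h,
    ← intervalIntegral.integral_const_mul]
  have hd : ∀ x : ℝ, HasDerivAt (fun x : ℝ => ee (c * x))
      ((2 * (Real.pi : ℂ) * Complex.I * c) * ee (c * x)) x := by
    intro x
    have := (hasDerivAt_ee (c * x)).scomp x ((hasDerivAt_id x).const_mul c)
    refine HasDerivAt.congr_deriv (f := fun x : ℝ => ee (c * x)) this ?_
    rw [Complex.real_smul]; push_cast; ring
  rw [intervalIntegral.integral_eq_sub_of_hasDerivAt (fun x _ => hd x)]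
  apply Continuous.intervalIntegrable
  have := continuous_ee
  fun_prop

/-- Coordinates with respect to the orthonormal frame `rot v, v`. -/
lemma exists_measurePreserving_frame {v : Plane} (hv : ‖v‖ = 1) :
    ∃ Φ : ℝ × ℝ ≃ᵐ Plane, MeasurePreserving Φ ∧ ∀ p, Φ p = p.1 • rot v + p.2 • v := by
  have hon : Orthonormal ℝ ![rot v, v] := by
    rw [orthonormal_iff_ite]
    intro i j
    have h0 : (inner ℝ (rot v) v : ℝ) = 0 := by rw [inner_rot_left]; simp
    fin_cases i <;> fin_cases j <;>
      simp [norm_rot, hv, h0, real_inner_comm (rot v) v]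
  let B : OrthonormalBasis (Fin 2) ℝ Plane :=
    OrthonormalBasis.mk hon (by
      rw [hon.linearIndependent.span_eq_top_of_card_eq_finrank (by simp)])
  let e1 : ℝ × ℝ ≃ᵐ (Fin 2 → ℝ) := MeasurableEquiv.finTwoArrow.symm
  let e2 : (Fin 2 → ℝ) ≃ᵐ Plane := MeasurableEquiv.toLp 2 (Fin 2 → ℝ)
  let e3 : Plane ≃ᵐ Plane := B.repr.symm.toHomeomorph.toMeasurableEquiv
  have h1 : MeasurePreserving e1 := volume_preserving_finTwoArrow ℝ |>.symm _
  have h2 : MeasurePreserving e2 := EuclideanSpace.volume_preserving_symm_measurableEquiv_toLp _ |>.symm _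
  have h3 : MeasurePreserving e3 := B.measurePreserving_repr_symm
  refine ⟨(e1.trans e2).trans e3, h3.comp (h2.comp h1), ?_⟩
  intro p
  change B.repr.symm (WithLp.toLp 2 ![p.1, p.2]) = _
  rw [← B.sum_repr_symm]
  simp [B, Fin.sum_univ_two]

/-- A slice is an interval [α, β], on which the exponential integrates to a difference of end
values. The end β belongs to the unique upward edge through this height and α to the unique downward
one, found by replacing v with -v. -/
lemma slice_integral (hc : IsCompact Ω) (hconv : Convex ℝ Ω)
    (hint : (interior Ω).Nonempty) (hfin : (edgeSet Ω).Finite) {v : Plane} (hv : ‖v‖ = 1) (c : ℝ)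
    {y : ℝ} (hy : ∀ p ∈ Ω.extremePoints ℝ, det2 v p ≠ y) :
    (2 * (Real.pi : ℂ) * Complex.I * c) *
      ∫ x : ℝ, Ω.indicator (expFun (c • v)) (y • rot v + x • v) =
      ∑ e ∈ hfin.toFinset, edgeTerm (c • v) v e.1 e.2 y := by
  have hv0 : v ≠ 0 := by rintro rfl; simp at hv
  have hvv : (inner ℝ v v : ℝ) = 1 := by rw [real_inner_self_eq_norm_sq, hv]; norm_num
  have hrv : (inner ℝ v (rot v) : ℝ) = 0 := by rw [real_inner_comm, inner_rot_left]; simp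
  have hheight : ∀ x : ℝ, det2 v (y • rot v + x • v) = y := by
    intro x
    rw [det2_add_right, det2_smul_right, det2_smul_right, det2_swap v (rot v), det2_rot_left, hvv]
    simp
  have hinner : ∀ x : ℝ, (inner ℝ v (y • rot v + x • v) : ℝ) = x := by
    intro x
    rw [inner_add_right, inner_smul_right, inner_smul_right, hrv, hvv]; simp
  have hexp : ∀ x : ℝ, expFun (c • v) (y • rot v + x • v) = ee (c * x) := by
    intro x
    rw [expFun_eq, inner_smul_left, hinner]; rfl
  have hrep : ∀ p : Plane, det2 v p = y → p = y • rot v + (inner ℝ v p : ℝ) • v := by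
    intro p hp
    have := norm_sq_smul_eq v p
    rw [hv, hp] at this
    simpa [add_comm] using this
  have hlin : Continuous fun x : ℝ => y • rot v + x • v := by fun_prop
  set S : Set ℝ := (fun x : ℝ => y • rot v + x • v) ⁻¹' Ω with hS
  have hSc : IsCompact S := by
    have : S = (fun p : Plane => (inner ℝ v p : ℝ)) '' (Ω ∩ {p | det2 v p = y}) := by
      ext x
      constructor
      · intro hx
        exact ⟨_, ⟨hx, hheight x⟩, hinner x⟩
      · rintro ⟨p, ⟨hp, hpy⟩, rfl⟩
        simp only [hS, Set.mem_preimage]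
        rw [← hrep p hpy]; exact hp
    rw [this]
    refine (hc.inter_right (isClosed_eq (continuous_det2 v) continuous_const)).image ?_
    fun_prop
  have hLHS : (∫ x : ℝ, Ω.indicator (expFun (c • v)) (y • rot v + x • v)) =
      ∫ x in S, ee (c * x) := by
    rw [← integral_indicator hSc.measurableSet]
    congr 1; funext x
    by_cases hx : x ∈ S
    · rw [Set.indicator_of_mem hx, Set.indicator_of_mem (by exact hx), hexp]
    · rw [Set.indicator_of_notMem hx, Set.indicator_of_notMem (by exact hx)]
  rw [hLHS]
  rcases S.eq_empty_or_nonempty with hemp | hne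
  · rw [hemp]
    simp only [Measure.restrict_empty, integral_zero_measure, mul_zero]
    symm
    apply Finset.sum_eq_zero
    rintro ⟨a, b⟩ he
    have hab : IsEdge Ω a b := hfin.mem_toFinset.1 he
    have hno : ∀ s : ℝ, 0 < s → s < 1 → det2 v (a + s • (b - a)) ≠ y := by
      intro s h0 h1 hcon
      have : (inner ℝ v (a + s • (b - a)) : ℝ) ∈ S := by
        simp only [hS, Set.mem_preimage]
        rw [← hrep _ hcon]; exact hab.add_smul_mem h0.le h1.le
      rw [hemp] at this
      exact this
    unfold edgeTerm
    rw [if_neg, if_neg, sub_zero]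
    · rintro ⟨h1, h2⟩
      simp only at h1 h2
      apply hno ((det2 v a - y) / (det2 v a - det2 v b)) (div_pos (by linarith) (by linarith))
        ((div_lt_one (by linarith)).2 (by linarith))
      rw [det2_add_right, det2_smul_right, det2_sub_right]
      have : det2 v a - det2 v b ≠ 0 := by linarith
      field_simp; ring
    · rintro ⟨h1, h2⟩
      simp only at h1 h2
      obtain ⟨s, hs0, hs1, hs⟩ := crossPt_mem_openSegment h1 h2
      exact hno s hs0 hs1 (by rw [← hs, det2_crossPt (by linarith)])
  · obtain ⟨β, hβ, hβmax⟩ := hSc.exists_isGreatest hne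
    obtain ⟨α, hα, hαmin⟩ := hSc.exists_isLeast hne
    have hSI : S = Set.Icc α β := by
      have hsub : S ⊆ Set.Icc α β := fun x hx => ⟨hαmin hx, hβmax hx⟩
      refine hsub.antisymm ?_
      have hSconv : Convex ℝ S := by
        intro x hx z hz s t hs ht hst
        have := hconv hx hz hs ht hst
        obtain rfl : t = 1 - s := by linarith
        rw [hS, Set.mem_preimage]
        convert this using 1
        simp only [smul_eq_mul]
        module
      rw [← segment_eq_Icc (hαmin hβ)]
      exact hSconv.segment_subset hα hβ
    rw [hSI, integral_ee_Icc c (hαmin hβ)]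
    have hup := sum_upward_edges hc hconv hint hfin hv0 hy (q := y • rot v + β • v) hβ (hheight β)
      (fun x hx hxy => by
        rw [hinner]
        apply hβmax
        simp only [hS, Set.mem_preimage]
        rw [← hrep x hxy]; exact hx) (expFun (c • v))
    have hdown := sum_upward_edges hc hconv hint hfin (neg_ne_zero.2 hv0) (y := -y)
      (fun p hp h => hy p hp (by rw [det2_neg_left] at h; linarith))
      (q := y • rot v + α • v) hα (by rw [det2_neg_left, hheight α])
      (fun x hx hxy => by
        rw [inner_neg_left, inner_neg_left, hinner, neg_le_neg_iff]
        apply hαmin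
        simp only [hS, Set.mem_preimage]
        rw [← hrep x (by rw [det2_neg_left] at hxy; linarith)]; exact hx) (expFun (c • v))
    rw [hexp] at hup hdown
    rw [← hup, ← hdown, ← Finset.sum_sub_distrib]
    apply Finset.sum_congr rfl
    rintro ⟨a, b⟩ -
    unfold edgeTerm
    have hcr : crossPt (-v) (-y) a b = crossPt v y a b := by
      unfold crossPt
      simp only [det2_neg_left]
      congr 2
      rw [← neg_sub, ← neg_div_neg_eq]
      congr 1 <;> ring
    simp only [hcr, det2_neg_left, neg_lt_neg_iff]
    congr 2
    rw [and_comm]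

/-- The divergence theorem for the Fourier transform of a convex polygon. -/
theorem green (hc : IsCompact Ω) (hconv : Convex ℝ Ω)
    (hint : (interior Ω).Nonempty) (hfinV : (Ω.extremePoints ℝ).Finite)
    (hfin : (edgeSet Ω).Finite) (ξ : Plane) :
    (2 * (Real.pi : ℂ) * Complex.I * (‖ξ‖ ^ 2 : ℝ)) * ft Ω ξ =
      ∑ e ∈ hfin.toFinset, (det2 ξ (e.2 - e.1) : ℂ) * edgeInt ξ e.1 e.2 := by
  rcases eq_or_ne ξ 0 with rfl | hξ
  · simp [det2]
  set c := ‖ξ‖ with hcdef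
  have hc0 : c ≠ 0 := by simpa [hcdef] using hξ
  set v := c⁻¹ • ξ with hvdef
  have hv : ‖v‖ = 1 := by
    rw [hvdef, norm_smul, norm_inv, Real.norm_eq_abs, abs_of_nonneg (norm_nonneg _)]
    exact inv_mul_cancel₀ hc0
  have hξv : ξ = c • v := by rw [hvdef, smul_smul, mul_inv_cancel₀ hc0, one_smul]
  obtain ⟨Φ, hΦ, hΦeq⟩ := exists_measurePreserving_frame hv
  have hInt : Integrable (Ω.indicator (expFun ξ)) := by
    rw [integrable_indicator_iff hc.measurableSet]
    exact (continuous_expFun ξ).continuousOn.integrableOn_compact hc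
  have hInt2 : Integrable fun p : ℝ × ℝ => Ω.indicator (expFun ξ) (Φ p) :=
    (hΦ.integrable_comp_emb Φ.measurableEmbedding).2 hInt
  have h1 : ft Ω ξ = ∫ y : ℝ, ∫ x : ℝ, Ω.indicator (expFun ξ) (y • rot v + x • v) := by
    rw [ft, ← integral_indicator hc.measurableSet, ← hΦ.integral_comp Φ.measurableEmbedding,
      Measure.volume_eq_prod, integral_prod _ hInt2]
    simp only [hΦeq]
  have hae : ∀ᵐ y : ℝ, ∀ p ∈ Ω.extremePoints ℝ, det2 v p ≠ y := by
    have hnull : volume ((fun p => det2 v p) '' (Ω.extremePoints ℝ)) = 0 :=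
      (hfinV.image _).measure_zero _
    filter_upwards [compl_mem_ae_iff.2 hnull] with y hy p hp h
    exact hy ⟨p, hp, h⟩
  have h2 : (2 * (Real.pi : ℂ) * Complex.I * c) * ft Ω ξ =
      ∑ e ∈ hfin.toFinset, (det2 v (e.2 - e.1) : ℂ) * edgeInt ξ e.1 e.2 := by
    rw [h1, ← integral_const_mul]
    have : ∀ e ∈ hfin.toFinset, (det2 v (e.2 - e.1) : ℂ) * edgeInt ξ e.1 e.2 =
        ∫ y, edgeTerm ξ v e.1 e.2 y :=
      fun e _ => (edgeTerm_integrable_and_integral ξ v e.1 e.2).2.symm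
    rw [Finset.sum_congr rfl this, ← integral_finsetSum _
      (fun e _ => (edgeTerm_integrable_and_integral ξ v e.1 e.2).1)]
    apply integral_congr_ae
    filter_upwards [hae] with y hy
    rw [hξv]
    exact slice_integral hc hconv hint hfin hv c hy
  -- Slicing along the unit vector v yields one factor ‖ξ‖; passing from v to ξ in the determinants
  -- supplies the second.
  have h3 : ∀ w, (det2 ξ w : ℂ) = c * det2 v w := by
    intro w
    conv_lhs => rw [hξv]
    rw [det2_smul_left]; push_cast; rfl
  simp only [h3, mul_assoc]
  rw [← Finset.mul_sum, ← h2]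
  push_cast; ring

end Green

/-! ### Far zeros of the Fourier transform and equality of opposite edges -/

section Asymptotics

/-- A convex polygon with nonempty interior. -/
structure IsPolygon (Ω : Set Plane) : Prop where
  isCompact : IsCompact Ω
  convex : Convex ℝ Ω
  interior_nonempty : (interior Ω).Nonempty
  finite_extremePoints : (Ω.extremePoints ℝ).Finite

/-- The integral of the character `s ↦ exp(2πisσ)` over the unit interval. -/
def unitInt (σ : ℝ) : ℂ := ∫ s in (0 : ℝ)..1, ee (s * σ)

lemma unitInt_mul (σ : ℝ) : (2 * (Real.pi : ℂ) * Complex.I * σ) * unitInt σ = ee σ - 1 := by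
  have := integral_ee_Icc σ (zero_le_one' ℝ)
  rw [integral_Icc_eq_integral_Ioc, ← intervalIntegral.integral_of_le zero_le_one] at this
  simpa [unitInt, mul_comm σ] using this

lemma norm_unitInt_mul (σ : ℝ) : 2 * Real.pi * |σ| * ‖unitInt σ‖ = circNorm σ := by
  rw [circNorm, ← unitInt_mul]
  simp [abs_of_pos Real.pi_pos]

lemma norm_unitInt_le_one (σ : ℝ) : ‖unitInt σ‖ ≤ 1 := by
  have := intervalIntegral.norm_integral_le_of_norm_le_const (a := (0 : ℝ)) (b := 1) (C := 1)
    (f := fun s => ee (s * σ)) (fun s _ => by simp)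
  simpa [unitInt] using this

lemma circNorm_le (t : ℝ) : circNorm t ≤ 2 * Real.pi * |t| := by
  have := Real.norm_exp_I_mul_ofReal_sub_one_le (x := 2 * Real.pi * t)
  rw [circNorm, ee]
  convert this using 1
  · congr 3; push_cast; ring
  · simp [abs_of_pos Real.pi_pos]

lemma one_sub_le_norm_unitInt (σ : ℝ) : 1 - 2 * Real.pi * |σ| ≤ ‖unitInt σ‖ := by
  have h1 : unitInt σ - 1 = ∫ s in (0 : ℝ)..1, (ee (s * σ) - 1) := by
    have := continuous_ee
    rw [intervalIntegral.integral_sub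
      (Continuous.intervalIntegrable (by fun_prop) _ _) (by simp)]
    simp [unitInt]
  have h2 : ‖unitInt σ - 1‖ ≤ 2 * Real.pi * |σ| := by
    rw [h1]
    have := intervalIntegral.norm_integral_le_of_norm_le_const (a := (0 : ℝ)) (b := 1)
      (C := 2 * Real.pi * |σ|) (f := fun s => ee (s * σ) - 1) (fun s hs => by
        rw [Set.uIoc_of_le zero_le_one] at hs
        refine (circNorm_le (s * σ)).trans ?_
        rw [abs_mul, abs_of_pos hs.1]
        have : s * |σ| ≤ |σ| := mul_le_of_le_one_left (abs_nonneg _) hs.2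
        have := Real.pi_pos
        gcongr)
    simpa using this
  have h3 := norm_sub_norm_le (1 : ℂ) (1 - unitInt σ)
  rw [norm_sub_rev 1 (unitInt σ), sub_sub_cancel, norm_one] at h3
  linarith

lemma edgeInt_eq (ξ a b : Plane) :
    edgeInt ξ a b = expFun ξ a * unitInt (inner ℝ ξ (b - a)) := by
  rw [edgeInt, unitInt, ← intervalIntegral.integral_const_mul]
  congr 1; funext s
  rw [expFun_add_right, expFun_eq ξ (s • (b - a)), inner_smul_right]

lemma edgeInt_comm (ξ a b : Plane) : edgeInt ξ a b = edgeInt ξ b a := by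
  have := intervalIntegral.integral_comp_sub_left (fun s => expFun ξ (a + s • (b - a)))
    (a := 0) (b := 1) (1 : ℝ)
  rw [sub_self, sub_zero] at this
  rw [edgeInt, ← this, edgeInt]
  congr 1; funext s; congr 1; module

lemma norm_edgeInt (ξ a b : Plane) : ‖edgeInt ξ a b‖ = ‖unitInt (inner ℝ ξ (b - a))‖ := by
  rw [edgeInt_eq, norm_mul, norm_expFun, one_mul]

lemma abs_det2_le (p q : Plane) : |det2 p q| ≤ ‖p‖ * ‖q‖ := by
  rw [← inner_rot_left, ← norm_rot p]; exact abs_real_inner_le_norm _ _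

/-- The squares of ⟨ξ, e⟩ and det(e, ξ) add up to ‖e‖²‖ξ‖², and the first is at most a quarter of
this sum as soon as ‖ξ‖‖e‖ ≥ 2M. -/
lemma half_le_abs_det2 {e ξ : Plane} (he : e ≠ 0) {M : ℝ} (hM : 0 ≤ M)
    (h1 : |(inner ℝ ξ e : ℝ)| ≤ M) (h2 : 2 * M / ‖e‖ ≤ ‖ξ‖) :
    ‖e‖ * ‖ξ‖ / 2 ≤ |det2 e ξ| := by
  have he' : 0 < ‖e‖ := norm_pos_iff.2 he
  have h3 := inner_sq_add_det2_sq e ξ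
  rw [real_inner_comm, ← sq_abs (inner ℝ ξ e), ← sq_abs (det2 e ξ)] at h3
  rw [div_le_iff₀ he'] at h2
  have h4 : |(inner ℝ ξ e : ℝ)| ^ 2 ≤ M ^ 2 := by gcongr
  have h5 : (2 * M) ^ 2 ≤ (‖ξ‖ * ‖e‖) ^ 2 := by gcongr
  apply abs_le_of_sq_le_sq' _ (abs_nonneg _) |>.2
  nlinarith [sq_nonneg (‖ξ‖ * ‖e‖)]

/-- A long vector in the strip is nearly perpendicular to e, hence its product with the transversal
e' has size comparable to ‖ξ‖. The decay of `unitInt` then compensates the growth of the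
determinant. -/
lemma nonparallel_bound {e e' : Plane} (he : e ≠ 0) (hdet : det2 e e' ≠ 0) {M : ℝ} (hM : 0 ≤ M) :
    ∃ C R : ℝ, ∀ ξ : Plane, |(inner ℝ ξ e : ℝ)| ≤ M → R ≤ ‖ξ‖ →
      |det2 ξ e'| * ‖unitInt (inner ℝ ξ e')‖ ≤ C := by
  have he' : 0 < ‖e‖ := norm_pos_iff.2 he
  have hd : 0 < |det2 e e'| := abs_pos.2 hdet
  set k := |det2 e e'| * ‖e‖ / 4 with hk
  have hk0 : 0 < k := by positivity
  refine ⟨‖e'‖ * ‖e‖ ^ 2 / k, max (max 1 (2 * M / ‖e‖)) (|(inner ℝ e e' : ℝ)| * M / k), ?_⟩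
  intro ξ h1 h2
  have hξ1 : 1 ≤ ‖ξ‖ := (le_max_left _ _).trans ((le_max_left _ _).trans h2)
  have hξ2 : 2 * M / ‖e‖ ≤ ‖ξ‖ := (le_max_right _ _).trans ((le_max_left _ _).trans h2)
  have hξ3 : |(inner ℝ e e' : ℝ)| * M / k ≤ ‖ξ‖ := (le_max_right _ _).trans h2
  rw [div_le_iff₀ hk0] at hξ3
  have h3 := half_le_abs_det2 he hM h1 hξ2
  -- Expand e' in the frame e, `rot e`: the first term stays bounded in the strip and the second
  -- grows like ‖ξ‖.
  have h4 : ‖e‖ ^ 2 * (inner ℝ ξ e' : ℝ) =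
      (inner ℝ e e' : ℝ) * inner ℝ ξ e + det2 e e' * det2 e ξ := by
    have := congrArg (fun w => (inner ℝ ξ w : ℝ)) (norm_sq_smul_eq e e')
    simp only [inner_smul_right, inner_add_right] at this
    rw [real_inner_comm (rot e) ξ, inner_rot_left] at this
    exact this
  have h5 : k * ‖ξ‖ ≤ ‖e‖ ^ 2 * |(inner ℝ ξ e' : ℝ)| := by
    have h6 : |det2 e e' * det2 e ξ| ≤
        |‖e‖ ^ 2 * (inner ℝ ξ e' : ℝ)| + |(inner ℝ e e' : ℝ) * inner ℝ ξ e| := by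
      have : det2 e e' * det2 e ξ =
        ‖e‖ ^ 2 * (inner ℝ ξ e' : ℝ) - (inner ℝ e e' : ℝ) * inner ℝ ξ e := by linarith
      rw [this]; exact abs_sub _ _
    rw [abs_mul, abs_mul, abs_mul, abs_of_pos (by positivity : 0 < ‖e‖ ^ 2)] at h6
    have h7 : |(inner ℝ e e' : ℝ)| * |(inner ℝ ξ e : ℝ)| ≤ |(inner ℝ e e' : ℝ)| * M := by gcongr
    have h8 : |det2 e e'| * (‖e‖ * ‖ξ‖ / 2) ≤ |det2 e e'| * |det2 e ξ| := by gcongr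
    have h9 : |det2 e e'| * (‖e‖ * ‖ξ‖ / 2) = 2 * (k * ‖ξ‖) := by rw [hk]; ring
    linarith
  set J := ‖unitInt (inner ℝ ξ e')‖ with hJ
  have hJ0 : 0 ≤ J := norm_nonneg _
  have h10 : |(inner ℝ ξ e' : ℝ)| * J ≤ 1 := by
    have h := norm_unitInt_mul (inner ℝ ξ e')
    have h' := circNorm_le_two (inner ℝ ξ e')
    rw [← hJ] at h
    have hpi := Real.pi_gt_three
    have hx : 0 ≤ |(inner ℝ ξ e' : ℝ)| * J := by positivity
    nlinarith
  have h11 : k * ‖ξ‖ * J ≤ ‖e‖ ^ 2 := by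
    calc k * ‖ξ‖ * J ≤ ‖e‖ ^ 2 * |(inner ℝ ξ e' : ℝ)| * J := by gcongr
      _ = ‖e‖ ^ 2 * (|(inner ℝ ξ e' : ℝ)| * J) := by ring
      _ ≤ ‖e‖ ^ 2 * 1 := by gcongr
      _ = ‖e‖ ^ 2 := mul_one _
  rw [le_div_iff₀ hk0]
  calc |det2 ξ e'| * J * k ≤ ‖ξ‖ * ‖e'‖ * J * k := by
        have := abs_det2_le ξ e'; gcongr
    _ = ‖e'‖ * (k * ‖ξ‖ * J) := by ring
    _ ≤ ‖e'‖ * ‖e‖ ^ 2 := by gcongr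

lemma sum_nonparallel_bound {e : Plane} (he : e ≠ 0) {M : ℝ} (hM : 0 ≤ M)
    (s : Finset (Plane × Plane)) (hs : ∀ f ∈ s, det2 e (f.2 - f.1) ≠ 0) :
    ∃ C R : ℝ, ∀ ξ : Plane, |(inner ℝ ξ e : ℝ)| ≤ M → R ≤ ‖ξ‖ →
      ‖∑ f ∈ s, (det2 ξ (f.2 - f.1) : ℂ) * edgeInt ξ f.1 f.2‖ ≤ C := by
  classical
  induction s using Finset.induction_on with
  | empty => exact ⟨0, 0, fun ξ _ _ => by simp⟩
  | insert f s hf ih =>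
    obtain ⟨C, R, h1⟩ := ih (fun f hf => hs f (Finset.mem_insert_of_mem hf))
    obtain ⟨C', R', h2⟩ := nonparallel_bound he (hs f (Finset.mem_insert_self _ _)) hM
    refine ⟨C' + C, max R R', fun ξ h3 h4 => ?_⟩
    rw [Finset.sum_insert hf]
    refine (norm_add_le _ _).trans (add_le_add ?_ (h1 ξ h3 ((le_max_left _ _).trans h4)))
    rw [norm_mul, norm_edgeInt, Complex.norm_real]
    exact h2 ξ h3 ((le_max_right _ _).trans h4)

variable {Ω Λ : Set Plane} {a b c d : Plane}

/-- Edges with the same direction coincide, so another parallel edge runs the opposite way, and two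
such edges would have the same direction as each other. -/
lemma IsEdge.parallel_edges (h : IsEdge Ω a b) :
    (∀ f ∈ edgeSet Ω, det2 (b - a) (f.2 - f.1) = 0 → f = (a, b)) ∨
    ∃ (c d : Plane) (k : ℝ), IsEdge Ω c d ∧ 0 < k ∧ d - c = -(k • (b - a)) ∧
      ∀ f ∈ edgeSet Ω, det2 (b - a) (f.2 - f.1) = 0 → f = (a, b) ∨ f = (c, d) := by
  have key : ∀ f ∈ edgeSet Ω, det2 (b - a) (f.2 - f.1) = 0 → f ≠ (a, b) →
      ∃ k : ℝ, 0 < k ∧ f.2 - f.1 = -(k • (b - a)) := by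
    rintro ⟨c, d⟩ hf h0 hne
    have h1 := eq_smul_of_det2_eq_zero h.sub_ne_zero h0
    set k := (inner ℝ (b - a) (d - c) : ℝ) / ‖b - a‖ ^ 2
    refine ⟨-k, ?_, by rw [neg_smul, neg_neg]; exact h1⟩
    rcases lt_trichotomy k 0 with hk | hk | hk
    · linarith
    · exfalso
      rw [hk, zero_smul] at h1
      exact IsEdge.sub_ne_zero hf h1
    · exfalso
      obtain ⟨r1, r2⟩ := h.eq_of_sub_eq_smul hf hk h1
      exact hne (by rw [r1, r2])
  by_cases hex : ∃ f ∈ edgeSet Ω, det2 (b - a) (f.2 - f.1) = 0 ∧ f ≠ (a, b)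
  · right
    obtain ⟨⟨c, d⟩, hf, h0, hne⟩ := hex
    obtain ⟨k, hk, hcd⟩ := key _ hf h0 hne
    refine ⟨c, d, k, hf, hk, hcd, ?_⟩
    rintro ⟨c', d'⟩ hf' h0'
    by_cases hne' : (c', d') = (a, b)
    · exact Or.inl hne'
    · right
      obtain ⟨k', hk', hcd'⟩ := key _ hf' h0' hne'
      have : d' - c' = (k' / k) • (d - c) := by
        simp only at hcd hcd'
        rw [hcd, hcd', smul_neg, smul_smul, div_mul_cancel₀ _ hk.ne']
      obtain ⟨r1, r2⟩ := IsEdge.eq_of_sub_eq_smul hf hf' (div_pos hk' hk) this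
      exact Prod.ext r1.symm r2.symm
  · left
    push Not at hex
    exact hex

/-- At far away zeros of the Fourier transform near the normal direction of an edge, the
contributions of the edges parallel to it nearly cancel. -/
lemma IsPolygon.parallel_sum_small (hΩ : IsPolygon Ω) (h : IsEdge Ω a b) {M ε : ℝ} (hM : 0 ≤ M)
    (hε : 0 < ε) (s : Finset (Plane × Plane)) (hs : ∀ f ∈ s, IsEdge Ω f.1 f.2)
    (hpar : ∀ f ∈ edgeSet Ω, det2 (b - a) (f.2 - f.1) = 0 → f ∈ s)
    (k : Plane × Plane → ℝ) (hk : ∀ f ∈ s, f.2 - f.1 = k f • (b - a)) :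
    ∃ R : ℝ, ∀ ξ : Plane, |(inner ℝ ξ (b - a) : ℝ)| ≤ M → R ≤ ‖ξ‖ → ft Ω ξ = 0 →
      ‖∑ f ∈ s, (k f : ℂ) * edgeInt ξ f.1 f.2‖ ≤ ε := by
  classical
  have hfin := finite_edgeSet hΩ.finite_extremePoints
  have hsub : s ⊆ hfin.toFinset := fun f hf => hfin.mem_toFinset.2 (hs f hf)
  have he := h.sub_ne_zero
  have he' : 0 < ‖b - a‖ := norm_pos_iff.2 he
  obtain ⟨C, R, hCR⟩ := sum_nonparallel_bound he hM (hfin.toFinset \ s) (fun f hf h0 => by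
    rw [Finset.mem_sdiff, hfin.mem_toFinset] at hf
    exact hf.2 (hpar f hf.1 h0))
  refine ⟨max (max R 1) (max (2 * M / ‖b - a‖) (2 * C / (‖b - a‖ * ε))), ?_⟩
  intro ξ h1 h2 h3
  have hR1 : R ≤ ‖ξ‖ := (le_max_left _ _).trans ((le_max_left _ _).trans h2)
  have hR2 : 1 ≤ ‖ξ‖ := (le_max_right _ _).trans ((le_max_left _ _).trans h2)
  have hR3 : 2 * M / ‖b - a‖ ≤ ‖ξ‖ := (le_max_left _ _).trans ((le_max_right _ _).trans h2)
  have hR4 : 2 * C / (‖b - a‖ * ε) ≤ ‖ξ‖ := (le_max_right _ _).trans ((le_max_right _ _).trans h2)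
  have h4 := hCR ξ h1 hR1
  have h5 := green hΩ.isCompact hΩ.convex hΩ.interior_nonempty hΩ.finite_extremePoints hfin ξ
  -- At a zero the parallel part is minus the transversal part, hence at most C in modulus; dividing
  -- by the common determinant, of order ‖ξ‖, makes it small.
  rw [h3, mul_zero, ← Finset.sum_sdiff hsub, eq_comm, add_eq_zero_iff_eq_neg'] at h5
  have h6 : ∑ f ∈ s, (det2 ξ (f.2 - f.1) : ℂ) * edgeInt ξ f.1 f.2 =
      (det2 ξ (b - a) : ℂ) * ∑ f ∈ s, (k f : ℂ) * edgeInt ξ f.1 f.2 := by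
    rw [Finset.mul_sum]
    apply Finset.sum_congr rfl
    intro f hf
    rw [hk f hf, det2_smul_right]; push_cast; ring
  rw [h6] at h5
  have h7 := congrArg norm h5
  rw [norm_mul, norm_neg, Complex.norm_real, Real.norm_eq_abs, det2_swap, abs_neg] at h7
  have h8 := half_le_abs_det2 he hM h1 hR3
  set N := ‖∑ f ∈ s, (k f : ℂ) * edgeInt ξ f.1 f.2‖ with hN
  have hN0 : 0 ≤ N := norm_nonneg _
  have h9 : ‖b - a‖ * ‖ξ‖ / 2 * N ≤ C := by
    calc _ ≤ |det2 (b - a) ξ| * N := by gcongr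
      _ ≤ C := by rw [h7]; exact h4
  rw [div_le_iff₀ (by positivity)] at hR4
  have h10 : 0 < ‖b - a‖ * ‖ξ‖ := by positivity
  by_contra hcon
  push Not at hcon
  nlinarith [mul_lt_mul_of_pos_left hcon h10]

lemma exists_normal {e : Plane} (he : e ≠ 0) : ∃ n : Plane, ‖n‖ = 1 ∧ (inner ℝ n e : ℝ) = 0 := by
  refine ⟨‖e‖⁻¹ • rot e, ?_, ?_⟩
  · rw [norm_smul, norm_rot, norm_inv, norm_norm, inv_mul_cancel₀ (norm_ne_zero_iff.2 he)]
  · rw [inner_smul_left, inner_rot_left]; simp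

/-- Choose points of Λ near equally spaced points of the line normal to e. Their products with e are
bounded, so by compactness a subsequence has nearly equal products. -/
lemma IsSpectrum.exists_pair_in_thin_strip (h : IsSpectrum Ω Λ) (hint : (interior Ω).Nonempty)
    {e : Plane} (he : e ≠ 0) {σ : ℝ} (hσ : 0 < σ) (R : ℝ) :
    ∃ ξ ∈ Λ, ∃ η ∈ Λ, |(inner ℝ (ξ - η) e : ℝ)| ≤ σ ∧ R ≤ ‖ξ - η‖ := by
  obtain ⟨q, hq⟩ := hint
  obtain ⟨r, hr, hball⟩ := Metric.isOpen_iff.1 isOpen_interior q hq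
  obtain ⟨M, hM0, hM⟩ := h.exists_mem_near hr (hball.trans interior_subset)
  obtain ⟨n, hn1, hn2⟩ := exists_normal he
  -- Each chosen point is within M of its target, so targets at distance at least L give points at
  -- distance at least R.
  set L := |R| + 2 * M with hL
  choose f hf hfM using fun k : ℕ => hM ((k * L) • n)
  have hs : ∀ k, |(inner ℝ (f k) e : ℝ)| ≤ M * ‖e‖ := by
    intro k
    have : (inner ℝ (f k) e : ℝ) = -inner ℝ ((k * L) • n - f k) e := by
      rw [inner_sub_left, inner_smul_left, hn2]; simp
    rw [this, abs_neg]
    exact (abs_real_inner_le_norm _ _).trans (by have := hfM k; gcongr)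
  obtain ⟨x, -, φ, hφ, hlim⟩ := tendsto_subseq_of_bounded
    (Metric.isBounded_closedBall (x := (0 : ℝ)) (r := M * ‖e‖))
    (x := fun k => (inner ℝ (f k) e : ℝ)) (fun k => by simpa using hs k)
  have hcau := hlim.cauchySeq
  obtain ⟨N, hN⟩ := Metric.cauchySeq_iff.1 hcau σ hσ
  refine ⟨f (φ (N + 1)), hf _, f (φ N), hf _, ?_, ?_⟩
  · have := hN (N + 1) (by simp) N le_rfl
    rw [Real.dist_eq] at this
    rw [inner_sub_left]
    exact this.le
  · have h1 := hfM (φ (N + 1))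
    have h2 := hfM (φ N)
    have h3 : (φ N : ℝ) + 1 ≤ φ (N + 1) := by exact_mod_cast hφ (Nat.lt_succ_self N)
    have h4 : ‖((φ (N + 1) * L) • n - (φ N * L) • n : Plane)‖ = (φ (N + 1) - φ N : ℝ) * L := by
      rw [← sub_smul, norm_smul, hn1, mul_one, ← sub_mul, Real.norm_eq_abs, abs_of_nonneg]
      have : 0 ≤ L := by positivity
      exact mul_nonneg (by linarith) this
    have h5 : ‖((φ (N + 1) * L) • n - (φ N * L) • n : Plane)‖ ≤
        ‖f (φ (N + 1)) - f (φ N)‖ + ‖(φ (N + 1) * L) • n - f (φ (N + 1))‖ +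
          ‖(φ N * L) • n - f (φ N)‖ := by
      have : ((φ (N + 1) * L) • n - (φ N * L) • n : Plane) = (f (φ (N + 1)) - f (φ N)) +
        ((φ (N + 1) * L) • n - f (φ (N + 1))) - ((φ N * L) • n - f (φ N)) := by abel
      rw [this]
      exact (norm_sub_le _ _).trans (by gcongr; exact norm_add_le _ _)
    have h6 : L ≤ (φ (N + 1) - φ N : ℝ) * L := by
      have : 0 ≤ L := by positivity
      nlinarith
    have := le_abs_self R
    linarith

/-- In a spectral polygon no edge is longer than the opposite face. -/
lemma IsPolygon.not_longer (hΩ : IsPolygon Ω) (hΛ : IsSpectrum Ω Λ) (hab : b - a ≠ 0) {κ : ℝ}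
    (hκ : κ < 1)
    (hsmall : ∀ M ε : ℝ, 0 ≤ M → 0 < ε → ∃ R : ℝ, ∀ ξ : Plane, |(inner ℝ ξ (b - a) : ℝ)| ≤ M →
      R ≤ ‖ξ‖ → ft Ω ξ = 0 → ‖edgeInt ξ a b‖ ≤ κ + ε) : False := by
  have hpi := Real.pi_pos
  -- In a strip of this width the edge integral has modulus at least 1 - (1 - κ)/4, which exceeds
  -- the assumed bound κ + (1 - κ)/4.
  obtain ⟨R, hR⟩ := hsmall ((1 - κ) / (8 * Real.pi)) ((1 - κ) / 4)
    (div_nonneg (by linarith) (by linarith)) (by linarith)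
  obtain ⟨ξ, hξ, η, hη, h1, h2⟩ := hΛ.exists_pair_in_thin_strip hΩ.interior_nonempty hab
    (div_pos (by linarith : 0 < 1 - κ) (by positivity : 0 < 8 * Real.pi)) (max R 1)
  have hne : ξ ≠ η := by
    rintro rfl
    have := (le_max_right R 1).trans h2
    simp at this
    linarith
  have h3 := hR (ξ - η) h1 ((le_max_left _ _).trans h2) (hΛ.ft_eq_zero hξ hη hne)
  rw [norm_edgeInt] at h3
  have h4 := one_sub_le_norm_unitInt (inner ℝ (ξ - η) (b - a))
  have h5 : 2 * Real.pi * |(inner ℝ (ξ - η) (b - a) : ℝ)| ≤ (1 - κ) / 4 := by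
    calc _ ≤ 2 * Real.pi * ((1 - κ) / (8 * Real.pi)) := by gcongr
      _ = (1 - κ) / 4 := by field_simp; ring
  linarith

/-- The case of exactly two parallel edges in `IsPolygon.parallel_sum_small`; the weight -k records
the opposite orientation and the ratio of the lengths. -/
lemma IsPolygon.opposite_small (hΩ : IsPolygon Ω) (h : IsEdge Ω a b) (h' : IsEdge Ω c d) {k : ℝ}
    (hk : 0 < k) (heq : d - c = -(k • (b - a))) {M ε : ℝ} (hM : 0 ≤ M) (hε : 0 < ε) :
    ∃ R : ℝ, ∀ ξ : Plane, |(inner ℝ ξ (b - a) : ℝ)| ≤ M → R ≤ ‖ξ‖ → ft Ω ξ = 0 →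
      ‖edgeInt ξ a b - k * edgeInt ξ c d‖ ≤ ε := by
  classical
  have hne : (a, b) ≠ (c, d) := by
    intro hh
    rw [Prod.mk.injEq] at hh
    rw [← hh.1, ← hh.2] at heq
    have : (1 + k) • (b - a) = 0 := by rw [add_smul, one_smul]; nth_rewrite 1 [heq]; abel
    rcases smul_eq_zero.1 this with h1 | h1
    · linarith
    · exact h.sub_ne_zero h1
  obtain ⟨R, hR⟩ := hΩ.parallel_sum_small h hM hε {(a, b), (c, d)}
    (by
      intro f hf
      rw [Finset.mem_insert, Finset.mem_singleton] at hf
      rcases hf with rfl | rfl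
      · exact h
      · exact h')
    (by
      intro f hf h0
      rw [Finset.mem_insert, Finset.mem_singleton]
      rcases h.parallel_edges with h1 | ⟨c', d', k', h1, h2, h3, h4⟩
      · exact Or.inl (h1 f hf h0)
      · rcases h4 f hf h0 with h5 | h5
        · exact Or.inl h5
        · have h6 := h4 (c, d) h' (by simp only; rw [heq, det2_neg_right, det2_smul_right]; simp)
          rcases h6 with h6 | h6
          · exact absurd h6.symm hne
          · right; rw [h5, h6])
    (fun f => if f = (a, b) then 1 else -k)
    (by
      intro f hf
      rw [Finset.mem_insert, Finset.mem_singleton] at hf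
      rcases hf with rfl | rfl
      · simp
      · rw [if_neg hne.symm]; simp only; rw [heq, neg_smul])
  refine ⟨R, fun ξ h1 h2 h3 => ?_⟩
  have := hR ξ h1 h2 h3
  rw [Finset.sum_pair hne, if_pos rfl, if_neg hne.symm] at this
  convert this using 2
  push_cast; ring

/-- In a spectral polygon, each edge has an opposite edge of the same length. -/
theorem IsPolygon.exists_opposite_of_spectrum (hΩ : IsPolygon Ω) (hΛ : IsSpectrum Ω Λ)
    (h : IsEdge Ω a b) : ∃ c d, IsEdge Ω c d ∧ d - c = -(b - a) := by
  have hone : ∀ ξ p q, ‖edgeInt ξ p q‖ ≤ 1 := fun ξ p q => by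
    rw [norm_edgeInt]; exact norm_unitInt_le_one _
  have key : ∀ {a b c d : Plane} {k : ℝ}, IsEdge Ω a b → IsEdge Ω c d → 0 < k →
      d - c = -(k • (b - a)) → 1 ≤ k := by
    intro a b c d k h h' hk heq
    by_contra hlt
    push Not at hlt
    refine hΩ.not_longer hΛ h.sub_ne_zero hlt ?_
    intro M ε hM hε
    obtain ⟨R, hR⟩ := hΩ.opposite_small h h' hk heq hM hε
    refine ⟨R, fun ξ h1 h2 h3 => ?_⟩
    have h4 := hR ξ h1 h2 h3
    have h5 := norm_sub_norm_le (edgeInt ξ a b) (k * edgeInt ξ c d)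
    rw [norm_mul, Complex.norm_real, Real.norm_eq_abs, abs_of_pos hk] at h5
    have h6 : k * ‖edgeInt ξ c d‖ ≤ k * 1 := by have := hone ξ c d; gcongr
    linarith
  rcases h.parallel_edges with h1 | ⟨c, d, k, h1, h2, h3, -⟩
  · exfalso
    refine hΩ.not_longer hΛ h.sub_ne_zero zero_lt_one ?_
    intro M ε hM hε
    obtain ⟨R, hR⟩ := hΩ.parallel_sum_small h hM hε {(a, b)}
      (by intro f hf; rw [Finset.mem_singleton] at hf; rw [hf]; exact h)
      (by intro f hf h0; rw [Finset.mem_singleton]; exact h1 f hf h0) (fun _ => 1)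
      (by intro f hf; rw [Finset.mem_singleton] at hf; rw [hf]; simp)
    refine ⟨R, fun ξ h1 h2 h3 => ?_⟩
    simpa using hR ξ h1 h2 h3
  -- Exchanging the two edges replaces the length ratio k by k⁻¹, so both are at least 1.
  · have k1 := key h h1 h2 h3
    have k2 := key h1 h (inv_pos.2 h2) (by
      rw [h3, smul_neg, neg_neg, smul_smul, inv_mul_cancel₀ h2.ne', one_smul])
    have k3 : k ≤ 1 := by
      by_contra hlt
      push Not at hlt
      have := inv_lt_one_of_one_lt₀ hlt
      linarith
    have : k = 1 := le_antisymm k3 k1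
    exact ⟨c, d, h1, by rw [h3, this, one_smul]⟩

/-! ### Integrality of the products with the edge translations -/

/-- At far away zeros of the Fourier transform near the normal direction of an edge `ab` with
opposite edge `cd`, the inner product with `b - a` or with the translation `a - d` is almost an
integer. -/
lemma IsPolygon.almost_integer (hΩ : IsPolygon Ω) (h : IsEdge Ω a b) (h' : IsEdge Ω c d)
    (heq : d - c = -(b - a)) {M ε : ℝ} (hM : 0 ≤ M) (hε : 0 < ε) :
    ∃ R : ℝ, ∀ ξ : Plane, |(inner ℝ ξ (b - a) : ℝ)| ≤ M → R ≤ ‖ξ‖ → ft Ω ξ = 0 →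
      circNorm (inner ℝ ξ (a - d)) * circNorm (inner ℝ ξ (b - a)) ≤ ε := by
  have hpi := Real.pi_pos
  obtain ⟨R, hR⟩ := hΩ.opposite_small h h' one_pos (by rw [one_smul]; exact heq) hM
    (div_pos hε (by positivity : 0 < 2 * Real.pi * (M + 1)))
  refine ⟨R, fun ξ h1 h2 h3 => ?_⟩
  have h4 := hR ξ h1 h2 h3
  -- With cd reversed, both edge integrals contain the same `unitInt`, and only the phases at a and
  -- d differ. Multiplying by 2π|⟨ξ, b - a⟩| then turns `unitInt` into `circNorm`.
  rw [Complex.ofReal_one, one_mul, edgeInt_comm ξ c d, edgeInt_eq, edgeInt_eq] at h4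
  have : c - d = b - a := by rw [← neg_sub, heq, neg_neg]
  rw [this, ← sub_mul, norm_mul, expFun_eq, expFun_eq, ← circNorm_eq_norm_sub,
    ← inner_sub_right] at h4
  rw [← norm_unitInt_mul (inner ℝ ξ (b - a))]
  rw [le_div_iff₀ (by positivity)] at h4
  refine le_trans ?_ h4
  set J := ‖unitInt (inner ℝ ξ (b - a))‖
  have hJ : 0 ≤ J := norm_nonneg _
  have hc := circNorm_nonneg (inner ℝ ξ (a - d))
  calc _ = circNorm (inner ℝ ξ (a - d)) * J * (2 * Real.pi * |(inner ℝ ξ (b - a) : ℝ)|) := by ring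
    _ ≤ circNorm (inner ℝ ξ (a - d)) * J * (2 * Real.pi * (M + 1)) := by gcongr; linarith

/-- If the edge `ab` of a spectral polygon has the opposite edge `cd`, and a ball inside the
polygon stays inside it when translated by `b - a`, then the inner products of the points of the
spectrum with `a - d` are congruent modulo `1`. -/
theorem IsPolygon.inner_translation_int (hΩ : IsPolygon Ω) (hΛ : IsSpectrum Ω Λ) (h : IsEdge Ω a b)
    (h' : IsEdge Ω c d) (heq : d - c = -(b - a)) {q : Plane} {r : ℝ} (hr : 0 < r)
    (hre : 2 * r ≤ ‖b - a‖) (hq : Metric.ball q r ⊆ Ω)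
    (hqe : ∀ x ∈ Metric.ball q r, x + (b - a) ∈ Ω) {ξ₁ ξ₂ : Plane} (h₁ : ξ₁ ∈ Λ) (h₂ : ξ₂ ∈ Λ) :
    ∃ n : ℤ, (inner ℝ (ξ₁ - ξ₂) (a - d) : ℝ) = n := by
  rw [← circNorm_eq_zero_iff]
  by_contra hne
  set e := b - a with he
  set τ := a - d with hτ
  set u : Plane → ℝ := fun ξ => inner ℝ ξ τ with hu
  set s : Plane → ℝ := fun ξ => inner ℝ ξ e with hs
  set η := circNorm (u ξ₁ - u ξ₂) with hη
  have hη0 : 0 < η := by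
    refine lt_of_le_of_ne (circNorm_nonneg _) (Ne.symm ?_)
    rw [hη, hu]; simp only; rwa [← inner_sub_left]
  obtain ⟨M, hM0, hM⟩ := hΛ.exists_mem_near_of_translate hr hre hq hqe
  obtain ⟨n, hn1, hn2⟩ := exists_normal h.sub_ne_zero
  -- The search is centred at a far point of the normal line, so that the product with e stays
  -- bounded.
  have hfar : ∀ (ρ s₀ : ℝ), ∃ p ∈ Λ, ρ ≤ ‖p‖ ∧ |s p| ≤ M * ‖e‖ ∧ 1 / 2 ≤ circNorm (s p - s₀) := by
    intro ρ s₀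
    obtain ⟨p, hp, h1, h2⟩ := hM ((|ρ| + M) • n) s₀
    refine ⟨p, hp, ?_, ?_, h2⟩
    · have h3 : ‖(|ρ| + M) • n‖ ≤ ‖(|ρ| + M) • n - p‖ + ‖p‖ := by
        have := norm_add_le ((|ρ| + M) • n - p) p
        rwa [sub_add_cancel] at this
      rw [norm_smul, hn1, mul_one, Real.norm_eq_abs, abs_of_nonneg (by positivity)] at h3
      have := le_abs_self ρ
      linarith
    · have : s p = -inner ℝ ((|ρ| + M) • n - p) e := by
        simp only [hs]
        rw [inner_sub_left, inner_smul_left, hn2]; simp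
      rw [this, abs_neg]
      exact (abs_real_inner_le_norm _ _).trans (by gcongr)
  set M' := 2 * (M * ‖e‖) + |s ξ₁| + |s ξ₂| with hM'
  have hM'0 : 0 ≤ M' := by positivity
  obtain ⟨R, hR⟩ := hΩ.almost_integer h h' heq hM'0 (by positivity : 0 < η / 32)
  -- In the coordinates (u, s) modulo 1, two points of Λ that are far apart differ by nearly a rook
  -- move: the two displacements have a small product.
  have hrook : ∀ p ∈ Λ, ∀ p' ∈ Λ, max R 1 + ‖p'‖ ≤ ‖p‖ → |s p - s p'| ≤ M' →
      circNorm (u p - u p') * circNorm (s p - s p') ≤ η / 32 := by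
    intro p hp p' hp' h1 h2
    have h3 : max R 1 ≤ ‖p - p'‖ := by
      have := norm_sub_norm_le p p'; linarith
    have hne : p ≠ p' := by
      rintro rfl
      rw [sub_self, norm_zero] at h3
      have := (le_max_right R 1).trans h3
      linarith
    have := hR (p - p') (by rw [inner_sub_left]; exact h2) ((le_max_left _ _).trans h3)
      (hΛ.ft_eq_zero hp hp' hne)
    rwa [inner_sub_left, inner_sub_left] at this
  -- The far point p differs from ξ₁ in s, so agrees with it in u; hence it differs from ξ₂ in u and
  -- agrees with it in s. The still farther q' differs from ξ₂ in s, so agrees with it in u. Then q'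
  -- and p differ in both coordinates, which no rook move allows.
  obtain ⟨p, hp, hp1, hp2, hp3⟩ := hfar (max R 1 + ‖ξ₁‖ + ‖ξ₂‖) (s ξ₁)
  obtain ⟨q', hq', hq1, hq2, hq3⟩ := hfar (max R 1 + ‖ξ₂‖ + ‖p‖) (s ξ₂)
  have n1 := norm_nonneg ξ₁
  have n2 := norm_nonneg ξ₂
  have n3 := norm_nonneg p
  have a1 := abs_nonneg (s ξ₁)
  have a2 := abs_nonneg (s ξ₂)
  have a3 : 0 ≤ M * ‖e‖ := by positivity
  have r1 := hrook p hp ξ₁ h₁ (by linarith) ((abs_sub _ _).trans (by linarith))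
  have r2 := hrook p hp ξ₂ h₂ (by linarith) ((abs_sub _ _).trans (by linarith))
  have r3 := hrook q' hq' ξ₂ h₂ (by linarith) ((abs_sub _ _).trans (by linarith))
  have r4 := hrook q' hq' p hp (by linarith) ((abs_sub _ _).trans (by linarith))
  have t1 : circNorm (u p - u ξ₁) ≤ η / 16 := by
    nlinarith [circNorm_nonneg (u p - u ξ₁)]
  have t3 : circNorm (u q' - u ξ₂) ≤ η / 16 := by
    nlinarith [circNorm_nonneg (u q' - u ξ₂)]
  have t0 := circNorm_sub_le (u ξ₁) (u p) (u ξ₂)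
  rw [circNorm_sub_comm (u ξ₁) (u p), ← hη] at t0
  have t2 : circNorm (s p - s ξ₂) ≤ 1 / 16 := by
    have : η / 2 ≤ circNorm (u p - u ξ₂) := by linarith
    nlinarith [circNorm_nonneg (s p - s ξ₂)]
  have t4 := circNorm_sub_le (u p) (u q') (u ξ₂)
  rw [circNorm_sub_comm (u p) (u q')] at t4
  have t5 := circNorm_sub_le (s q') (s p) (s ξ₂)
  have t6 : η / 2 ≤ circNorm (u q' - u p) := by linarith
  have t7 : 1 / 4 ≤ circNorm (s q' - s p) := by linarith
  nlinarith [mul_le_mul t6 t7 (by norm_num) (circNorm_nonneg _)]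

end Asymptotics

/-! ### The translation group: zeros on its dual, spanning, discreteness -/

section Translations

variable {Ω Λ : Set Plane} {a b c d : Plane}

/-- Each edge has an opposite edge of the same length. -/
def HasOppositeEdges (Ω : Set Plane) : Prop :=
  ∀ a b, IsEdge Ω a b → ∃ c d, IsEdge Ω c d ∧ d - c = -(b - a)

/-- The vectors carrying an edge to the opposite one, described through oriented edges. -/
def edgeTranslations (Ω : Set Plane) : Set Plane :=
  {τ | ∃ a b c d, IsEdge Ω a b ∧ IsEdge Ω c d ∧ d - c = -(b - a) ∧ τ = a - d}

lemma IsEdge.eq_of_sub_eq (h : IsEdge Ω a b) (h' : IsEdge Ω c d) (heq : d - c = b - a) :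
    a = c ∧ b = d :=
  h.eq_of_sub_eq_smul h' one_pos (by rw [one_smul]; exact heq)

/-- The reversed edge from d to c becomes ab on translation by a - d, which changes the integral by
a factor 1. -/
lemma edgeInt_opposite {ξ : Plane} (heq : d - c = -(b - a)) {n : ℤ}
    (hn : (inner ℝ ξ (a - d) : ℝ) = n) : edgeInt ξ c d = edgeInt ξ a b := by
  have : c - d = b - a := by rw [← neg_sub, heq, neg_neg]
  rw [edgeInt_comm, edgeInt_eq, edgeInt_eq, this]
  congr 1
  have h1 : expFun ξ a = expFun ξ d * expFun ξ (a - d) := by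
    rw [← expFun_add_right]; congr 1; abel
  rw [h1, expFun_eq ξ (a - d), hn, ee_int, mul_one]

/-- The Fourier transform of a polygon with opposite edges vanishes on the dual of its
translation group. -/
theorem IsPolygon.ft_eq_zero (hΩ : IsPolygon Ω) (hopp : HasOppositeEdges Ω) {ξ : Plane}
    (hξ : ξ ≠ 0) (hint : ∀ τ ∈ edgeTranslations Ω, ∃ n : ℤ, (inner ℝ ξ τ : ℝ) = n) :
    ft Ω ξ = 0 := by
  classical
  have hfin := finite_edgeSet hΩ.finite_extremePoints
  have h1 := green hΩ.isCompact hΩ.convex hΩ.interior_nonempty hΩ.finite_extremePoints hfin ξ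
  have h2 : ∑ e ∈ hfin.toFinset, (det2 ξ (e.2 - e.1) : ℂ) * edgeInt ξ e.1 e.2 = 0 := by
    have hex : ∀ e : Plane × Plane, e ∈ hfin.toFinset →
        ∃ f : Plane × Plane, f ∈ hfin.toFinset ∧ f.2 - f.1 = -(e.2 - e.1) := by
      rintro ⟨a, b⟩ he
      obtain ⟨c, d, h1, h2⟩ := hopp a b (hfin.mem_toFinset.1 he)
      exact ⟨(c, d), hfin.mem_toFinset.2 h1, h2⟩
    choose o ho1 ho2 using hex
    -- Each edge is paired with its opposite: the integrals agree and the determinants have opposite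
    -- signs. Uniqueness of an edge in a given direction makes the pairing an involution.
    refine Finset.sum_involution o ?_ ?_ ho1 ?_
    · rintro ⟨a, b⟩ he
      have hab : IsEdge Ω a b := hfin.mem_toFinset.1 he
      have hcd : IsEdge Ω (o (a, b) he).1 (o (a, b) he).2 := hfin.mem_toFinset.1 (ho1 _ he)
      obtain ⟨n, hn⟩ := hint _ ⟨a, b, _, _, hab, hcd, ho2 _ he, rfl⟩
      rw [edgeInt_opposite (ho2 _ he) hn, ho2 _ he, det2_neg_right]
      push_cast; ring
    · rintro ⟨a, b⟩ he - heq
      have h3 := ho2 _ he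
      rw [heq] at h3
      have hab : IsEdge Ω a b := hfin.mem_toFinset.1 he
      have h4 : (2 : ℝ) • (b - a) = 0 := by rw [two_smul]; nth_rewrite 1 [h3]; simp
      exact hab.sub_ne_zero ((smul_eq_zero.1 h4).resolve_left two_ne_zero)
    · rintro ⟨a, b⟩ he
      have hab : IsEdge Ω a b := hfin.mem_toFinset.1 he
      have h3 : IsEdge Ω _ _ := hfin.mem_toFinset.1 (ho1 _ (ho1 _ he))
      obtain ⟨r1, r2⟩ := hab.eq_of_sub_eq h3 (by rw [ho2, ho2, neg_neg])
      exact Prod.ext r1.symm r2.symm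
  rw [h2] at h1
  have h3 : (2 * (Real.pi : ℂ) * Complex.I * (‖ξ‖ ^ 2 : ℝ)) ≠ 0 := by
    simp [Real.pi_ne_zero, hξ]
  exact (mul_eq_zero.1 h1).resolve_left h3

lemma IsPolygon.volume_real_pos (hΩ : IsPolygon Ω) : 0 < volume.real Ω := by
  refine SpectralPolytope.volume_real_pos hΩ.isCompact.isBounded ?_
  exact (isOpen_interior.measure_pos volume hΩ.interior_nonempty).trans_le
    (measure_mono interior_subset)

lemma continuous_ft (hΩ : IsPolygon Ω) : Continuous (ft Ω) := by
  have := isFiniteMeasure_restrict hΩ.isCompact.isBounded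
  unfold ft
  refine continuous_of_dominated (bound := fun _ => 1)
    (fun ξ => (continuous_expFun ξ).aestronglyMeasurable) (fun ξ => by simp)
    (integrable_const _) ?_
  filter_upwards with x
  simp only [expFun_eq]
  exact continuous_ee.comp (by fun_prop)

/-- The translation group of a polygon with opposite edges spans the plane. -/
theorem IsPolygon.span_edgeTranslations (hΩ : IsPolygon Ω) (hopp : HasOppositeEdges Ω) :
    Submodule.span ℝ (edgeTranslations Ω) = ⊤ := by
  by_contra hne
  have hbot : (Submodule.span ℝ (edgeTranslations Ω))ᗮ ≠ ⊥ := by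
    rwa [Ne, Submodule.orthogonal_eq_bot_iff]
  obtain ⟨ξ, hξ, hξ0⟩ := Submodule.exists_mem_ne_zero_of_ne_bot hbot
  -- Every multiple of a vector orthogonal to all translations has integral (zero) products with
  -- them. Continuity extends the vanishing to 0, contradicting positive area.
  have hzero : ∀ r : ℝ, r ≠ 0 → ft Ω (r • ξ) = 0 := by
    intro r hr
    refine hΩ.ft_eq_zero hopp (smul_ne_zero hr hξ0) (fun τ hτ => ⟨0, ?_⟩)
    have := (Submodule.mem_orthogonal _ _).1 hξ τ (Submodule.subset_span hτ)
    rw [inner_smul_left, real_inner_comm, this]; simp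
  have hcont : Continuous fun r : ℝ => ft Ω (r • ξ) := (continuous_ft hΩ).comp (by fun_prop)
  have h0 : ft Ω ((0 : ℝ) • ξ) = 0 := by
    have hcl : IsClosed {r : ℝ | ft Ω (r • ξ) = 0} := isClosed_eq hcont continuous_const
    have hd : Dense ({0}ᶜ : Set ℝ) := dense_compl_singleton 0
    have : (Set.univ : Set ℝ) ⊆ {r : ℝ | ft Ω (r • ξ) = 0} := by
      rw [← hd.closure_eq]
      exact closure_minimal (fun r hr => hzero r hr) hcl
    exact this (Set.mem_univ 0)
  rw [zero_smul, ft_zero] at h0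
  exact hΩ.volume_real_pos.ne' (by exact_mod_cast h0)

/-- An exposed face is given by a functional. The zero functional gives Ω, of dimension two; a
nonzero one gives a vertex, of dimension zero, or an edge. -/
lemma isFacet_iff (hΩ : IsPolygon Ω) (F : Set Plane) :
    IsFacet Ω F ↔ ∃ a b, IsEdge Ω a b ∧ F = segment ℝ a b := by
  constructor
  · rintro ⟨hne, hexp, hdim⟩
    obtain ⟨l, hl⟩ := hexp hne
    set u := (InnerProductSpace.toDual ℝ Plane).symm l with hu
    have hlu : ∀ x, l x = inner ℝ u x := fun x => by
      rw [hu, InnerProductSpace.toDual_symm_apply]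
    have hu0 : u ≠ 0 := by
      intro h0
      have hF : F = Ω := by
        rw [hl]; ext x; simp [hlu, h0]
      have htop : vectorSpan ℝ F = ⊤ := by
        rw [← direction_affineSpan, hF,
          hΩ.convex.interior_nonempty_iff_affineSpan_eq_top.1 hΩ.interior_nonempty]
        simp
      rw [htop] at hdim
      simp at hdim
    have hd0 : rot u ≠ 0 := by rw [← norm_ne_zero_iff, norm_rot, norm_ne_zero_iff]; exact hu0
    have hld : ∀ x y, l x - l y = -det2 (rot u) (x - y) := fun x y => by
      rw [det2_rot_left, inner_sub_right, hlu, hlu]; ring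
    obtain ⟨q, hq⟩ := hΩ.interior_nonempty
    rcases exists_vertex_or_edge hΩ.isCompact hΩ.convex ⟨q, interior_subset hq⟩ hd0 with
      ⟨p, hp, hpos⟩ | ⟨a, b, hab, k, hk, hk2⟩
    · exfalso
      have hFp : F ⊆ {p} := by
        intro x hx
        rw [hl] at hx
        by_contra hxp
        have h1 := hpos x hx.1 hxp
        have h2 := hx.2 p hp.1
        have := hld x p
        linarith
      have hvs0 : vectorSpan ℝ F = ⊥ :=
        vectorSpan_of_subsingleton ℝ (Set.subsingleton_singleton.anti hFp)
      rw [hvs0] at hdim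
      simp at hdim
    · refine ⟨a, b, hab, ?_⟩
      rw [hl, ← hab.face_eq]
      ext x
      constructor
      · rintro ⟨hx, hmax⟩
        refine ⟨hx, ?_⟩
        have h1 := hab.det2_nonneg x hx
        rw [hk2, det2_smul_left] at h1 ⊢
        have h2 := hmax a hab.left_mem
        have := hld x a
        nlinarith
      · rintro ⟨hx, h0⟩
        refine ⟨hx, fun y hy => ?_⟩
        have h1 := hab.det2_nonneg y hy
        rw [hk2, det2_smul_left] at h0 h1
        have h2 := (mul_eq_zero.1 h0).resolve_left hk.ne'
        have h3 := nonneg_of_mul_nonneg_right h1 hk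
        have := hld x a
        have := hld y a
        linarith
  · rintro ⟨a, b, hab, rfl⟩
    refine ⟨⟨a, left_mem_segment ℝ a b⟩, ?_, ?_⟩
    · intro _
      refine ⟨-innerSL ℝ (rot (b - a)), ?_⟩
      rw [← hab.face_eq]
      have hl : ∀ x, (-innerSL ℝ (rot (b - a)) : StrongDual ℝ Plane) x =
          -det2 (b - a) (x - a) - det2 (b - a) a := by
        intro x
        rw [neg_apply, innerSL_apply_apply, inner_rot_left, det2_sub_right]
        ring
      ext x
      simp only [hl, Set.mem_ofPred_eq]
      constructor
      · rintro ⟨hx, h0⟩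
        refine ⟨hx, fun y hy => ?_⟩
        have := hab.det2_nonneg y hy
        linarith
      · rintro ⟨hx, hmax⟩
        refine ⟨hx, ?_⟩
        have h1 := hmax a hab.left_mem
        have h2 := hab.det2_nonneg x hx
        rw [sub_self, det2_zero_right] at h1
        linarith
    · rw [vectorSpan_segment, vsub_eq_sub, finrank_span_singleton hab.sub_ne_zero]

/-- The two orientations of one segment cannot both be edges: an interior point would lie strictly
on the left of one and not on the left of the other. -/
lemma IsEdge.eq_of_segment_eq (h : IsEdge Ω a b) (h' : IsEdge Ω c d)
    (heq : segment ℝ a b = segment ℝ c d) (hΩ : IsPolygon Ω) : a = c ∧ b = d := by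
  have h1 : det2 (b - a) (c - a) = 0 := by
    have : c ∈ segment ℝ a b := heq ▸ left_mem_segment ℝ c d
    rw [← h.face_eq] at this; exact this.2
  have h2 : det2 (b - a) (d - a) = 0 := by
    have : d ∈ segment ℝ a b := heq ▸ right_mem_segment ℝ c d
    rw [← h.face_eq] at this; exact this.2
  have h3 : det2 (b - a) (d - c) = 0 := by
    have : d - c = (d - a) - (c - a) := by abel
    rw [this, det2_sub_right, h1, h2, sub_self]
  have h4 := eq_smul_of_det2_eq_zero h.sub_ne_zero h3
  set k := (inner ℝ (b - a) (d - c) : ℝ) / ‖b - a‖ ^ 2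
  rcases lt_trichotomy k 0 with hk | hk | hk
  · exfalso
    obtain ⟨x, hx⟩ := hΩ.interior_nonempty
    have h5 := det2_pos_of_mem_interior h.sub_ne_zero h.det2_nonneg hx
    have h6 := h'.det2_nonneg x (interior_subset hx)
    have h7 : x - c = (x - a) - (c - a) := by abel
    rw [h7, det2_sub_right, h4, det2_smul_left, det2_smul_left, h1] at h6
    nlinarith
  · exact absurd (by rw [h4, hk, zero_smul]) h'.sub_ne_zero
  · exact h.eq_of_sub_eq_smul h' hk h4

/-- The difference vectors are multiples of each other by factors of modulus at most 1 with product
1, so the factors are ±1. -/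
lemma endpoints_eq_of_segment_eq {p q : Plane} (hab : a ≠ b)
    (heq : segment ℝ a b = segment ℝ p q) : (p = a ∧ q = b) ∨ (p = b ∧ q = a) := by
  have hp : p ∈ segment ℝ a b := heq ▸ left_mem_segment ℝ p q
  have hq : q ∈ segment ℝ a b := heq ▸ right_mem_segment ℝ p q
  have ha : a ∈ segment ℝ p q := heq ▸ left_mem_segment ℝ a b
  have hb : b ∈ segment ℝ p q := heq ▸ right_mem_segment ℝ a b
  rw [segment_eq_image'] at hp hq ha hb
  obtain ⟨s, hs, hp⟩ := hp
  obtain ⟨t, ht, hq⟩ := hq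
  obtain ⟨s', hs', ha⟩ := ha
  obtain ⟨t', ht', hb⟩ := hb
  simp only at hp hq ha hb
  have h1 : ((t' - s') * (t - s) - 1) • (b - a) = 0 := by
    have e1 : q - p = (t - s) • (b - a) := by rw [← hq, ← hp]; module
    have e2 : b - a = (t' - s') • (q - p) := by
      calc b - a = (p + t' • (q - p)) - (p + s' • (q - p)) := by rw [hb, ha]
        _ = _ := by module
    rw [sub_smul, mul_smul, ← e1, ← e2, one_smul, sub_self]
  have h2 : (t' - s') * (t - s) = 1 := by
    have := (smul_eq_zero.1 h1).resolve_right (sub_ne_zero.2 hab.symm)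
    linarith
  have h3 : t - s = 1 ∨ t - s = -1 := by
    have b1 : (t - s) ^ 2 ≤ 1 := by nlinarith [hs.1, hs.2, ht.1, ht.2]
    have b2 : (t' - s') ^ 2 ≤ 1 := by nlinarith [hs'.1, hs'.2, ht'.1, ht'.2]
    have b3 : (t' - s') ^ 2 * (t - s) ^ 2 = 1 := by rw [← mul_pow, h2, one_pow]
    have b4 : (t - s) ^ 2 = 1 := by nlinarith [sq_nonneg (t - s)]
    exact sq_eq_one_iff.1 b4
  rcases h3 with h3 | h3
  · left
    have hs0 : s = 0 := by linarith [hs.1, ht.2]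
    have ht1 : t = 1 := by linarith
    exact ⟨by rw [← hp, hs0]; simp, by rw [← hq, ht1]; simp⟩
  · right
    have hs0 : s = 1 := by linarith [hs.2, ht.1]
    have ht1 : t = 0 := by linarith
    exact ⟨by rw [← hp, hs0]; simp, by rw [← hq, ht1]; simp⟩

lemma segment_vadd (τ a b : Plane) : segment ℝ (τ + a) (τ + b) = τ +ᵥ segment ℝ a b := by
  rw [← Set.image_vadd]
  simp only [vadd_eq_add]
  exact (segment_translate_image ℝ τ a b).symm

/-- The facet translations of a polygon in terms of oriented edges. -/
theorem facetTranslations_eq (hΩ : IsPolygon Ω) : facetTranslations Ω = edgeTranslations Ω := by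
  ext τ
  constructor
  · rintro ⟨F, F', hF, hF', hne, heq⟩
    obtain ⟨a, b, hab, rfl⟩ := (isFacet_iff hΩ F).1 hF
    obtain ⟨c, d, hcd, rfl⟩ := (isFacet_iff hΩ F').1 hF'
    rw [← segment_vadd] at heq
    have hends : (τ + c = a ∧ τ + d = b) ∨ (τ + c = b ∧ τ + d = a) := by
      exact endpoints_eq_of_segment_eq hab.ne heq
    rcases hends with ⟨r1, r2⟩ | ⟨r1, r2⟩
    -- A translation respecting the orientations would give two edges with the same direction, hence
    -- equal facets; so it exchanges the order of the ends.
    · exfalso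
      have : d - c = b - a := by rw [← r1, ← r2]; abel
      obtain ⟨s1, s2⟩ := hab.eq_of_sub_eq hcd this
      exact hne (by rw [s1, s2])
    · refine ⟨a, b, c, d, hab, hcd, ?_, ?_⟩
      · rw [← r1, ← r2]; abel
      · rw [← r2]; abel
  · rintro ⟨a, b, c, d, hab, hcd, heq, rfl⟩
    refine ⟨segment ℝ a b, segment ℝ c d, (isFacet_iff hΩ _).2 ⟨a, b, hab, rfl⟩,
      (isFacet_iff hΩ _).2 ⟨c, d, hcd, rfl⟩, ?_, ?_⟩
    · intro hseg
      obtain ⟨r1, r2⟩ := hab.eq_of_segment_eq hcd hseg hΩ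
      rw [r1, r2] at heq
      have h4 : (2 : ℝ) • (d - c) = 0 := by rw [two_smul]; nth_rewrite 1 [heq]; simp
      exact hcd.sub_ne_zero ((smul_eq_zero.1 h4).resolve_left two_ne_zero)
    · rw [← segment_vadd, segment_symm]
      congr 1
      · rw [sub_eq_iff_eq_add] at heq; rw [heq]; abel
      · abel

/-- A short nonzero vector cannot have integral inner products with all differences of points of
a spectrum. -/
lemma IsSpectrum.le_norm_of_inner_int (hΛ : IsSpectrum Ω Λ) {q : Plane} {r : ℝ}
    (hq : Metric.ball q r ⊆ Ω) {t : Plane} (ht : t ≠ 0)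
    (hint : ∀ ξ ∈ Λ, ∀ η ∈ Λ, ∃ n : ℤ, (inner ℝ (ξ - η) t : ℝ) = n) : r / 2 ≤ ‖t‖ := by
  by_contra hlt
  push Not at hlt
  have ht' : 0 < ‖t‖ := norm_pos_iff.2 ht
  -- If ‖t‖ < r / 2, the ball of radius ‖t‖ / 2 about q and its translate by t lie in the ball of
  -- radius r. Points of Λ with products far apart modulo 1 then contradict integrality.
  obtain ⟨M, -, hM⟩ := hΛ.exists_mem_near_of_translate (q := q) (e := t) (r := ‖t‖ / 2)
    (by positivity) (by linarith) ((Metric.ball_subset_ball (by linarith)).trans hq)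
    (fun x hx => hq (by
      rw [Metric.mem_ball, dist_eq_norm] at hx ⊢
      have : x + t - q = (x - q) + t := by abel
      rw [this]
      exact (norm_add_le _ _).trans_lt (by linarith)))
  obtain ⟨ξ₀, h0⟩ := hΛ.nonempty
  obtain ⟨ξ, hξ, -, h1⟩ := hM 0 (inner ℝ ξ₀ t)
  have h2 := (circNorm_eq_zero_iff _).2 (hint ξ hξ ξ₀ h0)
  rw [inner_sub_left] at h2
  rw [h2] at h1
  norm_num at h1

lemma isLatticeSubgroup_of_discrete {T : AddSubgroup Plane}
    (hspan : Submodule.span ℝ (T : Set Plane) = ⊤) {r : ℝ} (hr : 0 < r)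
    (hdisc : ∀ t ∈ T, t ≠ 0 → r ≤ ‖t‖) : IsLatticeSubgroup T := by
  let L : Submodule ℤ Plane := AddSubgroup.toIntSubmodule T
  have hLT : (L : Set Plane) = T := rfl
  have : DiscreteTopology L := by
    refine DiscreteTopology.of_forall_le_norm hr ?_
    rintro ⟨t, ht⟩ hne
    exact hdisc t ht (fun h => hne (Subtype.ext h))
  have : IsZLattice ℝ L := ⟨by rw [hLT]; exact hspan⟩
  have hfree : Module.Free ℤ L := ZLattice.module_free ℝ L
  have hfinite : Module.Finite ℤ L := ZLattice.module_finite ℝ L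
  have hrank : Module.finrank ℤ L = 2 := by rw [ZLattice.rank ℝ L]; simp
  let B : Module.Basis (Fin 2) ℤ L := Module.finBasisOfFinrankEq ℤ L hrank
  refine ⟨B.ofZLatticeBasis ℝ L, ?_⟩
  have h1 := B.ofZLatticeBasis_span ℝ
  have h2 := congrArg Submodule.toAddSubgroup h1
  rw [Submodule.span_int_eq_addSubgroupClosure] at h2
  rw [← AddSubgroup.toIntSubmodule.injective.eq_iff]
  exact h1.symm.trans (by rw [← Submodule.span_int_eq_addSubgroupClosure]; rfl)

end Translations

/-! ### Non-parallelograms overlap their translates along an edge -/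

section SpectralPolygon

variable {Ω Λ : Set Plane} {a b c d : Plane}

lemma IsConvexPolytope.isPolygon (h : IsConvexPolytope Ω) (hint : (interior Ω).Nonempty) :
    IsPolygon Ω := by
  obtain ⟨s, hs, rfl⟩ := h
  exact ⟨hs.isCompact_convexHull ℝ, convex_convexHull ℝ s, hint,
    hs.subset extremePoints_convexHull_subset⟩

lemma interior_nonempty_of_volume_pos (hconv : Convex ℝ Ω) (hpos : 0 < volume Ω) :
    (interior Ω).Nonempty := by
  by_contra hne
  rw [Set.not_nonempty_iff_eq_empty] at hne
  have h1 : Ω ⊆ frontier Ω := by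
    intro x hx
    rw [frontier, hne, Set.sdiff_empty]
    exact subset_closure hx
  have := measure_mono_null h1 (hconv.addHaar_frontier volume)
  exact hpos.ne' this

lemma eq_zero_of_det2_eq_zero {p q f : Plane} (h : det2 p q ≠ 0) (h1 : det2 f p = 0)
    (h2 : det2 f q = 0) : f = 0 := by
  by_contra hf
  have e1 := eq_smul_of_det2_eq_zero hf h1
  have e2 := eq_smul_of_det2_eq_zero hf h2
  apply h
  rw [e1, e2, det2_smul_left, det2_smul_right, det2_self]; simp

/-- A polygon with a pair of opposite edges of the same length which is not a parallelogram
contains, with some ball, its translate along these edges. -/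
lemma IsPolygon.exists_ball_of_not_isParallelogram (hΩ : IsPolygon Ω) (hnp : ¬ IsParallelogram Ω)
    (h : IsEdge Ω a b) (h' : IsEdge Ω c d) (heq : d - c = -(b - a)) :
    ∃ (q : Plane) (r : ℝ), 0 < r ∧ 2 * r ≤ ‖b - a‖ ∧ Metric.ball q r ⊆ Ω ∧
      ∀ x ∈ Metric.ball q r, x + (b - a) ∈ Ω := by
  set e := b - a with he
  set τ := a - d with hτ
  have hc : c = d + e := by rw [sub_eq_iff_eq_add] at heq; rw [heq]; abel
  have ha : a = d + τ := by rw [hτ]; abel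
  have hb : b = d + τ + e := by rw [hτ, he]; abel
  have hsuff : ∀ q ∈ interior Ω, q + e ∈ interior Ω → ∃ (q : Plane) (r : ℝ), 0 < r ∧
      2 * r ≤ ‖e‖ ∧ Metric.ball q r ⊆ Ω ∧ ∀ x ∈ Metric.ball q r, x + e ∈ Ω := by
    intro q h1 h2
    obtain ⟨r1, hr1, hball1⟩ := Metric.isOpen_iff.1 isOpen_interior q h1
    obtain ⟨r2, hr2, hball2⟩ := Metric.isOpen_iff.1 isOpen_interior (q + e) h2
    have he0 : 0 < ‖e‖ := norm_pos_iff.2 h.sub_ne_zero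
    refine ⟨q, min (min r1 r2) (‖e‖ / 2), by positivity, ?_, ?_, ?_⟩
    · have := min_le_right (min r1 r2) (‖e‖ / 2); linarith
    · exact (Metric.ball_subset_ball ((min_le_left _ _).trans (min_le_left _ _))).trans
        (hball1.trans interior_subset)
    · intro x hx
      apply interior_subset
      apply hball2
      rw [Metric.mem_ball, dist_eq_norm] at hx ⊢
      rw [add_sub_add_right_eq_sub]
      exact hx.trans_le ((min_le_left _ _).trans (min_le_right _ _))
  have hD : 0 < -det2 e τ := by
    have h1 := h.det2_nonneg d h'.right_mem
    have h2 : det2 e (d - a) = -det2 e τ := by rw [hτ, ← det2_neg_right, neg_sub]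
    rw [h2] at h1
    refine lt_of_le_of_ne h1 (fun h0 => ?_)
    obtain ⟨x, hx⟩ := hΩ.interior_nonempty
    have h3 := det2_pos_of_mem_interior h.sub_ne_zero h.det2_nonneg hx
    have h4 := h'.det2_nonneg x (interior_subset hx)
    have h5 : x - c = (x - a) + τ - e := by rw [hc, hτ]; abel
    rw [heq, det2_neg_left, h5, det2_sub_right, det2_add_right, det2_self] at h4
    rw [← he] at h3
    linarith
  set D := -det2 e τ with hDdef
  have hdet : det2 e τ ≠ 0 := by intro h0; rw [hDdef, h0] at hD; simp at hD
  -- The parallelogram spanned by the two opposite edges, in the coordinates (x, s) used below.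
  have hP : ∀ x s : ℝ, 0 ≤ x → x ≤ 1 → 0 ≤ s → s ≤ 1 → d + x • τ + s • e ∈ Ω := by
    intro x s hx0 hx1 hs0 hs1
    have m1 : d + s • e ∈ Ω := by
      have := hΩ.convex h'.right_mem h'.left_mem (sub_nonneg.2 hs1) hs0 (by ring)
      rw [hc] at this
      convert this using 1; module
    have m2 : d + τ + s • e ∈ Ω := by
      have := hΩ.convex h.left_mem h.right_mem (sub_nonneg.2 hs1) hs0 (by ring)
      rw [ha, hb] at this
      convert this using 1; module
    have := hΩ.convex m1 m2 (sub_nonneg.2 hx1) hx0 (by ring)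
    convert this using 1; module
  have hI : ∀ x s : ℝ, 0 < x → x < 1 → 0 < s → s < 1 → d + x • τ + s • e ∈ interior Ω := by
    intro x s hx0 hx1 hs0 hs1
    by_contra hni
    obtain ⟨f, hf, hsup⟩ := exists_support hΩ.convex hΩ.interior_nonempty hni
    have t1 := hsup _ (hP 0 s le_rfl zero_le_one hs0.le hs1.le)
    have t2 := hsup _ (hP 1 s zero_le_one le_rfl hs0.le hs1.le)
    have t3 := hsup _ (hP x 0 hx0.le hx1.le le_rfl zero_le_one)
    have t4 := hsup _ (hP x 1 hx0.le hx1.le zero_le_one le_rfl)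
    have s1 : d + (0 : ℝ) • τ + s • e - (d + x • τ + s • e) = (-x) • τ := by module
    have s2 : d + (1 : ℝ) • τ + s • e - (d + x • τ + s • e) = (1 - x) • τ := by module
    have s3 : d + x • τ + (0 : ℝ) • e - (d + x • τ + s • e) = (-s) • e := by module
    have s4 : d + x • τ + (1 : ℝ) • e - (d + x • τ + s • e) = (1 - s) • e := by module
    rw [s1, det2_smul_right] at t1
    rw [s2, det2_smul_right] at t2
    rw [s3, det2_smul_right] at t3
    rw [s4, det2_smul_right] at t4
    refine hf (eq_zero_of_det2_eq_zero hdet ?_ ?_)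
    · nlinarith [nonneg_of_mul_nonneg_right t4 (by linarith)]
    · nlinarith [nonneg_of_mul_nonneg_right t2 (by linarith)]
  have hrep : ∀ p : Plane, p = d + (det2 e (p - d) / det2 e τ) • τ +
      (det2 τ (p - d) / det2 τ e) • e := by
    intro p
    have hdet' : det2 τ e ≠ 0 := by rw [det2_swap]; exact neg_ne_zero.2 hdet
    have h0 : ∀ w : Plane, w = (det2 e w / det2 e τ) • τ + (det2 τ w / det2 τ e) • e := by
      intro w
      have h1 : det2 e τ • w = det2 e w • τ - det2 τ w • e := by
        ext i; fin_cases i <;> simp [det2] <;> ring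
      rw [det2_swap τ e, div_neg, div_eq_inv_mul, div_eq_inv_mul, neg_smul, ← sub_eq_add_neg,
        mul_smul, mul_smul, ← smul_sub, ← h1, smul_smul, inv_mul_cancel₀ hdet, one_smul]
    rw [add_assoc, ← h0]; abel
  obtain ⟨p, hp, hpP⟩ : ∃ p ∈ Ω, p ∉ (d +ᵥ parallelepiped ![τ, e] : Set Plane) := by
    by_contra! hcon
    apply hnp
    refine ⟨d, ![τ, e], ?_, Set.Subset.antisymm hcon ?_⟩
    · rw [LinearIndependent.pair_iff]
      intro s t hst
      have h1 : det2 e (s • τ + t • e) = 0 := by rw [hst]; simp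
      have h2 : det2 τ (s • τ + t • e) = 0 := by rw [hst]; simp
      rw [det2_add_right, det2_smul_right, det2_smul_right, det2_self] at h1 h2
      have hdet' : det2 τ e ≠ 0 := by rw [det2_swap]; exact neg_ne_zero.2 hdet
      simp [hdet, hdet'] at h1 h2
      exact ⟨h1, h2⟩
    · rintro _ ⟨y, hy, rfl⟩
      rw [mem_parallelepiped_iff] at hy
      obtain ⟨t, ⟨ht0, ht1⟩, rfl⟩ := hy
      have := hP (t 0) (t 1) (ht0 0) (ht1 0) (ht0 1) (ht1 1)
      simpa [Fin.sum_univ_two, add_assoc] using this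
  have hpeq := hrep p
  set x := det2 e (p - d) / det2 e τ with hx
  set s := det2 τ (p - d) / det2 τ e with hs
  have hnot : ¬ (0 ≤ x ∧ x ≤ 1 ∧ 0 ≤ s ∧ s ≤ 1) := by
    rintro ⟨g1, g2, g3, g4⟩
    apply hpP
    refine ⟨x • τ + s • e, ?_, ?_⟩
    · rw [mem_parallelepiped_iff]
      refine ⟨![x, s], ⟨fun i => ?_, fun i => ?_⟩, by simp [Fin.sum_univ_two]⟩
      · fin_cases i <;> simpa
      · fin_cases i <;> simpa
    · simp only [vadd_eq_add]
      rw [← add_assoc]; exact hpeq.symm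
  have hxD : det2 e (p - d) = -(x * D) := by
    rw [hx, hDdef]; field_simp
  have hs_unique : ∀ x' s' : ℝ, p = d + x' • τ + s' • e → s = s' := by
    intro x' s' h1
    have hdet' : det2 τ e ≠ 0 := by rw [det2_swap]; exact neg_ne_zero.2 hdet
    have h2 : p - d = x' • τ + s' • e := by rw [h1]; abel
    rw [hs, h2, det2_add_right, det2_smul_right, det2_smul_right, det2_self]
    field_simp; ring
  have hx1 : x ≤ 1 ∧ (x = 1 → 0 ≤ s ∧ s ≤ 1) := by
    have h1 := h.det2_nonneg p hp
    have h2 : det2 e (p - a) = (1 - x) * D := by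
      have : p - a = (p - d) - τ := by rw [hτ]; abel
      rw [this, det2_sub_right, hxD]; ring
    rw [← he, h2] at h1
    refine ⟨by nlinarith, fun h3 => ?_⟩
    obtain ⟨t, ht0, ht1, ht⟩ := h.exists_of_det2_eq_zero hp (by rw [← he, h2, h3]; simp)
    rw [hs_unique 1 t (by rw [ht, ← he]; nth_rewrite 1 [ha]; module)]
    exact ⟨ht0, ht1⟩
  have hx0 : 0 ≤ x ∧ (x = 0 → 0 ≤ s ∧ s ≤ 1) := by
    have h1 := h'.det2_nonneg p hp
    have h2 : det2 (d - c) (p - c) = x * D := by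
      have : p - c = (p - d) - e := by rw [hc]; abel
      rw [this, heq, det2_neg_left, det2_sub_right, hxD, det2_self]; ring
    rw [h2] at h1
    refine ⟨by nlinarith, fun h3 => ?_⟩
    obtain ⟨t, ht0, ht1, ht⟩ := h'.exists_of_det2_eq_zero hp (by rw [h2, h3]; simp)
    rw [hs_unique 0 (1 - t) (by rw [ht, heq, hc]; module)]
    exact ⟨by linarith, by linarith⟩
  -- A point p of Ω outside the parallelogram is on neither of the lines x = 0, x = 1, which meet Ω
  -- only in the two edges. So p extends a chord x = const beyond length 1, in the direction s < 0
  -- or s > 1.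
  have hx0' : 0 < x := lt_of_le_of_ne hx0.1
    (fun h0 => hnot ⟨hx0.1, hx1.1, (hx0.2 h0.symm).1, (hx0.2 h0.symm).2⟩)
  have hx1' : x < 1 := lt_of_le_of_ne hx1.1
    (fun h0 => hnot ⟨hx0.1, hx1.1, (hx1.2 h0).1, (hx1.2 h0).2⟩)
  have hmid : ∀ t : ℝ, 0 < t → t ≤ 1 →
      t • (d + x • τ + (1 / 2 : ℝ) • e) + (1 - t) • p ∈ interior Ω := by
    intro t ht0 ht1
    exact hΩ.convex.combo_interior_self_mem_interior
      (hI x (1 / 2) hx0' hx1' (by norm_num) (by norm_num)) hp ht0 (by linarith) (by ring)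
  have hs01 : s < 0 ∨ 1 < s := by
    by_contra hcon
    push Not at hcon
    exact hnot ⟨hx0'.le, hx1'.le, hcon.1, hcon.2⟩
  have hbetween : ∀ w t : ℝ, 0 < t → t ≤ 1 → w = t * (1 / 2) + (1 - t) * s →
      d + x • τ + w • e ∈ interior Ω := by
    intro w t ht0 ht1 hw
    have := hmid t ht0 ht1
    rw [hpeq] at this
    convert this using 1
    rw [hw]; module
  rcases hs01 with hs0 | hs1
  -- With 0 < δ < -s and δ < 1, the points of the chord with parameters -δ and 1 - δ are both
  -- interior and differ by e.
  · set δ := min (-s / 2) (1 / 2) with hδ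
    have hδ0 : 0 < δ := lt_min (by linarith) (by norm_num)
    have hδ1 : δ ≤ -s / 2 := min_le_left _ _
    have hδ2 : δ ≤ 1 / 2 := min_le_right _ _
    have hden : 0 < 1 / 2 - s := by linarith
    refine hsuff (d + x • τ + (-δ) • e) (hbetween (-δ) ((-δ - s) / (1 / 2 - s))
      (div_pos (by linarith) hden) ((div_le_one hden).2 (by linarith)) ?_) ?_
    · have := div_mul_cancel₀ (-δ - s) hden.ne'
      linarith
    · have := hI x (1 - δ) hx0' hx1' (by linarith) (by linarith)
      convert this using 1; module
  · set δ := min ((s - 1) / 2) (1 / 2) with hδ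
    have hδ0 : 0 < δ := lt_min (by linarith) (by norm_num)
    have hδ1 : δ ≤ (s - 1) / 2 := min_le_left _ _
    have hδ2 : δ ≤ 1 / 2 := min_le_right _ _
    have hden : 0 < s - 1 / 2 := by linarith
    refine hsuff (d + x • τ + δ • e) (hI x δ hx0' hx1' hδ0 (by linarith)) ?_
    have := hbetween (1 + δ) ((s - 1 - δ) / (s - 1 / 2))
      (div_pos (by linarith) hden) ((div_le_one hden).2 (by linarith)) (by
        have := div_mul_cancel₀ (s - 1 - δ) hden.ne'
        linarith)
    convert this using 1; module

lemma IsEdge.eq_or_eq_of_mem_extremePoints (h : IsEdge Ω a b) {x : Plane}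
    (hx : x ∈ Ω.extremePoints ℝ) (h0 : det2 (b - a) (x - a) = 0) : x = a ∨ x = b := by
  obtain ⟨s, hs0, hs1, hxs⟩ := h.exists_of_det2_eq_zero hx.1 h0
  by_contra! hne
  have hs0' : 0 < s := lt_of_le_of_ne hs0 (by rintro rfl; apply hne.1; rw [hxs]; simp)
  have hs1' : s < 1 := lt_of_le_of_ne hs1 (by rintro rfl; apply hne.2; rw [hxs]; simp)
  have := (mem_extremePoints.1 hx).2 a h.left_mem b h.right_mem
    ⟨1 - s, s, by linarith, hs0', by ring, by rw [hxs]; module⟩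
  exact hne.1 this.1.symm

/-! ### Central symmetry through the support function -/

/-- Near a direction, the support function of a polygon is the maximum of two linear functions. -/
lemma IsPolygon.eventually_inner_le (hΩ : IsPolygon Ω) {u p q : Plane}
    (h : ∀ x ∈ Ω.extremePoints ℝ, x ≠ p → x ≠ q → (inner ℝ u x : ℝ) < inner ℝ u p) :
    ∀ᶠ u' in nhds u, ∀ x ∈ Ω,
      (inner ℝ u' x : ℝ) ≤ max (inner ℝ u' p : ℝ) (inner ℝ u' q : ℝ) := by
  have h1 : ∀ᶠ u' in nhds u, ∀ x ∈ Ω.extremePoints ℝ,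
      (inner ℝ u' x : ℝ) ≤ max (inner ℝ u' p : ℝ) (inner ℝ u' q : ℝ) := by
    rw [Filter.eventually_all_finite hΩ.finite_extremePoints]
    intro x hx
    by_cases hp : x = p
    · exact Filter.Eventually.of_forall fun u' => hp ▸ le_max_left _ _
    by_cases hq : x = q
    · exact Filter.Eventually.of_forall fun u' => hq ▸ le_max_right _ _
    have hlt := h x hx hp hq
    have hc1 : Continuous fun u' : Plane => (inner ℝ u' x : ℝ) := by fun_prop
    have hc2 : Continuous fun u' : Plane => (inner ℝ u' p : ℝ) := by fun_prop
    filter_upwards [hc1.continuousAt.eventually_lt hc2.continuousAt hlt] with u' hu'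
    exact hu'.le.trans (le_max_left _ _)
  filter_upwards [h1] with u' hu'
  set m := max (inner ℝ u' p : ℝ) (inner ℝ u' q : ℝ)
  have hconv : Convex ℝ {x : Plane | (inner ℝ u' x : ℝ) ≤ m} :=
    convex_halfSpace_le (innerSL ℝ u').isBoundedLinearMap.toIsLinearMap m
  have hclosed : IsClosed {x : Plane | (inner ℝ u' x : ℝ) ≤ m} :=
    isClosed_le (by fun_prop) continuous_const
  have hsub : closure (convexHull ℝ (Ω.extremePoints ℝ)) ⊆ {x : Plane | (inner ℝ u' x : ℝ) ≤ m} :=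
    closure_minimal (convexHull_min hu' hconv) hclosed
  rw [closure_convexHull_extremePoints hΩ.isCompact hΩ.convex] at hsub
  exact hsub

lemma IsEdge.inner_lt (h : IsEdge Ω a b) {u : Plane} {k : ℝ} (hk : 0 < k)
    (hu : b - a = k • rot u) : ∀ x ∈ Ω.extremePoints ℝ, x ≠ a → x ≠ b →
      (inner ℝ u x : ℝ) < inner ℝ u a := by
  intro x hx hxa hxb
  have h1 : 0 < det2 (b - a) (x - a) := by
    refine lt_of_le_of_ne (h.det2_nonneg x hx.1) (fun h0 => ?_)
    rcases h.eq_or_eq_of_mem_extremePoints hx h0.symm with h2 | h2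
    · exact hxa h2
    · exact hxb h2
  rw [hu, det2_smul_left, det2_rot_left, inner_sub_right] at h1
  have := (mul_pos_iff_of_pos_left hk).1 h1
  linarith

/-- Near a direction normal to an edge ab, h(u') and h(-u') switch vertices on the same line,
because the opposite edge cd is parallel. As it also has the same length, the kinks cancel in the
difference, leaving ⟨u', b + d⟩. Near any other direction both terms are linear. -/
lemma IsPolygon.exists_locally_linear (hΩ : IsPolygon Ω) (hopp : HasOppositeEdges Ω)
    {h : Plane → ℝ} (hh : ∀ u, IsGreatest ((fun x => (inner ℝ u x : ℝ)) '' Ω) (h u)) {u : Plane}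
    (hu : u ≠ 0) : ∃ C : Plane, ∀ᶠ u' in nhds u, h u' - h (-u') = inner ℝ u' C := by
  have heqmax : ∀ u' p q : Plane, p ∈ Ω → q ∈ Ω → (∀ x ∈ Ω,
      (inner ℝ u' x : ℝ) ≤ max (inner ℝ u' p : ℝ) (inner ℝ u' q : ℝ)) →
      h u' = max (inner ℝ u' p : ℝ) (inner ℝ u' q : ℝ) := by
    intro u' p q hp hq hle
    apply le_antisymm
    · obtain ⟨x, hx, hxe⟩ := (hh u').1
      simp only at hxe
      rw [← hxe]; exact hle x hx
    · exact max_le ((hh u').2 ⟨p, hp, rfl⟩) ((hh u').2 ⟨q, hq, rfl⟩)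
  have hneg : Filter.Tendsto (fun u' : Plane => -u') (nhds u) (nhds (-u)) :=
    continuous_neg.continuousAt
  have hrot : rot (-u) = -rot u := by ext i; fin_cases i <;> simp [rot]
  have hru : ∀ u : Plane, u ≠ 0 → rot u ≠ 0 := fun u hu => by
    rw [← norm_ne_zero_iff, norm_rot, norm_ne_zero_iff]; exact hu
  have hedge : ∀ a b c d : Plane, ∀ k : ℝ, IsEdge Ω a b → IsEdge Ω c d → d - c = -(b - a) → 0 < k →
      b - a = k • rot u → ∃ C : Plane, ∀ᶠ u' in nhds u, h u' - h (-u') = inner ℝ u' C := by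
    intro a b c d k hab hcd heq hk hbk
    refine ⟨b + d, ?_⟩
    have h1 := hΩ.eventually_inner_le (hab.inner_lt hk hbk)
    have h2 := hneg.eventually (hΩ.eventually_inner_le (hcd.inner_lt (u := -u) hk (by
      rw [heq, hbk, hrot, smul_neg])))
    filter_upwards [h1, h2] with u' h3 h4
    rw [heqmax u' a b hab.left_mem hab.right_mem h3,
      heqmax (-u') c d hcd.left_mem hcd.right_mem h4]
    have hc : c = d + b - a := by rw [sub_eq_iff_eq_add] at heq; rw [heq]; abel
    rw [hc]
    simp only [inner_neg_left, inner_add_right, inner_sub_right]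
    rcases le_total (inner ℝ u' a : ℝ) (inner ℝ u' b) with hle | hle
    · rw [max_eq_right hle, max_eq_right (by linarith)]; ring
    · rw [max_eq_left hle, max_eq_left (by linarith)]; ring
  obtain ⟨x₀, hx₀⟩ := hΩ.interior_nonempty
  have hne : Ω.Nonempty := ⟨x₀, interior_subset hx₀⟩
  have hvert : ∀ u p : Plane, (∀ x ∈ Ω, x ≠ p → 0 < det2 (rot u) (x - p)) →
      ∀ x ∈ Ω.extremePoints ℝ, x ≠ p → x ≠ p → (inner ℝ u x : ℝ) < inner ℝ u p := by
    intro u p hpos x hx hxp _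
    have := hpos x hx.1 hxp
    rw [det2_rot_left, inner_sub_right] at this
    linarith
  rcases exists_vertex_or_edge hΩ.isCompact hΩ.convex hne (hru u hu) with
    ⟨p, hp, hpos⟩ | ⟨a, b, hab, k, hk, hbk⟩
  · rcases exists_vertex_or_edge hΩ.isCompact hΩ.convex hne (hru (-u) (neg_ne_zero.2 hu)) with
      ⟨q, hq, hqos⟩ | ⟨c, d, hcd, k, hk, hdk⟩
    · refine ⟨p + q, ?_⟩
      have h1 := hΩ.eventually_inner_le (hvert u p hpos)
      have h2 := hneg.eventually (hΩ.eventually_inner_le (hvert (-u) q hqos))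
      filter_upwards [h1, h2] with u' h3 h4
      rw [heqmax u' p p hp.1 hp.1 h3, heqmax (-u') q q hq.1 hq.1 h4]
      simp only [max_self, inner_neg_left, inner_add_right]; ring
    · obtain ⟨a, b, hab, heq⟩ := hopp c d hcd
      refine hedge a b c d k hab hcd (by rw [heq, neg_neg]) hk ?_
      rw [heq, hdk, hrot, smul_neg, neg_neg]
  · obtain ⟨c, d, hcd, heq⟩ := hopp a b hab
    exact hedge a b c d k hab hcd heq hk hbk

/-- A polygon in which each edge has an opposite edge of the same length is centrally
symmetric. -/
theorem IsPolygon.isCentrallySymmetric (hΩ : IsPolygon Ω) (hopp : HasOppositeEdges Ω) :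
    IsCentrallySymmetric Ω := by
  obtain ⟨x₀, hx₀⟩ := hΩ.interior_nonempty
  have hne : Ω.Nonempty := ⟨x₀, interior_subset hx₀⟩
  have hex : ∀ u : Plane, ∃ m, IsGreatest ((fun x => (inner ℝ u x : ℝ)) '' Ω) m := fun u =>
    (hΩ.isCompact.image (by fun_prop)).exists_isGreatest (hne.image _)
  choose h hh using hex
  have hloc := fun u (hu : u ≠ 0) => hΩ.exists_locally_linear hopp hh hu
  set v : Plane := EuclideanSpace.single 0 1 with hv
  have hv0 : v ≠ 0 := by simp [hv]
  obtain ⟨C, hC⟩ := hloc v hv0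
  -- This set is open, and relatively closed in the punctured plane since linear functions agreeing
  -- on an open set are equal. Connectedness of the punctured plane makes C global.
  set A : Set Plane := {u | ∀ᶠ u' in nhds u, h u' - h (-u') = inner ℝ u' C} with hA
  have hAopen : IsOpen A := by
    rw [isOpen_iff_mem_nhds]
    intro u hu
    exact eventually_eventually_nhds.2 hu
  have hpre : IsPreconnected ({0}ᶜ : Set Plane) :=
    (isConnected_compl_singleton_of_one_lt_rank (by
      rw [← Module.finrank_eq_rank]; simp) 0).isPreconnected
  have hsub : ({0}ᶜ : Set Plane) ⊆ A := by
    refine hpre.subset_of_closure_inter_subset hAopen ⟨v, hv0, hC⟩ ?_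
    rintro u ⟨hu, hu0⟩
    obtain ⟨C', hC'⟩ := hloc u hu0
    obtain ⟨w, hw, hwA⟩ := mem_closure_iff_nhds.1 hu _ (eventually_eventually_nhds.2 hC')
    have hCC : C' = C := by
      have h1 : ∀ᶠ u' in nhds w, (inner ℝ u' (C' - C) : ℝ) = 0 := by
        filter_upwards [hw, hwA] with u' h2 h3
        rw [inner_sub_right, ← h2, h3, sub_self]
      have h2 : Continuous fun ε : ℝ => w + ε • (C' - C) := by fun_prop
      have h3 : ∀ᶠ ε in nhds (0 : ℝ), (inner ℝ (w + ε • (C' - C)) (C' - C) : ℝ) = 0 := by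
        refine (h2.tendsto 0).eventually (p := fun u' : Plane => (inner ℝ u' (C' - C) : ℝ) = 0) ?_
        simpa using h1
      have h4 : ∀ᶠ ε in nhdsWithin (0 : ℝ) (Set.Ioi 0),
          (inner ℝ (w + ε • (C' - C)) (C' - C) : ℝ) = 0 := h3.filter_mono nhdsWithin_le_nhds
      obtain ⟨ε, h5, h6⟩ := (h4.and self_mem_nhdsWithin).exists
      have h7 := h1.self_of_nhds
      rw [inner_add_left, h7, inner_smul_left, zero_add, mul_eq_zero] at h5
      rcases h5 with h5 | h5
      · exact absurd h5 (ne_of_gt h6)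
      · exact sub_eq_zero.1 (inner_self_eq_zero.1 h5)
    rw [hCC] at hC'
    exact hC'
  have hD : ∀ u : Plane, h u - h (-u) = inner ℝ u C := by
    intro u
    rcases eq_or_ne u 0 with rfl | hu
    · simp
    · exact (hsub hu : ∀ᶠ u' in nhds u, h u' - h (-u') = inner ℝ u' C).self_of_nhds
  -- The identity `hD` says that Ω and C - Ω have the same support function; a separating functional
  -- would contradict it.
  have hmem : ∀ x ∈ Ω, C - x ∈ Ω := by
    intro x hx
    by_contra hn
    obtain ⟨f, s, hf1, hf2⟩ := geometric_hahn_banach_closed_point hΩ.convex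
      hΩ.isCompact.isClosed hn
    set u := (InnerProductSpace.toDual ℝ Plane).symm f with hu
    have hfu : ∀ x, f x = inner ℝ u x := fun x => by
      rw [hu, InnerProductSpace.toDual_symm_apply]
    obtain ⟨y, hy, hye⟩ := (hh u).1
    simp only at hye
    have h1 := hf1 y hy
    rw [hfu] at h1 hf2
    have h2 := (hh (-u)).2 ⟨x, hx, rfl⟩
    simp only [inner_neg_left] at h2
    rw [inner_sub_right] at hf2
    have := hD u
    linarith
  refine ⟨(2 : ℝ)⁻¹ • C, ?_⟩
  have hrefl : ∀ x, Equiv.pointReflection ((2 : ℝ)⁻¹ • C) x = C - x := by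
    intro x
    rw [Equiv.pointReflection_apply, vsub_eq_sub, vadd_eq_add]
    module
  ext x
  constructor
  · rintro ⟨y, hy, rfl⟩
    rw [hrefl]; exact hmem y hy
  · intro hx
    exact ⟨C - x, hmem x hx, by rw [hrefl]; abel⟩

/-! ### The structure of all spectra -/

lemma inner_int_of_mem_closure {S : Set Plane} {ξ : Plane}
    (h : ∀ τ ∈ S, ∃ n : ℤ, (inner ℝ τ ξ : ℝ) = n) :
    ∀ t ∈ AddSubgroup.closure S, ∃ n : ℤ, (inner ℝ t ξ : ℝ) = n := by
  intro t ht
  induction ht using AddSubgroup.closure_induction with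
  | mem x hx => exact h x hx
  | zero => exact ⟨0, by simp⟩
  | add x y _ _ hx hy =>
    obtain ⟨m, hm⟩ := hx
    obtain ⟨n, hn⟩ := hy
    exact ⟨m + n, by rw [inner_add_left, hm, hn]; push_cast; rfl⟩
  | neg x _ hx =>
    obtain ⟨m, hm⟩ := hx
    exact ⟨-m, by rw [inner_neg_left, hm]; push_cast; rfl⟩

lemma IsPolygon.ft_eq_zero_of_mem_dualLattice (hΩ : IsPolygon Ω) (hopp : HasOppositeEdges Ω)
    {ξ : Plane} (hξ : ξ ≠ 0) (hmem : ξ ∈ dualLattice (facetGroup Ω)) : ft Ω ξ = 0 := by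
  refine hΩ.ft_eq_zero hopp hξ (fun τ hτ => ?_)
  obtain ⟨n, hn⟩ := hmem τ (AddSubgroup.subset_closure (by rwa [facetTranslations_eq hΩ]))
  exact ⟨n, by rw [real_inner_comm, hn]⟩

lemma sub_mem_dualLattice {L : AddSubgroup Plane} {ξ η : Plane} (hξ : ξ ∈ dualLattice L)
    (hη : η ∈ dualLattice L) : ξ - η ∈ dualLattice L := by
  intro t ht
  obtain ⟨m, hm⟩ := hξ t ht
  obtain ⟨n, hn⟩ := hη t ht
  exact ⟨m - n, by rw [inner_sub_right, hm, hn]; push_cast; rfl⟩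

theorem spectrum_structure (hP : IsConvexPolytope Ω) (hΛ : IsSpectrum Ω Λ)
    (hnp : ¬ IsParallelogram Ω) :
    IsCentrallySymmetric Ω ∧ IsLatticeSubgroup (facetGroup Ω) ∧
      ∃ v : Plane, Λ = v +ᵥ dualLattice (facetGroup Ω) := by
  have hconv : Convex ℝ Ω := by
    obtain ⟨s, -, rfl⟩ := hP
    exact convex_convexHull ℝ s
  have hΩ := hP.isPolygon (interior_nonempty_of_volume_pos hconv hΛ.measure_pos)
  have hopp : HasOppositeEdges Ω := fun a b hab => hΩ.exists_opposite_of_spectrum hΛ hab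
  have hint : ∀ ξ ∈ Λ, ∀ η ∈ Λ, ξ - η ∈ dualLattice (facetGroup Ω) := by
    intro ξ hξ η hη
    refine inner_int_of_mem_closure ?_
    rw [facetTranslations_eq hΩ]
    rintro τ ⟨a, b, c, d, hab, hcd, heq, rfl⟩
    obtain ⟨q, r, hr, hre, hq, hqe⟩ := hΩ.exists_ball_of_not_isParallelogram hnp hab hcd heq
    obtain ⟨n, hn⟩ := hΩ.inner_translation_int hΛ hab hcd heq hr hre hq hqe hξ hη
    exact ⟨n, by rw [real_inner_comm, hn]⟩
  refine ⟨hΩ.isCentrallySymmetric hopp, ?_, ?_⟩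
  · obtain ⟨q, hq⟩ := hΩ.interior_nonempty
    obtain ⟨r, hr, hball⟩ := Metric.isOpen_iff.1 isOpen_interior q hq
    refine isLatticeSubgroup_of_discrete ?_ (half_pos hr) ?_
    · rw [eq_top_iff, ← hΩ.span_edgeTranslations hopp, ← facetTranslations_eq hΩ]
      exact Submodule.span_mono AddSubgroup.subset_closure
    · intro t ht ht0
      refine hΛ.le_norm_of_inner_int (hball.trans interior_subset) ht0 ?_
      intro ξ hξ η hη
      obtain ⟨n, hn⟩ := hint ξ hξ η hη t ht
      exact ⟨n, by rw [real_inner_comm, hn]⟩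
  · obtain ⟨ξ₀, h0⟩ := hΛ.nonempty
    refine ⟨ξ₀, Set.Subset.antisymm ?_ ?_⟩
    · intro ξ hξ
      exact ⟨ξ - ξ₀, hint ξ hξ ξ₀ h0, by simp⟩
    · rintro _ ⟨η, hη, rfl⟩
      -- A point of ξ₀ + T* differs from every point of Λ by an element of T*, so its exponential is
      -- orthogonal to all others in Λ and maximality applies.
      refine hΛ.mem_of_orthogonal (fun ξ hξ hne => ?_)
      refine hΩ.ft_eq_zero_of_mem_dualLattice hopp (sub_ne_zero.2 hne.symm) ?_
      have : ξ₀ + η - ξ = η - (ξ - ξ₀) := by abel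
      change ξ₀ + η - ξ ∈ dualLattice (facetGroup Ω)
      rw [this]
      exact sub_mem_dualLattice hη (hint ξ hξ ξ₀ h0)

theorem spectral_polygon (hP : IsConvexPolytope Ω) (hs : IsSpectral Ω)
    (hnp : ¬ IsParallelogram Ω) :
    IsCentrallySymmetric Ω ∧ HasUniqueSpectrumUpToTranslation Ω ∧
      IsLatticeSubgroup (facetGroup Ω) ∧
      ∀ Λ : Set Plane, IsSpectrum Ω Λ ↔ ∃ v : Plane, Λ = v +ᵥ dualLattice (facetGroup Ω) := by
  obtain ⟨Λ₀, hΛ₀⟩ := hs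
  obtain ⟨h1, h2, v₀, h3⟩ := spectrum_structure hP hΛ₀ hnp
  have hiff : ∀ Λ : Set Plane, IsSpectrum Ω Λ ↔ ∃ v : Plane, Λ = v +ᵥ dualLattice (facetGroup Ω) := by
    intro Λ
    constructor
    · intro hΛ
      exact (spectrum_structure hP hΛ hnp).2.2
    · rintro ⟨v, rfl⟩
      have := hΛ₀.vadd (v - v₀)
      rwa [h3, vadd_vadd, sub_add_cancel] at this
  refine ⟨h1, ⟨⟨Λ₀, hΛ₀⟩, ?_⟩, h2, hiff⟩
  intro Λ Λ' hΛ hΛ'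
  obtain ⟨v, rfl⟩ := (hiff Λ).1 hΛ
  obtain ⟨w, rfl⟩ := (hiff Λ').1 hΛ'
  exact ⟨w - v, by rw [vadd_vadd, sub_add_cancel]⟩

end SpectralPolygon

/-! ### Normal form of a centrally symmetric hexagon -/

section Hexagon

variable {Ω : Set Plane} {a b c A B C : Plane}

/-- A centrally symmetric hexagon with center `c` and vertices `c ± A`, `c ± B`, `c ± C`. -/
structure IsSymmetricHexagon (Ω : Set Plane) (c A B C : Plane) : Prop where
  isPolygon : IsPolygon Ω
  reflect_mem : ∀ x ∈ Ω, c + c - x ∈ Ω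
  det_AB_pos : 0 < det2 A B
  det_BC_pos : 0 < det2 B C
  det_AC_pos : 0 < det2 A C
  -- By det(A, C) B = det(B, C) A + det(A, B) C, these three inequalities say that B is outside the
  -- triangle 0, A, C, that A is outside 0, B, -C, and that C is outside 0, B, -A.
  det_AC_lt : det2 A C < det2 B C + det2 A B
  det_BC_lt : det2 B C < det2 A C + det2 A B
  det_AB_lt : det2 A B < det2 A C + det2 B C
  mem_extremePoints_iff : ∀ x, x ∈ Ω.extremePoints ℝ ↔
    x = c + A ∨ x = c - A ∨ x = c + B ∨ x = c - B ∨ x = c + C ∨ x = c - C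

lemma mem_of_mem_extremePoints_of_mem_convexHull (hconv : Convex ℝ Ω) {x : Plane}
    (hx : x ∈ Ω.extremePoints ℝ) {T : Set Plane} (hT : T ⊆ Ω) (hxT : x ∈ convexHull ℝ T) :
    x ∈ T :=
  extremePoints_convexHull_subset
    (inter_extremePoints_subset_extremePoints_of_subset (convexHull_min hT hconv) ⟨hxT, hx⟩)

/-- An extreme point of Ω in the triangle c, c + p, c + r is one of its corners. The factor k allows
determinants as coefficients without division. -/
lemma eq_of_extreme_combination (hconv : Convex ℝ Ω) {w p r : Plane}
    (hc : c ∈ Ω) (hw : c + w ∈ Ω.extremePoints ℝ) (hp : c + p ∈ Ω) (hr : c + r ∈ Ω)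
    {k s t : ℝ} (hk : 0 < k) (hs : 0 ≤ s) (ht : 0 ≤ t) (hst : s + t ≤ k)
    (h : k • w = s • p + t • r) : w = 0 ∨ w = p ∨ w = r := by
  have h1 : c + w ∈ ({c, c + p, c + r} : Set Plane) := by
    refine mem_of_mem_extremePoints_of_mem_convexHull hconv hw ?_ ?_
    · rintro x (rfl | rfl | rfl) <;> assumption
    · have hk' := hk.ne'
      rw [mem_convexHull_iff]
      intro K hK hKc
      have e1 : c ∈ K := hK (by simp)
      have e2 : c + p ∈ K := hK (by simp)
      have e3 : c + r ∈ K := hK (by simp)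
      have h2 : w = (s / k) • p + (t / k) • r := by
        rw [div_eq_inv_mul, div_eq_inv_mul, mul_smul, mul_smul, ← smul_add, ← h, smul_smul,
          inv_mul_cancel₀ hk', one_smul]
      have h3 := hKc.sum_mem (t := Finset.univ)
        (w := ![1 - s / k - t / k, s / k, t / k]) (z := ![c, c + p, c + r]) (by
          intro i _
          fin_cases i
          · simp only [Fin.zero_eta, Matrix.cons_val_zero]
            have : s / k + t / k ≤ 1 := by rw [← add_div]; exact (div_le_one hk).2 hst
            linarith
          · exact div_nonneg hs hk.le
          · exact div_nonneg ht hk.le) (by simp [Fin.sum_univ_three]; ring) (by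
          intro i _
          fin_cases i
          · exact e1
          · exact e2
          · exact e3)
      simp only [Fin.sum_univ_three, Matrix.cons_val_zero, Matrix.cons_val_one,
        Matrix.cons_val] at h3
      convert h3 using 1
      rw [h2]; module
  rcases h1 with h1 | h1 | h1
  · left; simpa using h1
  · right; left; exact add_left_cancel h1
  · right; right; exact add_left_cancel h1

/-- Of two parallel vectors one is a multiple of the other by a factor of modulus at most 1, so it
lies on a segment from the centre to plus or minus the other and cannot be extreme. -/
lemma det2_ne_zero_of_extreme (hconv : Convex ℝ Ω) {p q : Plane} (hc : c ∈ Ω)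
    (hp : c + p ∈ Ω.extremePoints ℝ) (hp' : c + -p ∈ Ω)
    (hq : c + q ∈ Ω.extremePoints ℝ) (hq' : c + -q ∈ Ω) (hp0 : p ≠ 0) (hq0 : q ≠ 0)
    (h1 : p ≠ q) (h2 : p ≠ -q) : det2 p q ≠ 0 := by
  intro h0
  have h2' : q ≠ -p := fun h => h2 (by rw [h, neg_neg])
  set k := (inner ℝ p q : ℝ) / ‖p‖ ^ 2 with hk
  have hqk : q = k • p := eq_smul_of_det2_eq_zero hp0 h0
  have hk0 : k ≠ 0 := by intro h; apply hq0; rw [hqk, h, zero_smul]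
  have key : ∀ l : ℝ, ∀ u v : Plane, c + u ∈ Ω.extremePoints ℝ → c + v ∈ Ω → c + -v ∈ Ω → u ≠ 0 →
      u ≠ v → u ≠ -v → |l| ≤ 1 → u = l • v → False := by
    intro l u v hu hv hv' hu0 n1 n2 hl huv
    rcases le_total 0 l with hl0 | hl0
    · rw [abs_of_nonneg hl0] at hl
      rcases eq_of_extreme_combination hconv hc hu hv hv one_pos hl0 le_rfl (by linarith)
        (by rw [huv]; module) with h | h | h
      · exact hu0 h
      · exact n1 h
      · exact n1 h
    · rw [abs_of_nonpos hl0] at hl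
      rcases eq_of_extreme_combination hconv hc hu hv' hv' one_pos (neg_nonneg.2 hl0) le_rfl
        (by linarith) (by rw [huv]; module) with h | h | h
      · exact hu0 h
      · exact n2 h
      · exact n2 h
  rcases le_total |k| 1 with hle | hle
  · exact key k q p hq hp.1 hp' hq0 h1.symm h2' hle hqk
  · refine key k⁻¹ p q hp hq.1 hq' hp0 h1 h2 ?_ ?_
    · rw [abs_inv]; exact inv_le_one_of_one_le₀ hle
    · rw [hqk, smul_smul, inv_mul_cancel₀ hk0, one_smul]

lemma det2_cyclic_relation (p q r : Plane) :
    det2 p r • q = det2 q r • p + det2 p q • r := by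
  ext i; fin_cases i <;> simp [det2] <;> ring

lemma exists_six_points {W : Set Plane} (hcard : W.ncard = 6) (hneg : ∀ w ∈ W, -w ∈ W)
    (h0 : (0 : Plane) ∉ W) : ∃ x y z : Plane, x ∈ W ∧ y ∈ W ∧ z ∈ W ∧ x ≠ y ∧ x ≠ -y ∧ x ≠ z ∧
      x ≠ -z ∧ y ≠ z ∧ y ≠ -z ∧ ∀ w ∈ W, w = x ∨ w = -x ∨ w = y ∨ w = -y ∨ w = z ∨ w = -z := by
  have hfin : W.Finite := Set.finite_of_ncard_ne_zero (by rw [hcard]; norm_num)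
  have hself : ∀ w ∈ W, w ≠ -w := fun w hw h => h0 (by
    have h2 : (2 : ℝ) • w = 0 := by rw [two_smul]; nth_rewrite 1 [h]; simp
    exact (smul_eq_zero.1 h2).resolve_left two_ne_zero ▸ hw)
  have hex : ∀ S : Set Plane, S.Finite → S.ncard < 6 → ∃ w ∈ W, w ∉ S := by
    intro S hS hlt
    by_contra! hcon
    have := Set.ncard_le_ncard hcon hS
    omega
  obtain ⟨x, hx, -⟩ := hex ∅ Set.finite_empty (by simp)
  obtain ⟨y, hy, hyn⟩ := hex {x, -x} (by simp) (by
    have := Set.ncard_insert_le x {-x}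
    simp only [Set.ncard_singleton] at this
    omega)
  obtain ⟨z, hz, hzn⟩ := hex {x, -x, y, -y} (by simp) (by
    have h1 := Set.ncard_insert_le x {-x, y, -y}
    have h2 := Set.ncard_insert_le (-x) {y, -y}
    have h3 := Set.ncard_insert_le y {-y}
    simp only [Set.ncard_singleton] at h3
    omega)
  simp only [Set.mem_insert_iff, Set.mem_singleton_iff, not_or] at hyn hzn
  obtain ⟨n1, n2⟩ := hyn
  obtain ⟨n3, n4, n5, n6⟩ := hzn
  have hxx := hself x hx
  have hyy := hself y hy
  have hzz := hself z hz
  have flip : ∀ u v : Plane, u ≠ -v → v ≠ -u := fun u v h h' => h (by rw [h', neg_neg])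
  have flip' : ∀ u v : Plane, u ≠ v → -u ≠ -v := fun u v h h' => h (neg_injective h')
  refine ⟨x, y, z, hx, hy, hz, Ne.symm n1, flip _ _ n2, Ne.symm n3, flip _ _ n4, Ne.symm n5,
    flip _ _ n6, ?_⟩
  have hsub : ({x, -x, y, -y, z, -z} : Set Plane) ⊆ W := by
    rintro w (rfl | rfl | rfl | rfl | rfl | rfl)
    exacts [hx, hneg _ hx, hy, hneg _ hy, hz, hneg _ hz]
  have hcard' : ({x, -x, y, -y, z, -z} : Set Plane).ncard = 6 := by
    have m1 : x ∉ ({-x, y, -y, z, -z} : Set Plane) := by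
      simp only [Set.mem_insert_iff, Set.mem_singleton_iff, not_or]
      exact ⟨hxx, Ne.symm n1, flip _ _ n2, Ne.symm n3, flip _ _ n4⟩
    have m2 : -x ∉ ({y, -y, z, -z} : Set Plane) := by
      simp only [Set.mem_insert_iff, Set.mem_singleton_iff, not_or]
      exact ⟨Ne.symm n2, flip' _ _ (Ne.symm n1), Ne.symm n4, flip' _ _ (Ne.symm n3)⟩
    have m3 : y ∉ ({-y, z, -z} : Set Plane) := by
      simp only [Set.mem_insert_iff, Set.mem_singleton_iff, not_or]
      exact ⟨hyy, Ne.symm n5, flip _ _ n6⟩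
    have m4 : -y ∉ ({z, -z} : Set Plane) := by
      simp only [Set.mem_insert_iff, Set.mem_singleton_iff, not_or]
      exact ⟨Ne.symm n6, flip' _ _ (Ne.symm n5)⟩
    rw [Set.ncard_insert_of_notMem m1, Set.ncard_insert_of_notMem m2,
      Set.ncard_insert_of_notMem m3, Set.ncard_insert_of_notMem m4, Set.ncard_pair hzz]
  have heq := Set.eq_of_subset_of_ncard_le hsub (by rw [hcard, hcard']) hfin
  intro w hw
  rw [← heq] at hw
  simpa using hw

lemma interior_nonempty_of_det2_ne_zero (hconv : Convex ℝ Ω) (hc : c ∈ Ω) (hA : c + A ∈ Ω)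
    (hB : c + B ∈ Ω) (hdet : det2 A B ≠ 0) : (interior Ω).Nonempty := by
  rw [hconv.interior_nonempty_iff_affineSpan_eq_top,
    ← AffineSubspace.direction_eq_top_iff_of_nonempty
      ((affineSpan_nonempty ℝ).2 ⟨c, hc⟩), direction_affineSpan, eq_top_iff]
  intro w _
  have h1 : A ∈ vectorSpan ℝ Ω := by
    have := vsub_mem_vectorSpan ℝ hA hc
    simpa using this
  have h2 : B ∈ vectorSpan ℝ Ω := by
    have := vsub_mem_vectorSpan ℝ hB hc
    simpa using this
  have h3 : det2 A B • w = det2 w B • A + det2 A w • B := det2_cyclic_relation A w B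
  have h4 : w = (det2 A B)⁻¹ • (det2 w B • A + det2 A w • B) := by
    rw [← h3, smul_smul, inv_mul_cancel₀ hdet, one_smul]
  rw [h4]
  exact Submodule.smul_mem _ _ (Submodule.add_mem _ (Submodule.smul_mem _ _ h1)
    (Submodule.smul_mem _ _ h2))

/-- Relative to the centre the vertices form three pairs ±x, ±y, ±z. Changing signs of y and z and
exchanging them puts x, y, z in counterclockwise order within a half plane; a failed inequality
would put one vertex into the triangle of the centre and two others. -/
theorem exists_isSymmetricHexagon (hhex : IsConvexHexagon Ω) (hsym : IsCentrallySymmetric Ω) :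
    ∃ c A B C : Plane, IsSymmetricHexagon Ω c A B C := by
  obtain ⟨hpoly, hcard⟩ := hhex
  obtain ⟨c, hc⟩ := hsym
  have hconv : Convex ℝ Ω := by
    obtain ⟨s, -, rfl⟩ := hpoly
    exact convex_convexHull ℝ s
  have hrefl : ∀ x ∈ Ω, c + c - x ∈ Ω := by
    intro x hx
    rw [← hc]
    refine ⟨x, hx, ?_⟩
    rw [Equiv.pointReflection_apply, vsub_eq_sub, vadd_eq_add]; abel
  have hextr : ∀ x ∈ Ω.extremePoints ℝ, c + c - x ∈ Ω.extremePoints ℝ := by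
    intro x hx
    rw [mem_extremePoints] at hx ⊢
    refine ⟨hrefl x hx.1, ?_⟩
    rintro y hy z hz ⟨s, t, hs, ht, hst, hyz⟩
    have := hx.2 _ (hrefl y hy) _ (hrefl z hz) ⟨s, t, hs, ht, hst, by
      have : s • (c + c - y) + t • (c + c - z) = (s + t) • (c + c) - (s • y + t • z) := by module
      rw [this, hyz, hst]; module⟩
    constructor
    · rw [← this.1]; abel
    · rw [← this.2]; abel
  set W : Set Plane := (fun w => c + w) ⁻¹' Ω.extremePoints ℝ with hW
  have hWcard : W.ncard = 6 := by
    rw [← hcard]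
    exact Set.ncard_preimage_of_injective_subset_range (add_right_injective c)
      (fun x _ => ⟨x - c, by simp⟩)
  have hWneg : ∀ w ∈ W, -w ∈ W := by
    intro w hw
    have : c + c - (c + w) ∈ Ω.extremePoints ℝ := hextr _ hw
    change c + -w ∈ Ω.extremePoints ℝ
    convert this using 1; abel
  have hcmem : ∀ w ∈ W, c ∈ Ω := by
    intro w hw
    have := hconv hw.1 (hWneg w hw).1 (by norm_num : (0 : ℝ) ≤ 1 / 2)
      (by norm_num : (0 : ℝ) ≤ 1 / 2) (by norm_num)
    convert this using 1; module
  have hW0 : (0 : Plane) ∉ W := by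
    intro h0
    have hfin : W.Finite := Set.finite_of_ncard_ne_zero (by rw [hWcard]; norm_num)
    have : ∃ w ∈ W, w ∉ ({0} : Set Plane) := by
      by_contra! hcon
      have := Set.ncard_le_ncard hcon (Set.finite_singleton 0)
      rw [hWcard, Set.ncard_singleton] at this
      omega
    obtain ⟨w, hw, hw0⟩ := this
    have h1 := (mem_extremePoints.1 h0).2 _ hw.1 _ (hWneg w hw).1
      ⟨1 / 2, 1 / 2, by norm_num, by norm_num, by norm_num, by module⟩
    exact hw0 (by simpa using h1.1)
  obtain ⟨x, y, z, hx, hy, hz, hxy, hxy', hxz, hxz', hyz, hyz', hall⟩ :=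
    exists_six_points hWcard hWneg hW0
  have hcΩ := hcmem x hx
  have hne : ∀ w ∈ W, w ≠ 0 := fun w hw h => hW0 (h ▸ hw)
  have hdet : ∀ u ∈ W, ∀ v ∈ W, u ≠ v → u ≠ -v → det2 u v ≠ 0 := fun u hu v hv h1 h2 =>
    det2_ne_zero_of_extreme hconv hcΩ hu (hWneg u hu).1 hv (hWneg v hv).1 (hne u hu) (hne v hv) h1 h2
  have flip : ∀ u v : Plane, u ≠ -v → v ≠ -u := fun u v h h' => h (by rw [h', neg_neg])
  have main : ∀ A ∈ W, ∀ B ∈ W, ∀ C ∈ W, 0 < det2 A B → 0 < det2 B C → 0 < det2 A C →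
      (∀ w ∈ W, w = A ∨ w = -A ∨ w = B ∨ w = -B ∨ w = C ∨ w = -C) →
      ∃ c A B C : Plane, IsSymmetricHexagon Ω c A B C := by
    intro A hA B hB C hC h1 h2 h3 hABC
    have hext : ∀ x, x ∈ Ω.extremePoints ℝ ↔
        x = c + A ∨ x = c - A ∨ x = c + B ∨ x = c - B ∨ x = c + C ∨ x = c - C := by
      intro x
      constructor
      · intro hx
        have := hABC (x - c) (by change c + (x - c) ∈ Ω.extremePoints ℝ; convert hx using 1; abel)
        simp only [sub_eq_iff_eq_add'] at this
        simpa only [sub_eq_add_neg] using this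
      · simp only [sub_eq_add_neg]
        rintro (rfl | rfl | rfl | rfl | rfl | rfl)
        exacts [hA, hWneg _ hA, hB, hWneg _ hB, hC, hWneg _ hC]
    have hne2 : ∀ u v : Plane, 0 < det2 u v → u ≠ v := by
      rintro u _ h rfl
      simp at h
    have hne3 : ∀ u v : Plane, 0 < det2 u v → u ≠ -v := by
      rintro u v h rfl
      simp [det2_neg_left] at h
    refine ⟨c, A, B, C, hpoly.isPolygon (interior_nonempty_of_det2_ne_zero hconv hcΩ hA.1 hB.1
      h1.ne'), hrefl, h1, h2, h3, ?_, ?_, ?_, hext⟩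
    · by_contra! hle
      rcases eq_of_extreme_combination hconv hcΩ hB hA.1 hC.1 h3 h2.le h1.le hle
        (det2_cyclic_relation A B C) with h | h | h
      · exact hne B hB h
      · exact hne2 A B h1 h.symm
      · exact hne2 B C h2 h
    · by_contra! hle
      rcases eq_of_extreme_combination hconv hcΩ hA hB.1 (hWneg C hC).1 h2 h3.le h1.le hle
        (by rw [smul_neg, det2_cyclic_relation A B C]; module) with h | h | h
      · exact hne A hA h
      · exact hne2 A B h1 h
      · exact hne3 A C h3 h
    · by_contra! hle
      rcases eq_of_extreme_combination hconv hcΩ hC hB.1 (hWneg A hA).1 h1 h3.le h2.le hle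
        (by rw [smul_neg, det2_cyclic_relation A B C]; module) with h | h | h
      · exact hne C hC h
      · exact hne2 B C h2 h.symm
      · exact hne3 A C h3 (by rw [h, neg_neg])
  have main' : ∀ y ∈ W, ∀ z ∈ W, 0 < det2 x y → 0 < det2 x z → y ≠ z → y ≠ -z →
      (∀ w ∈ W, w = x ∨ w = -x ∨ w = y ∨ w = -y ∨ w = z ∨ w = -z) →
      ∃ c A B C : Plane, IsSymmetricHexagon Ω c A B C := by
    intro y hy z hz h1 h2 h3 h4 h5
    rcases lt_or_gt_of_ne (hdet y hy z hz h3 h4) with h | h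
    · refine main x hx z hz y hy h2 (by rw [det2_swap]; linarith) h1 (fun w hw => ?_)
      rcases h5 w hw with h | h | h | h | h | h <;> simp [h]
    · exact main x hx y hy z hz h1 h h2 h5
  have main'' : ∀ z ∈ W, 0 < det2 x z → y ≠ z → y ≠ -z →
      (∀ w ∈ W, w = x ∨ w = -x ∨ w = y ∨ w = -y ∨ w = z ∨ w = -z) →
      ∃ c A B C : Plane, IsSymmetricHexagon Ω c A B C := by
    intro z hz h1 h2 h3 h5
    rcases lt_or_gt_of_ne (hdet x hx y hy hxy hxy') with h | h
    · refine main' (-y) (hWneg y hy) z hz (by rw [det2_neg_right]; linarith) h1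
        (fun h => h3 (by rw [← h, neg_neg])) (fun h => h2 (neg_injective h)) (fun w hw => ?_)
      rcases h5 w hw with h | h | h | h | h | h <;> simp [h]
    · exact main' y hy z hz h h1 h2 h3 h5
  rcases lt_or_gt_of_ne (hdet x hx z hz hxz hxz') with h | h
  · refine main'' (-z) (hWneg z hz) (by rw [det2_neg_right]; linarith) hyz'
      (by rwa [neg_neg]) (fun w hw => ?_)
    rcases hall w hw with h | h | h | h | h | h <;> simp [h]
  · exact main'' z hz h hyz hyz' hall

end Hexagon

/-! ### The hexagon packs by the lattice of A + B and B + C -/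

section HexagonLattice

variable {Ω : Set Plane} {a b c A B C : Plane}

lemma IsPolygon.subset_halfSpace (hΩ : IsPolygon Ω) {d p : Plane}
    (h : ∀ v ∈ Ω.extremePoints ℝ, 0 ≤ det2 d (v - p)) : ∀ x ∈ Ω, 0 ≤ det2 d (x - p) := by
  have hconv : Convex ℝ {x : Plane | 0 ≤ det2 d (x - p)} := by
    intro x hx y hy s t hs ht hst
    simp only [Set.mem_ofPred_eq] at hx hy ⊢
    have : s • x + t • y - p = s • (x - p) + t • (y - p) + (s + t - 1) • p := by module
    rw [this, hst, sub_self, zero_smul, add_zero, det2_add_right, det2_smul_right, det2_smul_right]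
    positivity
  have hclosed : IsClosed {x : Plane | 0 ≤ det2 d (x - p)} :=
    isClosed_le continuous_const ((continuous_det2 d).comp (by fun_prop))
  have hsub : closure (convexHull ℝ (Ω.extremePoints ℝ)) ⊆ {x : Plane | 0 ≤ det2 d (x - p)} :=
    closure_minimal (convexHull_min h hconv) hclosed
  rw [closure_convexHull_extremePoints hΩ.isCompact hΩ.convex] at hsub
  exact hsub

lemma IsEdge.reflect (hrefl : ∀ x ∈ Ω, c + c - x ∈ Ω) (h : IsEdge Ω a b) :
    IsEdge Ω (c + c - a) (c + c - b) := by
  have e1 : c + c - b - (c + c - a) = -(b - a) := by abel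
  have e2 : ∀ x, x - (c + c - a) = -(c + c - x - a) := fun x => by abel
  refine ⟨fun hne => h.ne (sub_right_injective hne), ?_, ?_⟩
  · intro x hx
    rw [e1, e2, det2_neg_left, det2_neg_right, neg_neg]
    exact h.det2_nonneg _ (hrefl x hx)
  · ext x
    constructor
    · rintro ⟨hx, h0⟩
      rw [e1, e2, det2_neg_left, det2_neg_right, neg_neg] at h0
      obtain ⟨s, hs0, hs1, hs⟩ := h.exists_of_det2_eq_zero (hrefl x hx) h0
      rw [segment_eq_image']
      refine ⟨s, ⟨hs0, hs1⟩, ?_⟩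
      have : x = c + c - (c + c - x) := by abel
      rw [this, hs]; module
    · intro hx
      rw [segment_eq_image'] at hx
      obtain ⟨s, hs, rfl⟩ := hx
      have hmem : a + s • (b - a) ∈ Ω := h.segment_subset (by
        rw [segment_eq_image']; exact ⟨s, hs, rfl⟩)
      constructor
      · have := hrefl _ hmem
        convert this using 1; module
      · simp [det2_smul_right]

namespace IsSymmetricHexagon

lemma hasOppositeEdges (h : IsSymmetricHexagon Ω c A B C) : HasOppositeEdges Ω := fun a b hab =>
  ⟨c + c - a, c + c - b, hab.reflect h.reflect_mem, by abel⟩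

lemma vertex_mem (h : IsSymmetricHexagon Ω c A B C) {v : Plane}
    (hv : v = A ∨ v = -A ∨ v = B ∨ v = -B ∨ v = C ∨ v = -C) : c + v ∈ Ω := by
  refine extremePoints_subset ((h.mem_extremePoints_iff _).2 ?_)
  rcases hv with rfl | rfl | rfl | rfl | rfl | rfl <;> simp [sub_eq_add_neg]

/-- Only neighbours in the cyclic order A, B, C, -A, -B, -C span an edge, with sums ±(A + B), ±(B +
C), ±(C - A). For any other pair some vertex lies strictly on the wrong side. -/
lemma edge_sum_mem (h : IsSymmetricHexagon Ω c A B C) (hab : IsEdge Ω a b) :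
    (a - c) + (b - c) ∈ AddSubgroup.closure {A + B, B + C} := by
  set L := AddSubgroup.closure ({A + B, B + C} : Set Plane)
  have hP : A + B ∈ L := AddSubgroup.subset_closure (by simp)
  have hQ : B + C ∈ L := AddSubgroup.subset_closure (by simp)
  have hR : C - A ∈ L := by
    have := L.sub_mem hQ hP
    convert this using 1; abel
  obtain ⟨p, rfl⟩ : ∃ p, a = c + p := ⟨a - c, by abel⟩
  obtain ⟨q, rfl⟩ : ∃ q, b = c + q := ⟨b - c, by abel⟩
  have hne : p ≠ q := fun hpq => hab.ne (by rw [hpq])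
  have hp := (h.mem_extremePoints_iff _).1 hab.left_mem_extremePoints
  have hq := (h.mem_extremePoints_iff _).1 hab.right_mem_extremePoints
  simp only [sub_eq_add_neg, add_right_inj] at hp hq
  have key : ∀ v, (v = A ∨ v = -A ∨ v = B ∨ v = -B ∨ v = C ∨ v = -C) →
      0 ≤ det2 q v - det2 p v - det2 q p := by
    intro v hv
    have h1 := hab.det2_nonneg _ (h.vertex_mem hv)
    rw [add_sub_add_left_eq_sub, add_sub_add_left_eq_sub, det2_sub_left, det2_sub_right,
      det2_sub_right, det2_self] at h1
    linarith
  have k1 := key A (by simp)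
  have k2 := key (-A) (by simp)
  have k3 := key B (by simp)
  have k4 := key (-B) (by simp)
  have k5 := key C (by simp)
  have k6 := key (-C) (by simp)
  have hBA := det2_swap B A
  have hCB := det2_swap C B
  have hCA := det2_swap C A
  have g1 := h.det_AB_pos
  have g2 := h.det_BC_pos
  have g3 := h.det_AC_pos
  have g4 := h.det_AC_lt
  have g5 := h.det_BC_lt
  have g6 := h.det_AB_lt
  have goal : ∀ u v : Plane, u ∈ L → (v = u ∨ v = -u) → v ∈ L := by
    rintro u v hu (rfl | rfl)
    exacts [hu, L.neg_mem hu]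
  rw [add_sub_cancel_left, add_sub_cancel_left]
  clear key
  rcases hp with rfl | rfl | rfl | rfl | rfl | rfl <;>
  rcases hq with rfl | rfl | rfl | rfl | rfl | rfl <;>
  first
  | exact absurd rfl hne
  | exact goal _ _ hP (Or.inl (by abel1))
  | exact goal _ _ hP (Or.inr (by abel1))
  | exact goal _ _ hQ (Or.inl (by abel1))
  | exact goal _ _ hQ (Or.inr (by abel1))
  | exact goal _ _ hR (Or.inl (by abel1))
  | exact goal _ _ hR (Or.inr (by abel1))
  | (exfalso
     simp only [det2_neg_left, det2_neg_right, det2_self, hBA, hCB, hCA] at k1 k2 k3 k4 k5 k6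
     linarith)

/-- The opposite edge is the reflection of ab in c, so the translation is the sum of the two
vertices relative to the centre. -/
lemma facetGroup_le (h : IsSymmetricHexagon Ω c A B C) :
     facetGroup Ω ≤ AddSubgroup.closure {A + B, B + C} := by
  rw [facetGroup, AddSubgroup.closure_le, facetTranslations_eq h.isPolygon]
  rintro τ ⟨a, b, a', b', hab, hab', heq, rfl⟩
  obtain ⟨-, h2⟩ := hab'.eq_of_sub_eq (hab.reflect h.reflect_mem) (by rw [heq]; abel)
  have := h.edge_sum_mem hab
  rw [h2]
  have e : a - (c + c - b) = a - c + (b - c) := by abel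
  rw [e]
  exact this

lemma det_sum_pos (h : IsSymmetricHexagon Ω c A B C) : 0 < det2 (A + B) (B + C) := by
  simp only [det2_add_left, det2_add_right, det2_self]
  linarith [h.det_AB_pos, h.det_BC_pos, h.det_AC_pos]

lemma det2_lt_of_mem_interior (h : IsSymmetricHexagon Ω c A B C) {d p : Plane} (hd : d ≠ 0)
    (hv : ∀ v, (v = A ∨ v = -A ∨ v = B ∨ v = -B ∨ v = C ∨ v = -C) → 0 ≤ det2 d v - det2 d p)
    {x : Plane} (hx : x ∈ interior Ω) : det2 d p < det2 d (x - c) := by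
  have h1 := h.isPolygon.subset_halfSpace (d := d) (p := c + p) (by
    intro v hvΩ
    have := (h.mem_extremePoints_iff v).1 hvΩ
    have e : v - (c + p) = (v - c) - p := by abel
    rw [e, det2_sub_right]
    apply hv
    simp only [sub_eq_iff_eq_add']
    simpa only [sub_eq_add_neg] using this)
  have h2 := det2_pos_of_mem_interior hd h1 hx
  have e : x - (c + p) = (x - c) - p := by abel
  rw [e, det2_sub_right] at h2
  linarith

/-- The open hexagon lies strictly between two parallel lines symmetric about the centre, so
differences of its points are bounded by the width of the strip. -/
lemma abs_det2_lt (h : IsSymmetricHexagon Ω c A B C) {d p : Plane} (hd : d ≠ 0)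
    (hv : ∀ v, (v = A ∨ v = B ∨ v = C) → |det2 d v| ≤ -det2 d p)
    {x y : Plane} (hx : x ∈ interior Ω) (hy : y ∈ interior Ω) :
    |det2 d (x - y)| < -(2 * det2 d p) := by
  have hA := abs_le.1 (hv A (by simp))
  have hB := abs_le.1 (hv B (by simp))
  have hC := abs_le.1 (hv C (by simp))
  have h1 : ∀ x ∈ interior Ω, det2 d p < det2 d (x - c) := fun x hx =>
    h.det2_lt_of_mem_interior hd (by
      rintro v (rfl | rfl | rfl | rfl | rfl | rfl) <;> (try simp only [det2_neg_right]) <;> linarith) hx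
  have h2 : ∀ x ∈ interior Ω, det2 (-d) (-p) < det2 (-d) (x - c) := fun x hx => by
    refine h.det2_lt_of_mem_interior (neg_ne_zero.2 hd) ?_ hx
    rintro v (rfl | rfl | rfl | rfl | rfl | rfl) <;>
      simp only [det2_neg_right, det2_neg_left, neg_neg] <;> linarith
  have e : x - y = (x - c) - (y - c) := by abel
  rw [e, det2_sub_right, abs_lt]
  have l1 := h1 x hx
  have l2 := h1 y hy
  have l3 := h2 x hx
  have l4 := h2 y hy
  simp only [det2_neg_left, det2_neg_right, neg_neg] at l3 l4
  constructor <;> linarith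

/-- Translates of the open hexagon by the lattice generated by `A + B` and `B + C` are disjoint. -/
lemma eq_of_sub_eq (h : IsSymmetricHexagon Ω c A B C) {x y : Plane} (hx : x ∈ interior Ω)
    (hy : y ∈ interior Ω) {m n : ℤ}
    (hxy : x - y = (m : ℝ) • (A + B) + (n : ℝ) • (B + C)) : x = y := by
  have hBA := det2_swap B A
  have hCB := det2_swap C B
  have hCA := det2_swap C A
  have g1 := h.det_AB_pos
  have g2 := h.det_BC_pos
  have g3 := h.det_AC_pos
  have g4 := h.det_AC_lt
  have g5 := h.det_BC_lt
  have g6 := h.det_AB_lt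
  -- The three strips are those parallel to the three pairs of sides. Each sign pattern of (m, n)
  -- other than (0, 0) is incompatible with their widths.
  have f1 := h.abs_det2_lt (d := B - A) (p := A) (by
      intro h0; rw [sub_eq_zero] at h0; rw [h0] at g1; simp at g1) (by
      rintro v (rfl | rfl | rfl) <;> rw [abs_le] <;>
        simp only [det2_sub_left, det2_self, hBA] <;> constructor <;> linarith) hx hy
  have f2 := h.abs_det2_lt (d := C - B) (p := B) (by
      intro h0; rw [sub_eq_zero] at h0; rw [h0] at g2; simp at g2) (by
      rintro v (rfl | rfl | rfl) <;> rw [abs_le] <;>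
        simp only [det2_sub_left, det2_self, hBA, hCB, hCA] <;> constructor <;> linarith) hx hy
  have f3 := h.abs_det2_lt (d := A + C) (p := A) (by
      intro h0; rw [add_eq_zero_iff_eq_neg] at h0; rw [h0, det2_neg_left] at g3; simp at g3) (by
      rintro v (rfl | rfl | rfl) <;> rw [abs_le] <;>
        simp only [det2_add_left, det2_self, hCB, hCA] <;> constructor <;> linarith) hx hy
  rw [hxy, abs_lt] at f1 f2 f3
  simp only [det2_add_left, det2_sub_left, det2_add_right, det2_smul_right, det2_self, hBA, hCB,
    hCA] at f1 f2 f3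
  have hm : ∀ k : ℤ, 0 < k → (1 : ℝ) ≤ k := fun k hk => by exact_mod_cast hk
  have hm' : ∀ k : ℤ, k < 0 → (k : ℝ) ≤ -1 := fun k hk => by
    have : k ≤ -1 := by omega
    exact_mod_cast this
  set D := det2 A C
  set X := det2 B C
  set Y := det2 A B
  have u : 0 < Y + D - X := by linarith
  have v : 0 < D + X - Y := by linarith
  have w : 0 < X + Y - D := by linarith
  suffices hmn : m = 0 ∧ n = 0 by
    rw [hmn.1, hmn.2] at hxy
    simpa [sub_eq_zero] using hxy
  rcases lt_trichotomy m 0 with hm0 | hm0 | hm0 <;> rcases lt_trichotomy n 0 with hn0 | hn0 | hn0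
  · nlinarith [mul_le_mul_of_nonneg_left (hm' m hm0) u.le, mul_le_mul_of_nonneg_left (hm' m hm0) w.le,
      mul_le_mul_of_nonneg_left (hm' n hn0) u.le]
  · rw [hn0, Int.cast_zero] at f1
    nlinarith [mul_le_mul_of_nonneg_left (hm' m hm0) g1.le]
  · nlinarith [mul_le_mul_of_nonneg_left (hm' m hm0) v.le,
      mul_le_mul_of_nonneg_left (hm n hn0) u.le]
  · rw [hm0, Int.cast_zero] at f2
    nlinarith [mul_le_mul_of_nonneg_left (hm' n hn0) g2.le]
  · exact ⟨hm0, hn0⟩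
  · rw [hm0, Int.cast_zero] at f2
    nlinarith [mul_le_mul_of_nonneg_left (hm n hn0) g2.le]
  · nlinarith [mul_le_mul_of_nonneg_left (hm m hm0) v.le,
      mul_le_mul_of_nonneg_left (hm' n hn0) u.le]
  · rw [hn0, Int.cast_zero] at f1
    nlinarith [mul_le_mul_of_nonneg_left (hm m hm0) g1.le]
  · nlinarith [mul_le_mul_of_nonneg_left (hm m hm0) u.le, mul_le_mul_of_nonneg_left (hm m hm0) w.le,
      mul_le_mul_of_nonneg_left (hm n hn0) u.le]

end IsSymmetricHexagon

end HexagonLattice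

/-! ### Completeness of pulled-back torus characters -/

section Completeness

open UnitAddTorus

variable {U : Set Plane} {g : Plane → ℂ}

lemma ae_eq_zero_of_isCompact_subset (hU : IsOpen U) (hg : IntegrableOn g U)
    (h : ∀ s ⊆ U, IsCompact s → ∫ x in s, g x = 0) : g =ᵐ[volume.restrict U] 0 := by
  obtain ⟨F, hF, hFU, hUF, -⟩ := hU.exists_iUnion_isClosed
  rw [← hUF]
  refine (ae_restrict_iUnion_iff _ _).2 (fun n => ?_)
  refine ae_eq_zero_of_forall_setIntegral_isCompact_eq_zero (hg.mono_set (hFU n)) ?_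
  intro s hs
  rw [Measure.restrict_restrict' (hF n).measurableSet]
  exact h _ (Set.inter_subset_right.trans (hFU n)) (hs.inter_right (hF n))

/-- Integration against g is a bounded functional on continuous functions of the torus, with norm at
most ∫ ‖g‖, and it vanishes on the dense span of the characters. -/
lemma integral_comp_mul_eq_zero {π : Plane → UnitAddTorus (Fin 2)} (hπ : Continuous π)
    (hg : IntegrableOn g U) (h : ∀ n : Fin 2 → ℤ, ∫ x in U, mFourier n (π x) * g x = 0)
    (φ : C(UnitAddTorus (Fin 2), ℂ)) : ∫ x in U, φ (π x) * g x = 0 := by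
  have hint : ∀ φ : C(UnitAddTorus (Fin 2), ℂ), IntegrableOn (fun x => φ (π x) * g x) U :=
    fun φ => hg.bdd_mul (c := ‖φ‖) (φ.continuous.comp hπ).aestronglyMeasurable
      (Filter.Eventually.of_forall fun x => φ.norm_coe_le_norm (π x))
  let L : C(UnitAddTorus (Fin 2), ℂ) →ₗ[ℂ] ℂ :=
    { toFun := fun φ => ∫ x in U, φ (π x) * g x
      map_add' := fun φ ψ => by
        simp only [ContinuousMap.add_apply, add_mul]
        exact integral_add (hint φ) (hint ψ)
      map_smul' := fun c φ => by
        simp only [ContinuousMap.smul_apply, smul_eq_mul, mul_assoc, RingHom.id_apply]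
        exact integral_const_mul _ _ }
  let L' : C(UnitAddTorus (Fin 2), ℂ) →L[ℂ] ℂ := L.mkContinuous (∫ x in U, ‖g x‖) (fun φ => by
    rw [mul_comm, ← integral_const_mul]
    refine norm_integral_le_of_norm_le (hg.norm.const_mul _) (Filter.Eventually.of_forall fun x => ?_)
    rw [norm_mul]
    exact mul_le_mul_of_nonneg_right (φ.norm_coe_le_norm (π x)) (norm_nonneg _))
  have hdense : Dense (Submodule.span ℂ (Set.range (mFourier (d := Fin 2))) :
      Set C(UnitAddTorus (Fin 2), ℂ)) := by
    rw [Submodule.dense_iff_topologicalClosure_eq_top]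
    exact span_mFourier_closure_eq_top
  have hL : L' = 0 := ContinuousLinearMap.ext_on hdense (by
    rintro _ ⟨n, rfl⟩
    exact h n)
  exact congrArg (fun f : C(UnitAddTorus (Fin 2), ℂ) →L[ℂ] ℂ => f φ) hL

/-- On a set which a continuous map injects into the torus, an integrable function is determined
by its integrals against the pullbacks of the characters of the torus. -/
theorem ae_eq_zero_of_integral_mFourier_eq_zero {π : Plane → UnitAddTorus (Fin 2)}
    (hU : IsOpen U) (hπ : Continuous π) (hinj : Set.InjOn π U) (hg : IntegrableOn g U)
    (h : ∀ n : Fin 2 → ℤ, ∫ x in U, mFourier n (π x) * g x = 0) :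
    g =ᵐ[volume.restrict U] 0 := by
  refine ae_eq_zero_of_isCompact_subset hU hg (fun s hsU hs => ?_)
  have hF : IsClosed (π '' s) := (hs.image hπ).isClosed
  -- Continuous functions bounded by 1 and converging pointwise to the indicator of the closed image
  -- of s. By injectivity this indicator pulls back, on U, to that of s.
  let φ : ℕ → C(UnitAddTorus (Fin 2), ℂ) := fun n =>
    ⟨fun x => (((hF.apprSeq n x : NNReal) : ℝ) : ℂ), by fun_prop⟩
  have hlim : Filter.Tendsto (fun n => ∫ x in U, φ n (π x) * g x) Filter.atTop
      (nhds (∫ x in U, s.indicator g x)) := by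
    refine tendsto_integral_of_dominated_convergence (fun x => ‖g x‖) (fun n => ?_) hg.norm
      (fun n => Filter.Eventually.of_forall fun x => ?_) ?_
    · exact ((φ n).continuous.comp hπ).aestronglyMeasurable.mul hg.aestronglyMeasurable
    · have h1 : ((hF.apprSeq n (π x) : NNReal) : ℝ) ≤ 1 := by
        exact_mod_cast HasOuterApproxClosed.apprSeq_apply_le_one hF n (π x)
      rw [norm_mul]
      refine mul_le_of_le_one_left (norm_nonneg _) ?_
      change ‖(((hF.apprSeq n (π x) : NNReal) : ℝ) : ℂ)‖ ≤ 1
      rw [Complex.norm_real, Real.norm_of_nonneg (NNReal.coe_nonneg _)]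
      exact h1
    · filter_upwards [ae_restrict_mem hU.measurableSet] with x hx
      have h1 := (tendsto_pi_nhds.1 (HasOuterApproxClosed.tendsto_apprSeq hF)) (π x)
      have h2 : s.indicator g x =
          (((Set.indicator (π '' s) (fun _ => (1 : NNReal)) (π x) : NNReal) : ℝ) : ℂ) * g x := by
        by_cases hxs : x ∈ s
        · rw [Set.indicator_of_mem hxs, Set.indicator_of_mem (Set.mem_image_of_mem π hxs)]
          simp
        · rw [Set.indicator_of_notMem hxs, Set.indicator_of_notMem]
          · simp
          · rintro ⟨y, hy, hyx⟩
            exact hxs (hinj (hsU hy) hx hyx ▸ hy)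
      rw [h2]
      refine Filter.Tendsto.mul_const _ ?_
      exact (Complex.continuous_ofReal.tendsto _).comp ((NNReal.continuous_coe.tendsto _).comp h1)
  have hzero : (fun n => ∫ x in U, φ n (π x) * g x) = fun _ => 0 :=
    funext fun n => integral_comp_mul_eq_zero hπ hg h (φ n)
  rw [hzero, setIntegral_indicator hs.measurableSet, Set.inter_eq_right.2 hsU] at hlim
  exact (tendsto_nhds_unique tendsto_const_nhds hlim).symm

end Completeness

/-! ### Existence of a spectrum for the hexagon -/

section HexagonSpectrum

variable {Ω : Set Plane} {c A B C : Plane}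

lemma exists_dual_basis {P Q : Plane} (h : det2 P Q ≠ 0) :
    ∃ ξ η : Plane, (inner ℝ P ξ : ℝ) = 1 ∧ (inner ℝ Q ξ : ℝ) = 0 ∧ (inner ℝ P η : ℝ) = 0 ∧
      (inner ℝ Q η : ℝ) = 1 ∧
      ∀ w : Plane, w = (inner ℝ ξ w : ℝ) • P + (inner ℝ η w : ℝ) • Q := by
  have hi : ∀ u w : Plane, (inner ℝ w (rot u) : ℝ) = det2 u w := fun u w => by
    rw [real_inner_comm, inner_rot_left]
  have hs := det2_swap Q P
  refine ⟨(-(det2 P Q)⁻¹) • rot Q, (det2 P Q)⁻¹ • rot P, ?_, ?_, ?_, ?_, ?_⟩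
  · rw [inner_smul_right, hi, hs]; field_simp
  · rw [inner_smul_right, hi]; simp
  · rw [inner_smul_right, hi]; simp
  · rw [inner_smul_right, hi]; field_simp
  · intro w
    have h3 : det2 P Q • w = det2 w Q • P + det2 P w • Q := det2_cyclic_relation P w Q
    have e1 : (inner ℝ ((-(det2 P Q)⁻¹) • rot Q) w : ℝ) = (det2 P Q)⁻¹ * det2 w Q := by
      rw [real_inner_smul_left, inner_rot_left, det2_swap Q w]; ring
    have e2 : (inner ℝ ((det2 P Q)⁻¹ • rot P) w : ℝ) = (det2 P Q)⁻¹ * det2 P w := by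
      rw [real_inner_smul_left, inner_rot_left]
    rw [e1, e2, mul_smul, mul_smul, ← smul_add, ← h3, smul_smul, inv_mul_cancel₀ h, one_smul]

/-- The spectrum is the dual of the lattice L of A + B and B + C. Orthogonality follows from T ⊆ L,
and completeness from the packing property alone; neither T = L nor the tiling of the plane is
needed. -/
theorem IsSymmetricHexagon.isSpectral (h : IsSymmetricHexagon Ω c A B C) : IsSpectral Ω := by
  set P := A + B with hP
  set Q := B + C with hQ
  obtain ⟨ξ, η, h1, h2, h3, h4, hw⟩ := exists_dual_basis h.det_sum_pos.ne'
  set Λ : Set Plane := Set.range fun n : Fin 2 → ℤ => (n 0 : ℝ) • ξ + (n 1 : ℝ) • η with hΛ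
  have hpoly := h.isPolygon
  have hnull : volume (frontier Ω) = 0 := hpoly.convex.addHaar_frontier volume
  have hae : (interior Ω : Set Plane) =ᵐ[volume] Ω := interior_ae_eq_of_null_frontier hnull
  have hpos : 0 < volume Ω := (isOpen_interior.measure_pos volume hpoly.interior_nonempty).trans_le
    (measure_mono interior_subset)
  have hdual : ∀ n : Fin 2 → ℤ, (n 0 : ℝ) • ξ + (n 1 : ℝ) • η ∈ dualLattice (facetGroup Ω) := by
    intro n t ht
    refine inner_int_of_mem_closure ?_ t (h.facetGroup_le ht)
    rintro τ (rfl | rfl)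
    · exact ⟨n 0, by rw [inner_add_right, inner_smul_right, inner_smul_right, h1, h3]; ring⟩
    · exact ⟨n 1, by rw [inner_add_right, inner_smul_right, inner_smul_right, h2, h4]; ring⟩
  refine ⟨Λ, isSpectrum_of_orthogonal_eq_zero hpoly.isCompact.isBounded
    hpoly.isCompact.measurableSet hpos (Set.countable_range _) ?_ ?_⟩
  · rintro _ ⟨m, rfl⟩ _ ⟨n, rfl⟩ hne
    exact hpoly.ft_eq_zero_of_mem_dualLattice h.hasOppositeEdges (sub_ne_zero.2 hne)
      (sub_mem_dualLattice (hdual m) (hdual n))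
  · intro g hg hz
    have := isFiniteMeasure_restrict hpoly.isCompact.isBounded
    -- The quotient map by L in coordinates with respect to P and Q; packing is its injectivity on
    -- the interior.
    let π : Plane → UnitAddTorus (Fin 2) := fun x =>
      ![((inner ℝ ξ x : ℝ) : UnitAddCircle), ((inner ℝ η x : ℝ) : UnitAddCircle)]
    have hπ : Continuous π := by
      refine continuous_pi fun i => ?_
      fin_cases i
      · exact (AddCircle.continuous_mk' 1).comp (by fun_prop : Continuous fun x : Plane => (inner ℝ ξ x : ℝ))
      · exact (AddCircle.continuous_mk' 1).comp (by fun_prop : Continuous fun x : Plane => (inner ℝ η x : ℝ))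
    have hinj : Set.InjOn π (interior Ω) := by
      intro x hx y hy hxy
      have e0 : ((inner ℝ ξ x : ℝ) : UnitAddCircle) = ((inner ℝ ξ y : ℝ) : UnitAddCircle) :=
        congrFun hxy 0
      have e1 : ((inner ℝ η x : ℝ) : UnitAddCircle) = ((inner ℝ η y : ℝ) : UnitAddCircle) :=
        congrFun hxy 1
      rw [← sub_eq_zero, ← AddCircle.coe_sub, AddCircle.coe_eq_zero_iff] at e0 e1
      obtain ⟨m, hm⟩ := e0
      obtain ⟨n, hn⟩ := e1
      refine h.eq_of_sub_eq hx hy (m := m) (n := n) ?_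
      rw [hw (x - y), inner_sub_right, inner_sub_right, ← hm, ← hn]
      simp
    have hchar : ∀ (n : Fin 2 → ℤ) (x : Plane),
        UnitAddTorus.mFourier n (π x) = expFun ((n 0 : ℝ) • ξ + (n 1 : ℝ) • η) x := by
      intro n x
      change ∏ i, fourier (n i) (π x i) = _
      rw [Fin.prod_univ_two, expFun_eq, inner_add_left, ee_add, real_inner_smul_left,
        real_inner_smul_left]
      change fourier (n 0) ((inner ℝ ξ x : ℝ) : UnitAddCircle) *
        fourier (n 1) ((inner ℝ η x : ℝ) : UnitAddCircle) = _
      rw [fourier_coe_apply, fourier_coe_apply]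
      simp only [ee]
      push_cast
      congr 2 <;> ring
    have hg1 : IntegrableOn g (interior Ω) := by
      have : Integrable g (volume.restrict Ω) := hg.integrable (by norm_num)
      exact IntegrableOn.mono_set this interior_subset
    have key := ae_eq_zero_of_integral_mFourier_eq_zero isOpen_interior hπ hinj hg1 (by
      intro n
      -- Orthogonality pairs g with the conjugate exponential, hence the index -n; the boundary of Ω
      -- is null.
      rw [setIntegral_congr_set hae, ← hz ((-n 0 : ℝ) • ξ + (-n 1 : ℝ) • η)
        ⟨-n, by simp⟩]
      refine integral_congr_ae (Filter.Eventually.of_forall fun x => ?_)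
      simp only [hchar]
      congr 2
      module)
    rwa [Measure.restrict_congr_set hae] at key

lemma IsParallelogram.ncard_extremePoints_le (h : IsParallelogram Ω) :
    (Ω.extremePoints ℝ).ncard ≤ 4 := by
  obtain ⟨p, v, -, rfl⟩ := h
  rw [parallelepiped_eq_convexHull, ← convexHull_vadd]
  have hsub : (p +ᵥ ∑ i, ({0, v i} : Set Plane)) ⊆ {p, p + v 0, p + v 1, p + (v 0 + v 1)} := by
    rintro _ ⟨y, hy, rfl⟩
    rw [Fin.sum_univ_two] at hy
    obtain ⟨a, ha, b, hb, rfl⟩ := hy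
    rcases ha with rfl | rfl <;> rcases hb with rfl | rfl <;> simp
  refine (Set.ncard_le_ncard (extremePoints_convexHull_subset.trans hsub) (by simp)).trans ?_
  have h1 := Set.ncard_insert_le p {p + v 0, p + v 1, p + (v 0 + v 1)}
  have h2 := Set.ncard_insert_le (p + v 0) {p + v 1, p + (v 0 + v 1)}
  have h3 := Set.ncard_insert_le (p + v 1) {p + (v 0 + v 1)}
  simp only [Set.ncard_singleton] at h3
  omega

end HexagonSpectrum

end SpectralPolytope

end

/-! ### The two statements together -/

theorem theorem1p3 :
    (∀ Ω : Set (EuclideanSpace ℝ (Fin 2)),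
      SpectralPolytope.IsConvexHexagon Ω →
      SpectralPolytope.IsCentrallySymmetric Ω →
        SpectralPolytope.HasUniqueSpectrumUpToTranslation Ω ∧
        SpectralPolytope.IsLatticeSubgroup (SpectralPolytope.facetGroup Ω) ∧
        ∀ Λ : Set (EuclideanSpace ℝ (Fin 2)), SpectralPolytope.IsSpectrum Ω Λ ↔
          ∃ v : EuclideanSpace ℝ (Fin 2),
            Λ = v +ᵥ SpectralPolytope.dualLattice (SpectralPolytope.facetGroup Ω)) ∧
    (∀ Ω : Set (EuclideanSpace ℝ (Fin 2)),
      SpectralPolytope.IsConvexPolytope Ω →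
      SpectralPolytope.IsSpectral Ω →
      ¬ SpectralPolytope.IsParallelogram Ω →
        SpectralPolytope.IsCentrallySymmetric Ω ∧
        SpectralPolytope.HasUniqueSpectrumUpToTranslation Ω ∧
        SpectralPolytope.IsLatticeSubgroup (SpectralPolytope.facetGroup Ω) ∧
        ∀ Λ : Set (EuclideanSpace ℝ (Fin 2)), SpectralPolytope.IsSpectrum Ω Λ ↔
          ∃ v : EuclideanSpace ℝ (Fin 2),
            Λ = v +ᵥ SpectralPolytope.dualLattice (SpectralPolytope.facetGroup Ω)) := by
  refine ⟨fun Ω hhex hsym => ?_, fun Ω hP hs hnp => SpectralPolytope.spectral_polygon hP hs hnp⟩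
  have hnp : ¬ SpectralPolytope.IsParallelogram Ω := fun h => by
    have h4 := h.ncard_extremePoints_le
    rw [hhex.2] at h4
    omega
  obtain ⟨c, A, B, C, h⟩ := SpectralPolytope.exists_isSymmetricHexagon hhex hsym
  exact (SpectralPolytope.spectral_polygon hhex.1 h.isSpectral hnp).2
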